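/- Theorem 2. A tree network is a tree $T=(V,E)$ in which every vertex $v$ has a weight $w(v)\ge 0$ and every edge has a length $\ge 0$; its points are its vertices and the points on its edges, $d(v,x)$ is the length of the unique path from the vertex $v$ to the point $x$ (the length of a part of an edge being prorated), and the cost of $v$ at $x$ is $w(v)\,d(v,x)$. The weighted discrete $p$-center problem asks for $p$ points (centers) $c_1,\dots,c_p$ of $T$ that minimize $\max_{v\in V}\min_{1\le i\le p} w(v)\,d(v,c_i)$, together with this minimum value. Call a binary tree network (each vertex has at most two children) with $n$ vertices, rooted at a vertex $r$, $K$-balanced if its height is at most $K\log n$. There is a real RAM program (unit-cost exact arithmetic and comparisons on real numbers, unit-cost addition, subtraction, halving, comparison and indexing on integers that never exceed $(n+p)^{k}$, for a fixed $k$) such that for every constant $K$ there is a constant $C$ with the following property: for all $n\ge 2$ and $p\ge 1$, given $p$ and any $K$-balanced binary tree network with $n$ vertices (as its root, its array of parents, the lengths of the edges to the parents and the vertex weights), the program solves the weighted discrete $p$-center problem, i.e. outputs the minimum value and $p$ optimal centers, in at most $$C\,\bigl(n\log n+p^2\log^2(n/p)\bigr)$$ steps. In short, the weighted discrete $p$-center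 problem on balanced binary tree networks with $n$ vertices can be solved in $O(n\log n+p^2\log^2(n/p))$ time. -/

import Mathlib

/-! ## Tree networks and the weighted discrete `p`-center problem -/

/-- A tree network: a tree with non-negative edge lengths and non-negative vertex weights. -/
structure TreeNetwork (V : Type) where
  graph : SimpleGraph V
  isTree : graph.IsTree
  length : Sym2 V → ℝ
  length_nonneg : ∀ e ∈ graph.edgeSet, 0 ≤ length e
  weight : V → ℝ
  weight_nonneg : ∀ v, 0 ≤ weight v

namespace TreeNetwork

variable {V : Type} (N : TreeNetwork V)

/-- The unique path between two vertices. -/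
noncomputable def path (u v : V) : N.graph.Walk u v :=
  (N.isTree.existsUnique_path u v).choose

/-- The distance between two vertices: the total length of the edges of the path. -/
noncomputable def dist (u v : V) : ℝ :=
  ((N.path u v).edges.map N.length).sum

/-- The points of the network: the vertices, and for each edge `(u, v)` the points on it,
given by their distance `t` from `u`. (A vertex has several names; the distances agree.) -/
inductive Point : Type
  | vertex (v : V) : Point
  | edge (u v : V) (h : N.graph.Adj u v) (t : ℝ) (h0 : 0 ≤ t) (h1 : t ≤ N.length s(u, v)) : Point

/-- The distance from a vertex to a point, with prorated length on the edge of the point: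
the path enters that edge through one of its two ends. -/
noncomputable def distTo (w : V) : N.Point → ℝ
  | .vertex v => N.dist w v
  | .edge u v _ t _ _ => min (N.dist w u + t) (N.dist w v + (N.length s(u, v) - t))

/-- The cost of a vertex at a point. -/
noncomputable def cost (v : V) (x : N.Point) : ℝ := N.distTo v x * N.weight v

/-- Every vertex is `α`-covered by at least one of the `p` centers `c`. -/
def Covers {p : ℕ} (c : Fin p → N.Point) (α : ℝ) : Prop :=
  ∀ v, ∃ i, N.cost v (c i) ≤ α

/-- `α`-feasibility. -/
def Feasible (p : ℕ) (α : ℝ) : Prop := ∃ c : Fin p → N.Point, N.Covers c α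

/-- `c` is an optimal placement of `p` centers, and `α` is the optimal cost. -/
def IsOptimal {p : ℕ} (c : Fin p → N.Point) (α : ℝ) : Prop :=
  N.Covers c α ∧ ∀ β, N.Feasible p β → α ≤ β

/-- The parent of `v` when the tree is rooted at `r`: the second vertex on the path from `v`
to `r`; the parent of `r` is `r` itself. -/
noncomputable def parent (r v : V) : V := (N.path v r).snd

open Classical in
/-- The length of the edge from `v` to its parent, and `0` for the root. -/
noncomputable def parentLength (r v : V) : ℝ :=
  if v = r then 0 else N.length s(v, N.parent r v)

/-- Rooted at `r`, the tree is binary: each vertex has at most two children. -/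
def IsBinary (r : V) : Prop :=
  ∀ v, {u | u ≠ r ∧ N.parent r u = v}.encard ≤ 2

/-- Rooted at `r`, the tree has height at most `K log n`, where `n` is the number of vertices. -/
def IsBalanced (r : V) (K : ℝ) : Prop :=
  ∀ v, ((N.path v r).length : ℝ) ≤ K * Real.log (Nat.card V)

end TreeNetwork

/-! ## A real RAM

A program works on two kinds of cells: words (natural numbers of bounded size, used for counting
and for addresses) and real numbers. A program is a structured command over finitely many scalar
variables and one-dimensional arrays of each kind. Every operator, memory access, assignment and
test costs one time unit. Reals admit exact arithmetic and comparison only: there is no rounding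
and no conversion between reals and words. -/

namespace RealRAM

/-- The memory: scalars and arrays of words and of reals. -/
structure Store where
  ivar : ℕ → ℕ
  rvar : ℕ → ℝ
  iarr : ℕ → ℕ → ℕ
  rarr : ℕ → ℕ → ℝ

/-- Word expressions; `sub` is truncated subtraction and `half` is division by two, rounded
down. -/
inductive IExpr : Type
  | const (c : ℕ)
  | var (x : ℕ)
  | arr (a : ℕ) (i : IExpr)
  | add (e f : IExpr)
  | sub (e f : IExpr)
  | half (e : IExpr)

/-- Real expressions. -/
inductive RExpr : Type
  | const (q : ℚ)
  | var (x : ℕ)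
  | arr (a : ℕ) (i : IExpr)
  | add (e f : RExpr)
  | sub (e f : RExpr)
  | mul (e f : RExpr)
  | div (e f : RExpr)

/-- Tests. -/
inductive BExpr : Type
  | ile (e f : IExpr)
  | rle (e f : RExpr)
  | not (b : BExpr)
  | and (b c : BExpr)
  | or (b c : BExpr)

/-- The value of a word expression, where `W` is the largest word: an overflow is an error. -/
def IExpr.eval (W : ℕ) (σ : Store) : IExpr → Option ℕ
  | .const c => if c ≤ W then some c else none
  | .var x => some (σ.ivar x)
  | .arr a i => (i.eval W σ).map (σ.iarr a)
  | .add e f => do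
      let x ← e.eval W σ
      let y ← f.eval W σ
      if x + y ≤ W then some (x + y) else none
  | .sub e f => do
      let x ← e.eval W σ
      let y ← f.eval W σ
      some (x - y)
  | .half e => (e.eval W σ).map (· / 2)

/-- The value of a real expression: a division by zero is an error. -/
noncomputable def RExpr.eval (W : ℕ) (σ : Store) : RExpr → Option ℝ
  | .const q => some (q : ℝ)
  | .var x => some (σ.rvar x)
  | .arr a i => (i.eval W σ).map (σ.rarr a)
  | .add e f => do
      let x ← e.eval W σ
      let y ← f.eval W σ
      some (x + y)
  | .sub e f => do
      let x ← e.eval W σ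
      let y ← f.eval W σ
      some (x - y)
  | .mul e f => do
      let x ← e.eval W σ
      let y ← f.eval W σ
      some (x * y)
  | .div e f => do
      let x ← e.eval W σ
      let y ← f.eval W σ
      if y = 0 then none else some (x / y)

/-- The value of a test. -/
noncomputable def BExpr.eval (W : ℕ) (σ : Store) : BExpr → Option Bool
  | .ile e f => do
      let x ← e.eval W σ
      let y ← f.eval W σ
      some (decide (x ≤ y))
  | .rle e f => do
      let x ← e.eval W σ
      let y ← f.eval W σ
      some (decide (x ≤ y))
  | .not b => (b.eval W σ).map (!·)
  | .and b c => do
      let x ← b.eval W σ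
      let y ← c.eval W σ
      some (x && y)
  | .or b c => do
      let x ← b.eval W σ
      let y ← c.eval W σ
      some (x || y)

/-- The number of operations in a word expression. -/
def IExpr.ops : IExpr → ℕ
  | .const _ => 1
  | .var _ => 1
  | .arr _ i => i.ops + 1
  | .add e f => e.ops + f.ops + 1
  | .sub e f => e.ops + f.ops + 1
  | .half e => e.ops + 1

/-- The number of operations in a real expression. -/
def RExpr.ops : RExpr → ℕ
  | .const _ => 1
  | .var _ => 1
  | .arr _ i => i.ops + 1
  | .add e f => e.ops + f.ops + 1
  | .sub e f => e.ops + f.ops + 1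
  | .mul e f => e.ops + f.ops + 1
  | .div e f => e.ops + f.ops + 1

/-- The number of operations in a test. -/
def BExpr.ops : BExpr → ℕ
  | .ile e f => e.ops + f.ops + 1
  | .rle e f => e.ops + f.ops + 1
  | .not b => b.ops + 1
  | .and b c => b.ops + c.ops + 1
  | .or b c => b.ops + c.ops + 1

/-- Programs. -/
inductive Prog : Type
  | skip
  | iset (x : ℕ) (e : IExpr)
  | rset (x : ℕ) (e : RExpr)
  | istore (a : ℕ) (i : IExpr) (e : IExpr)
  | rstore (a : ℕ) (i : IExpr) (e : RExpr)
  | seq (c d : Prog)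
  | ite (b : BExpr) (c d : Prog)
  | loop (b : BExpr) (c : Prog)

/-- `Exec W c σ σ' t`: with largest word `W`, started in the memory `σ`, the program `c` halts
without error in the memory `σ'` after exactly `t` time units. `loop b c` repeats `c` while `b`
holds. -/
inductive Exec (W : ℕ) : Prog → Store → Store → ℕ → Prop
  | skip (σ : Store) : Exec W .skip σ σ 1
  | iset (σ : Store) (x : ℕ) (e : IExpr) (v : ℕ) (hv : e.eval W σ = some v) :
      Exec W (.iset x e) σ { σ with ivar := Function.update σ.ivar x v } (e.ops + 1)
  | rset (σ : Store) (x : ℕ) (e : RExpr) (v : ℝ) (hv : e.eval W σ = some v) :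
      Exec W (.rset x e) σ { σ with rvar := Function.update σ.rvar x v } (e.ops + 1)
  | istore (σ : Store) (a : ℕ) (i e : IExpr) (j v : ℕ)
      (hj : i.eval W σ = some j) (hv : e.eval W σ = some v) :
      Exec W (.istore a i e) σ
        { σ with iarr := Function.update σ.iarr a (Function.update (σ.iarr a) j v) }
        (i.ops + e.ops + 1)
  | rstore (σ : Store) (a : ℕ) (i : IExpr) (e : RExpr) (j : ℕ) (v : ℝ)
      (hj : i.eval W σ = some j) (hv : e.eval W σ = some v) :
      Exec W (.rstore a i e) σ
        { σ with rarr := Function.update σ.rarr a (Function.update (σ.rarr a) j v) }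
        (i.ops + e.ops + 1)
  | seq (σ σ₁ σ₂ : Store) (c d : Prog) (t₁ t₂ : ℕ)
      (hc : Exec W c σ σ₁ t₁) (hd : Exec W d σ₁ σ₂ t₂) : Exec W (.seq c d) σ σ₂ (t₁ + t₂)
  | ite_true (σ σ₁ : Store) (b : BExpr) (c d : Prog) (t : ℕ)
      (hb : b.eval W σ = some true) (hc : Exec W c σ σ₁ t) :
      Exec W (.ite b c d) σ σ₁ (b.ops + 1 + t)
  | ite_false (σ σ₁ : Store) (b : BExpr) (c d : Prog) (t : ℕ)
      (hb : b.eval W σ = some false) (hd : Exec W d σ σ₁ t) :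
      Exec W (.ite b c d) σ σ₁ (b.ops + 1 + t)
  | loop_false (σ : Store) (b : BExpr) (c : Prog) (hb : b.eval W σ = some false) :
      Exec W (.loop b c) σ σ (b.ops + 1)
  | loop_true (σ σ₁ σ₂ : Store) (b : BExpr) (c : Prog) (t₁ t₂ : ℕ)
      (hb : b.eval W σ = some true) (hc : Exec W c σ σ₁ t₁)
      (hl : Exec W (.loop b c) σ₁ σ₂ t₂) :
      Exec W (.loop b c) σ σ₂ (b.ops + 1 + t₁ + t₂)

end RealRAM

/-! ## Input and output -/

namespace TreeNetwork

/-- The input: word scalars `0, 1, 2` hold `n`, `p` and the root; word array `0` holds the parents;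
real arrays `0` and `1` hold the lengths of the edges to the parents and the vertex weights.
All other cells are `0`. -/
noncomputable def input {n : ℕ} (N : TreeNetwork (Fin n)) (r : Fin n) (p : ℕ) : RealRAM.Store where
  ivar x := if x = 0 then n else if x = 1 then p else if x = 2 then (r : ℕ) else 0
  rvar _ := 0
  iarr a i := if h : i < n then (if a = 0 then (N.parent r ⟨i, h⟩ : ℕ) else 0) else 0
  rarr a i := if h : i < n then
      (if a = 0 then N.parentLength r ⟨i, h⟩ else if a = 1 then N.weight ⟨i, h⟩ else 0)
    else 0

/-- The triple of numbers that names a point: `(v, v, 0)` for the vertex `v`, and `(u, v, t)` for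
the point at distance `t` from `u` on the edge `(u, v)`. -/
def Point.code {n : ℕ} {N : TreeNetwork (Fin n)} : N.Point → ℕ × ℕ × ℝ
  | .vertex v => (v, v, 0)
  | .edge u v _ t _ _ => (u, v, t)

/-- The output is a solution: real scalar `0` holds the optimal cost, and the `i`-th entries of
word arrays `1`, `2` and of real array `2` name the `i`-th center of an optimal placement. -/
def IsSolution {n : ℕ} (N : TreeNetwork (Fin n)) (p : ℕ) (σ : RealRAM.Store) : Prop :=
  ∃ c : Fin p → N.Point,
    (∀ i : Fin p, (σ.iarr 1 i, σ.iarr 2 i, σ.rarr 2 i) = (c i).code) ∧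
      N.IsOptimal c (σ.rvar 0)

end TreeNetwork

/-! For a fixed cost α, each vertex of positive weight w demands a center within the radius α / w. A
greedy sweep from the leaves to the root decides feasibility in linear time: every merged part is
summarized by one number, either the distance within which it still needs a center or the negated
distance to its nearest usable center, and a center is placed only where a demand would run out
inside an edge. The placed centers cover everything (`greedy_covers`). The sweep also leaves equally
many vertices whose discs are pairwise disjoint (`greedy_indep`), and no center serves two of these,
so the number of centers is minimal (`Labels.feasible_iff`).

The optimal cost is found by parametric search between an infeasible `lo` and a feasible `hi`. All
numbers of the sweep are affine in the cost, and a comparison is decided on the open interval unless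
one of three affine functions changes sign inside it. The symbolic run `pass` carries out what is
decided and blocks what depends on undecided comparisons. Decisions survive shrinking of the
interval (`pass_mono`). Once nothing is blocked, the number of centers is constant on the open
interval (`count_const`); since infeasible costs form an open set, it equals the number just above
`lo`, so `hi` is optimal (`Labels.le_of_feasible`).

To need only O(log n) feasibility tests, the steps of the sweep get weights: four times the weight
of the next step that waits for them. Then the waiting steps weigh at most a third of the active
ones (`three_mul_waiting_le`). Each round records the critical values of the steps that become ready
and tests the weighted median of the recorded values inside the interval, which halves the weight
inside. The potential, this weight plus three times the weight of the steps never considered, does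
not grow when values are recorded (`account_round`), and a test multiplies it by at most 3/4
(`exec_searchBody`). In a binary tree of height H the initial potential is at most 3n·16^H (`wt_le`,
`Labels.three_mul_unseenW_lt`), which is polynomial in n for H = O(log n), while a positive weight
inside is at least 1 (`one_le_inW`). Hence O(log n) rounds suffice.

A round takes linear time apart from sorting its new entries. At most 3n entries arise in the whole
search and each takes part in O(log n) merges of new entries, so sorting costs O(n log n) altogether
(`exec_sortProg`, `exec_collectProg`). Labelling the vertices away from the root takes one linear
sweep per level. The total is O(n log n + p), where p pays for writing the output; `cast_le_padding`
absorbs p into the bound. -/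

namespace RealRAM

/-! ### Values and definedness of expressions -/

/-- The value of a word expression when no overflow occurs. -/
def IExpr.val (σ : Store) : IExpr → ℕ
  | .const c => c
  | .var x => σ.ivar x
  | .arr a i => σ.iarr a (i.val σ)
  | .add e f => e.val σ + f.val σ
  | .sub e f => e.val σ - f.val σ
  | .half e => e.val σ / 2

/-- No overflow occurs in a word expression. -/
def IExpr.Ok (W : ℕ) (σ : Store) : IExpr → Prop
  | .const c => c ≤ W
  | .var _ => True
  | .arr _ i => i.Ok W σ
  | .add e f => e.Ok W σ ∧ f.Ok W σ ∧ e.val σ + f.val σ ≤ W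
  | .sub e f => e.Ok W σ ∧ f.Ok W σ
  | .half e => e.Ok W σ

theorem IExpr.eval_eq {W : ℕ} {σ : Store} (e : IExpr) (h : e.Ok W σ) :
    e.eval W σ = some (e.val σ) := by
  induction e with
  | const c => simpa [eval, val, Ok] using h
  | var x => rfl
  | arr a i ih => simp [eval, val, ih h]
  | add e f ihe ihf =>
    obtain ⟨h1, h2, h3⟩ := h
    simp [eval, val, ihe h1, ihf h2, h3]
  | sub e f ihe ihf =>
    obtain ⟨h1, h2⟩ := h
    simp [eval, val, ihe h1, ihf h2]
  | half e ih => simp [eval, val, ih h]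

/-- The value of a real expression when no error occurs. -/
noncomputable def RExpr.val (σ : Store) : RExpr → ℝ
  | .const q => (q : ℝ)
  | .var x => σ.rvar x
  | .arr a i => σ.rarr a (i.val σ)
  | .add e f => e.val σ + f.val σ
  | .sub e f => e.val σ - f.val σ
  | .mul e f => e.val σ * f.val σ
  | .div e f => e.val σ / f.val σ

/-- No error occurs in a real expression. -/
def RExpr.Ok (W : ℕ) (σ : Store) : RExpr → Prop
  | .const _ => True
  | .var _ => True
  | .arr _ i => i.Ok W σ
  | .add e f => e.Ok W σ ∧ f.Ok W σ
  | .sub e f => e.Ok W σ ∧ f.Ok W σ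
  | .mul e f => e.Ok W σ ∧ f.Ok W σ
  | .div e f => e.Ok W σ ∧ f.Ok W σ ∧ f.val σ ≠ 0

theorem RExpr.eval_eq {W : ℕ} {σ : Store} (e : RExpr) (h : e.Ok W σ) :
    e.eval W σ = some (e.val σ) := by
  induction e with
  | const c => rfl
  | var x => rfl
  | arr a i => simp [eval, val, i.eval_eq h]
  | add e f ihe ihf =>
    obtain ⟨h1, h2⟩ := h
    simp [eval, val, ihe h1, ihf h2]
  | sub e f ihe ihf =>
    obtain ⟨h1, h2⟩ := h
    simp [eval, val, ihe h1, ihf h2]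
  | mul e f ihe ihf =>
    obtain ⟨h1, h2⟩ := h
    simp [eval, val, ihe h1, ihf h2]
  | div e f ihe ihf =>
    obtain ⟨h1, h2, h3⟩ := h
    simp [eval, val, ihe h1, ihf h2, h3]

/-- The truth value of a test. -/
def BExpr.Holds (σ : Store) : BExpr → Prop
  | .ile e f => e.val σ ≤ f.val σ
  | .rle e f => e.val σ ≤ f.val σ
  | .not b => ¬ b.Holds σ
  | .and b c => b.Holds σ ∧ c.Holds σ
  | .or b c => b.Holds σ ∨ c.Holds σ

/-- No error occurs in a test. -/
def BExpr.Ok (W : ℕ) (σ : Store) : BExpr → Prop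
  | .ile e f => e.Ok W σ ∧ f.Ok W σ
  | .rle e f => e.Ok W σ ∧ f.Ok W σ
  | .not b => b.Ok W σ
  | .and b c => b.Ok W σ ∧ c.Ok W σ
  | .or b c => b.Ok W σ ∧ c.Ok W σ

open Classical in
theorem BExpr.eval_eq {W : ℕ} {σ : Store} (b : BExpr) (h : b.Ok W σ) :
    b.eval W σ = some (decide (b.Holds σ)) := by
  induction b with
  | ile e f => by_cases hh : e.val σ ≤ f.val σ <;>
      simp [eval, Holds, e.eval_eq h.1, f.eval_eq h.2, hh]
  | rle e f => by_cases hh : e.val σ ≤ f.val σ <;>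
      simp [eval, Holds, e.eval_eq h.1, f.eval_eq h.2, hh]
  | not b ih => by_cases hh : b.Holds σ <;> simp [eval, Holds, ih h, hh]
  | and b c ihb ihc => by_cases hh : b.Holds σ <;> by_cases hh' : c.Holds σ <;>
      simp [eval, Holds, ihb h.1, ihc h.2, hh, hh']
  | or b c ihb ihc => by_cases hh : b.Holds σ <;> by_cases hh' : c.Holds σ <;>
      simp [eval, Holds, ihb h.1, ihc h.2, hh, hh']

theorem BExpr.eval_true {W : ℕ} {σ : Store} {b : BExpr} (h : b.Ok W σ) (hb : b.Holds σ) :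
    b.eval W σ = some true := by
  rw [b.eval_eq h]; simp [hb]

theorem BExpr.eval_false {W : ℕ} {σ : Store} {b : BExpr} (h : b.Ok W σ) (hb : ¬ b.Holds σ) :
    b.eval W σ = some false := by
  rw [b.eval_eq h]; simp [hb]

/-! ### Updates of the memory -/

namespace Store

def setI (σ : Store) (x v : ℕ) : Store := { σ with ivar := Function.update σ.ivar x v }

def setR (σ : Store) (x : ℕ) (v : ℝ) : Store := { σ with rvar := Function.update σ.rvar x v }

def setIA (σ : Store) (a j v : ℕ) : Store :=
  { σ with iarr := Function.update σ.iarr a (Function.update (σ.iarr a) j v) }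

def setRA (σ : Store) (a j : ℕ) (v : ℝ) : Store :=
  { σ with rarr := Function.update σ.rarr a (Function.update (σ.rarr a) j v) }

variable (σ : Store) (a b x y v j : ℕ) (w : ℝ)

@[simp] theorem setI_ivar : (σ.setI x v).ivar y = if y = x then v else σ.ivar y := by
  simp [setI, Function.update_apply]
@[simp] theorem setI_rvar : (σ.setI x v).rvar = σ.rvar := rfl
@[simp] theorem setI_iarr : (σ.setI x v).iarr = σ.iarr := rfl
@[simp] theorem setI_rarr : (σ.setI x v).rarr = σ.rarr := rfl
@[simp] theorem setR_rvar : (σ.setR x w).rvar y = if y = x then w else σ.rvar y := by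
  simp [setR, Function.update_apply]
@[simp] theorem setR_ivar : (σ.setR x w).ivar = σ.ivar := rfl
@[simp] theorem setR_iarr : (σ.setR x w).iarr = σ.iarr := rfl
@[simp] theorem setR_rarr : (σ.setR x w).rarr = σ.rarr := rfl
@[simp] theorem setIA_iarr : (σ.setIA a j v).iarr b =
    if b = a then Function.update (σ.iarr a) j v else σ.iarr b := by
  simp [setIA, Function.update_apply]
@[simp] theorem setIA_ivar : (σ.setIA a j v).ivar = σ.ivar := rfl
@[simp] theorem setIA_rvar : (σ.setIA a j v).rvar = σ.rvar := rfl
@[simp] theorem setIA_rarr : (σ.setIA a j v).rarr = σ.rarr := rfl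
@[simp] theorem setRA_rarr : (σ.setRA a j w).rarr b =
    if b = a then Function.update (σ.rarr a) j w else σ.rarr b := by
  simp [setRA, Function.update_apply]
@[simp] theorem setRA_ivar : (σ.setRA a j w).ivar = σ.ivar := rfl
@[simp] theorem setRA_rvar : (σ.setRA a j w).rvar = σ.rvar := rfl
@[simp] theorem setRA_iarr : (σ.setRA a j w).iarr = σ.iarr := rfl

end Store

/-! ### Weakest preconditions and costs of loop-free programs -/

namespace Prog

/-- A sufficient precondition for a loop-free program to establish `Q`. -/
def wp (W : ℕ) : Prog → (Store → Prop) → Store → Prop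
  | .skip, Q, σ => Q σ
  | .iset x e, Q, σ => e.Ok W σ ∧ Q (σ.setI x (e.val σ))
  | .rset x e, Q, σ => e.Ok W σ ∧ Q (σ.setR x (e.val σ))
  | .istore a i e, Q, σ => i.Ok W σ ∧ e.Ok W σ ∧ Q (σ.setIA a (i.val σ) (e.val σ))
  | .rstore a i e, Q, σ => i.Ok W σ ∧ e.Ok W σ ∧ Q (σ.setRA a (i.val σ) (e.val σ))
  | .seq c d, Q, σ => c.wp W (d.wp W Q) σ
  | .ite b c d, Q, σ => b.Ok W σ ∧ (b.Holds σ → c.wp W Q σ) ∧ (¬ b.Holds σ → d.wp W Q σ)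
  | .loop _ _, _, _ => False

/-- An upper bound for the running time of a loop-free program. -/
def cost : Prog → ℕ
  | .skip => 1
  | .iset _ e => e.ops + 1
  | .rset _ e => e.ops + 1
  | .istore _ i e => i.ops + e.ops + 1
  | .rstore _ i e => i.ops + e.ops + 1
  | .seq c d => c.cost + d.cost
  | .ite b c d => b.ops + 1 + max c.cost d.cost
  | .loop _ _ => 0

/-- Loops never satisfy `wp`, so the value 0 that `cost` gives them is harmless. For straight-line
code both the correctness and the time bound become computations. -/
theorem wp_sound {W : ℕ} (c : Prog) {Q : Store → Prop} {σ : Store} (h : c.wp W Q σ) :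
    ∃ σ' t, Exec W c σ σ' t ∧ t ≤ c.cost ∧ Q σ' := by
  induction c generalizing Q σ with
  | skip => exact ⟨_, _, .skip σ, le_rfl, h⟩
  | iset x e => exact ⟨_, _, .iset σ x e _ (e.eval_eq h.1), le_rfl, h.2⟩
  | rset x e => exact ⟨_, _, .rset σ x e _ (e.eval_eq h.1), le_rfl, h.2⟩
  | istore a i e =>
    exact ⟨_, _, .istore σ a i e _ _ (i.eval_eq h.1) (e.eval_eq h.2.1), le_rfl, h.2.2⟩
  | rstore a i e =>
    exact ⟨_, _, .rstore σ a i e _ _ (i.eval_eq h.1) (e.eval_eq h.2.1), le_rfl, h.2.2⟩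
  | seq c d ihc ihd =>
    obtain ⟨σ₁, t₁, h₁, ht₁, hQ₁⟩ := ihc h
    obtain ⟨σ₂, t₂, h₂, ht₂, hQ₂⟩ := ihd hQ₁
    exact ⟨σ₂, _, .seq _ _ _ _ _ _ _ h₁ h₂, Nat.add_le_add ht₁ ht₂, hQ₂⟩
  | ite b c d ihc ihd =>
    obtain ⟨hb, hc, hd⟩ := h
    by_cases hh : b.Holds σ
    · obtain ⟨σ₁, t₁, h₁, ht₁, hQ₁⟩ := ihc (hc hh)
      exact ⟨σ₁, _, .ite_true _ _ _ _ _ _ (BExpr.eval_true hb hh) h₁,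
        Nat.add_le_add le_rfl (ht₁.trans (le_max_left _ _)), hQ₁⟩
    · obtain ⟨σ₁, t₁, h₁, ht₁, hQ₁⟩ := ihd (hd hh)
      exact ⟨σ₁, _, .ite_false _ _ _ _ _ _ (BExpr.eval_false hb hh) h₁,
        Nat.add_le_add le_rfl (ht₁.trans (le_max_right _ _)), hQ₁⟩
  | loop b c => exact h.elim

/-! ### Cells that a program does not write -/

def writesI (x : ℕ) : Prog → Bool
  | .iset y _ => x == y
  | .seq c d => c.writesI x || d.writesI x
  | .ite _ c d => c.writesI x || d.writesI x
  | .loop _ c => c.writesI x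
  | _ => false

def writesR (x : ℕ) : Prog → Bool
  | .rset y _ => x == y
  | .seq c d => c.writesR x || d.writesR x
  | .ite _ c d => c.writesR x || d.writesR x
  | .loop _ c => c.writesR x
  | _ => false

def writesIA (x : ℕ) : Prog → Bool
  | .istore y _ _ => x == y
  | .seq c d => c.writesIA x || d.writesIA x
  | .ite _ c d => c.writesIA x || d.writesIA x
  | .loop _ c => c.writesIA x
  | _ => false

def writesRA (x : ℕ) : Prog → Bool
  | .rstore y _ _ => x == y
  | .seq c d => c.writesRA x || d.writesRA x
  | .ite _ c d => c.writesRA x || d.writesRA x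
  | .loop _ c => c.writesRA x
  | _ => false

end Prog

/-- The two memories agree on all cells that the program does not write. -/
structure Frame (c : Prog) (σ σ' : Store) : Prop where
  i : ∀ x, c.writesI x = false → σ'.ivar x = σ.ivar x
  r : ∀ x, c.writesR x = false → σ'.rvar x = σ.rvar x
  ia : ∀ x, c.writesIA x = false → σ'.iarr x = σ.iarr x
  ra : ∀ x, c.writesRA x = false → σ'.rarr x = σ.rarr x

theorem Frame.refl (c : Prog) (σ : Store) : Frame c σ σ :=
  ⟨fun _ _ => rfl, fun _ _ => rfl, fun _ _ => rfl, fun _ _ => rfl⟩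

theorem Frame.trans {c : Prog} {σ σ₁ σ₂ : Store} (h : Frame c σ σ₁) (h' : Frame c σ₁ σ₂) :
    Frame c σ σ₂ :=
  ⟨fun x hx => (h'.i x hx).trans (h.i x hx), fun x hx => (h'.r x hx).trans (h.r x hx),
    fun x hx => (h'.ia x hx).trans (h.ia x hx), fun x hx => (h'.ra x hx).trans (h.ra x hx)⟩

/-- Since `writesI` and its companions are decidable on concrete programs, everything a program
leaves alone need not be carried along in loop invariants. -/
theorem Exec.frame {W : ℕ} {c : Prog} {σ σ' : Store} {t : ℕ} (h : Exec W c σ σ' t) :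
    Frame c σ σ' := by
  induction h with
  | skip σ => exact .refl _ _
  | iset σ x e v hv =>
    refine ⟨fun y hy => ?_, fun _ _ => rfl, fun _ _ => rfl, fun _ _ => rfl⟩
    have : y ≠ x := by simpa [Prog.writesI] using hy
    simp [this]
  | rset σ x e v hv =>
    refine ⟨fun _ _ => rfl, fun y hy => ?_, fun _ _ => rfl, fun _ _ => rfl⟩
    have : y ≠ x := by simpa [Prog.writesR] using hy
    simp [this]
  | istore σ a i e j v hj hv =>
    refine ⟨fun _ _ => rfl, fun _ _ => rfl, fun y hy => ?_, fun _ _ => rfl⟩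
    have : y ≠ a := by simpa [Prog.writesIA] using hy
    simp [this]
  | rstore σ a i e j v hj hv =>
    refine ⟨fun _ _ => rfl, fun _ _ => rfl, fun _ _ => rfl, fun y hy => ?_⟩
    have : y ≠ a := by simpa [Prog.writesRA] using hy
    simp [this]
  | seq σ σ₁ σ₂ c d t₁ t₂ hc hd ihc ihd =>
    constructor <;> intro x hx
    · simp only [Prog.writesI, Bool.or_eq_false_iff] at hx
      exact (ihd.i x hx.2).trans (ihc.i x hx.1)
    · simp only [Prog.writesR, Bool.or_eq_false_iff] at hx
      exact (ihd.r x hx.2).trans (ihc.r x hx.1)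
    · simp only [Prog.writesIA, Bool.or_eq_false_iff] at hx
      exact (ihd.ia x hx.2).trans (ihc.ia x hx.1)
    · simp only [Prog.writesRA, Bool.or_eq_false_iff] at hx
      exact (ihd.ra x hx.2).trans (ihc.ra x hx.1)
  | ite_true σ σ₁ b c d t hb hc ih =>
    constructor <;> intro x hx
    · simp only [Prog.writesI, Bool.or_eq_false_iff] at hx
      exact ih.i x hx.1
    · simp only [Prog.writesR, Bool.or_eq_false_iff] at hx
      exact ih.r x hx.1
    · simp only [Prog.writesIA, Bool.or_eq_false_iff] at hx
      exact ih.ia x hx.1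
    · simp only [Prog.writesRA, Bool.or_eq_false_iff] at hx
      exact ih.ra x hx.1
  | ite_false σ σ₁ b c d t hb hc ih =>
    constructor <;> intro x hx
    · simp only [Prog.writesI, Bool.or_eq_false_iff] at hx
      exact ih.i x hx.2
    · simp only [Prog.writesR, Bool.or_eq_false_iff] at hx
      exact ih.r x hx.2
    · simp only [Prog.writesIA, Bool.or_eq_false_iff] at hx
      exact ih.ia x hx.2
    · simp only [Prog.writesRA, Bool.or_eq_false_iff] at hx
      exact ih.ra x hx.2
  | loop_false σ b c hb => exact .refl _ _
  | loop_true σ σ₁ σ₂ b c t₁ t₂ hb hc hl ihc ihl =>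
    exact Frame.trans ⟨ihc.i, ihc.r, ihc.ia, ihc.ra⟩ ihl

/-! ### Loops -/

/-- A loop with an invariant `I m` that carries a budget `m` for the remaining time. -/
theorem exec_loop {W : ℕ} {b : BExpr} {c : Prog} (I : ℕ → Store → Prop) (σ₀ : Store) (m₀ : ℕ)
    (h₀ : I m₀ σ₀)
    (hb : ∀ m σ, Frame (.loop b c) σ₀ σ → I m σ → b.Ok W σ)
    (hstep : ∀ m σ, Frame (.loop b c) σ₀ σ → I m σ → b.Holds σ →
      ∃ σ' t m', Exec W c σ σ' t ∧ I m' σ' ∧ b.ops + 1 + t + m' ≤ m) :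
    ∃ σ' t m, Exec W (.loop b c) σ₀ σ' t ∧ I m σ' ∧ t + m ≤ m₀ + (b.ops + 1) ∧
      ¬ b.Holds σ' := by
  suffices H : ∀ m σ, Frame (.loop b c) σ₀ σ → I m σ →
      ∃ σ' t m', Exec W (.loop b c) σ σ' t ∧ I m' σ' ∧ t + m' ≤ m + (b.ops + 1) ∧
        ¬ b.Holds σ' from H m₀ σ₀ (.refl _ _) h₀
  intro m
  -- The budget strictly decreases, because every test costs at least one unit; this gives
  -- termination together with the time bound.
  induction m using Nat.strong_induction_on with
  | _ m ih =>
    intro σ hf hI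
    by_cases hh : b.Holds σ
    · obtain ⟨σ₁, t₁, m₁, he, hI₁, hm⟩ := hstep m σ hf hI hh
      have hf₁ := he.frame
      obtain ⟨σ₂, t₂, m₂, he₂, hI₂, hm₂, hn⟩ := ih m₁ (by omega) σ₁
        (hf.trans ⟨hf₁.i, hf₁.r, hf₁.ia, hf₁.ra⟩) hI₁
      exact ⟨σ₂, _, m₂, .loop_true _ _ _ _ _ _ _ (BExpr.eval_true (hb m σ hf hI) hh) he he₂, hI₂,
        by omega, hn⟩
    · exact ⟨σ, _, m, .loop_false _ _ _ (BExpr.eval_false (hb m σ hf hI) hh), hI, by omega, hh⟩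

/-- Run `c` while the counter `i` is smaller than the variable `l`, increasing it each time. -/
def forUp (i l : ℕ) (c : Prog) : Prog :=
  .loop (.not (.ile (.var l) (.var i))) (.seq c (.iset i (.add (.var i) (.const 1))))

/-- A counting loop whose running time is charged to the increase of `g`. -/
theorem exec_forUp_amortized {W i l : ℕ} {c : Prog} (I : ℕ → Store → Prop) (g : Store → ℕ)
    (T a b : ℕ) {σ₀ : Store}
    (hi : c.writesI i = false) (hl : (forUp i l c).writesI l = false)
    (ha : σ₀.ivar i = a) (hb : σ₀.ivar l = b) (hab : a ≤ b) (hW : b ≤ W) (hW1 : 1 ≤ W)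
    (h₀ : I a σ₀)
    (hstep : ∀ j σ, a ≤ j → j < b → σ.ivar i = j → Frame (forUp i l c) σ₀ σ → I j σ →
      ∃ σ' t, Exec W c σ σ' t ∧ t + g σ ≤ T + g (σ'.setI i (j + 1)) ∧
        I (j + 1) (σ'.setI i (j + 1))) :
    ∃ σ' t, Exec W (forUp i l c) σ₀ σ' t ∧ t + g σ₀ ≤ (b - a) * (T + 9) + 5 + g σ' ∧ I b σ' ∧
      σ'.ivar i = b := by
  -- Here `d` counts the remaining iterations. Each costs nine units beyond the body, five for the
  -- test and four for the increment; the last test, which fails, costs the additional five.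
  suffices H : ∀ d j σ, j + d = b → a ≤ j → σ.ivar i = j → Frame (forUp i l c) σ₀ σ → I j σ →
      ∃ σ' t, Exec W (forUp i l c) σ σ' t ∧ t + g σ ≤ d * (T + 9) + 5 + g σ' ∧ I b σ' ∧
        σ'.ivar i = b from H (b - a) a σ₀ (by omega) le_rfl ha (.refl _ _) h₀
  intro d
  induction d with
  | zero =>
    intro j σ hj _ hji hf hI
    obtain rfl : j = b := by omega
    have hlb : σ.ivar l = j := (hf.i l hl).trans hb
    refine ⟨σ, _, .loop_false _ _ _ (BExpr.eval_false ⟨trivial, trivial⟩ ?_), ?_, hI, hji⟩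
    · simp [BExpr.Holds, IExpr.val, hlb, hji]
    · simp [BExpr.ops, IExpr.ops]
  | succ d ih =>
    intro j σ hj haj hji hf hI
    have hlb : σ.ivar l = b := (hf.i l hl).trans hb
    obtain ⟨σ₁, t₁, he₁, ht₁, hI₁⟩ := hstep j σ haj (by omega) hji hf hI
    have hi₁ : σ₁.ivar i = j := (he₁.frame.i i hi).trans hji
    have hok : (IExpr.add (.var i) (.const 1)).Ok W σ₁ :=
      ⟨trivial, hW1, by simp [IExpr.val, hi₁]; omega⟩
    have hv : (IExpr.add (.var i) (.const 1)).val σ₁ = j + 1 := by simp [IExpr.val, hi₁]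
    have he₂ := Exec.iset σ₁ i _ _ (IExpr.eval_eq _ hok)
    rw [hv] at he₂
    have he₃ := Exec.seq _ _ _ _ _ _ _ he₁ he₂
    have hf₃ := he₃.frame
    obtain ⟨σ₂, t₂, h1, h2, h3, h4⟩ := ih (j + 1) (σ₁.setI i (j + 1)) (by omega) (by omega)
      (by simp) (hf.trans ⟨hf₃.i, hf₃.r, hf₃.ia, hf₃.ra⟩) hI₁
    refine ⟨σ₂, _, .loop_true _ _ _ _ _ _ _ (BExpr.eval_true ⟨trivial, trivial⟩ ?_) he₃ h1, ?_,
      h3, h4⟩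
    · simp [BExpr.Holds, IExpr.val, hlb, hji]; omega
    · simp only [BExpr.ops, IExpr.ops]
      have : (d + 1) * (T + 9) = d * (T + 9) + T + 9 := by ring
      omega

theorem exec_forUp {W i l : ℕ} {c : Prog} (I : ℕ → Store → Prop) (T a b : ℕ) {σ₀ : Store}
    (hi : c.writesI i = false) (hl : (forUp i l c).writesI l = false)
    (ha : σ₀.ivar i = a) (hb : σ₀.ivar l = b) (hab : a ≤ b) (hW : b ≤ W) (hW1 : 1 ≤ W)
    (h₀ : I a σ₀)
    (hstep : ∀ j σ, a ≤ j → j < b → σ.ivar i = j → Frame (forUp i l c) σ₀ σ → I j σ →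
      ∃ σ' t, Exec W c σ σ' t ∧ t ≤ T ∧ I (j + 1) (σ'.setI i (j + 1))) :
    ∃ σ' t, Exec W (forUp i l c) σ₀ σ' t ∧ t ≤ (b - a) * (T + 9) + 5 ∧ I b σ' ∧
      σ'.ivar i = b := by
  simpa using exec_forUp_amortized I (fun _ => 0) T a b hi hl ha hb hab hW hW1 h₀
    (by simpa using hstep)

attribute [simp] IExpr.val IExpr.Ok RExpr.val RExpr.Ok BExpr.Holds BExpr.Ok Prog.wp

end RealRAM

/-! ### Greedy placement of centers for a fixed cost, and its optimality. -/

namespace PCenter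

/-! ### The greedy algorithm on a tree with vertices `0, …, n - 1` and `par i < i` -/

/-- A rooted tree on `0, …, n - 1` whose labels increase away from the root `0`. -/
structure Shape (n : ℕ) (par : ℕ → ℕ) (len : ℕ → ℝ) : Prop where
  par_lt : ∀ i, 0 < i → i < n → par i < i
  len_nonneg : ∀ i, 0 < i → i < n → 0 ≤ len i

/-- `y` is closer to zero than `a`; ties are resolved in favour of negative numbers. -/
def Closer (y a : ℝ) : Prop := y * y < a * a ∨ (y * y ≤ a * a ∧ y < 0)

/-- The state of the greedy algorithm. A value `acc v ≥ 0` is the distance within which the part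
that is already merged into `v` needs a center; a value `acc v < 0` tells that there is a center
at distance `-acc v`. The list `cs` holds the centers `(i, t)` placed so far, at distance `t`
from `i` on the edge to the parent of `i`. -/
structure GState where
  acc : ℕ → ℝ
  cs : List (ℕ × ℝ)

-- One subtraction serves both signs: along the edge a demand loses `len i` of its reach, and an
-- existing center gets farther away by `len i`. A change from a nonnegative to a negative value
-- means that the demand runs out inside the edge, so a center is placed at the last possible point.
open Classical in
noncomputable def gstep (par : ℕ → ℕ) (len : ℕ → ℝ) (i : ℕ) (s : GState) : GState where
  acc := if Closer (s.acc i - len i) (s.acc (par i)) then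
    Function.update s.acc (par i) (s.acc i - len i) else s.acc
  cs := if 0 ≤ s.acc i ∧ s.acc i - len i < 0 then s.cs ++ [(i, s.acc i)] else s.cs

/-- The state after merging the vertices `n - 1, …, n - k` into their parents. -/
noncomputable def greedy (n : ℕ) (par : ℕ → ℕ) (len R : ℕ → ℝ) : ℕ → GState
  | 0 => ⟨R, []⟩
  | k + 1 => gstep par len (n - 1 - k) (greedy n par len R k)

/-- The number of centers placed below the root, and at the root. -/
noncomputable def GState.count (s : GState) : ℕ := s.cs.length + if 0 ≤ s.acc 0 then 1 else 0

/-- The root of the merged part that contains `u`, after `k` steps. -/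
def top (n : ℕ) (par : ℕ → ℕ) : ℕ → ℕ → ℕ
  | 0, u => u
  | k + 1, u => if top n par k u = n - 1 - k then par (n - 1 - k) else top n par k u

variable {n : ℕ} {par : ℕ → ℕ} {len R rd : ℕ → ℝ}

theorem top_lt (hs : Shape n par len) {k : ℕ} (hk : k < n) {u : ℕ} (hu : u < n) :
    top n par k u < n - k := by
  induction k with
  | zero => simpa [top] using hu
  | succ k ih =>
    have h := ih (by omega)
    simp only [top]
    split_ifs with h1
    · have := hs.par_lt (n - 1 - k) (by omega) (by omega); omega
    · omega

theorem top_self {k : ℕ} {u : ℕ} (hu : u < n - k) : top n par k u = u := by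
  induction k with
  | zero => rfl
  | succ k ih =>
    simp only [top]
    rw [ih (by omega), if_neg (by omega)]

/-- An edge that has been processed joins vertices of the same part; this keeps functions defined
part by part Lipschitz across it. -/
theorem top_par (hs : Shape n par len) {k : ℕ} (hk : k < n) {u : ℕ} (hu : u < n)
    (hu' : n - k ≤ u) : top n par k (par u) = top n par k u := by
  induction k with
  | zero => omega
  | succ k ih =>
    simp only [top]
    rcases Nat.lt_or_ge u (n - k) with h | h
    · have hu1 : u = n - 1 - k := by omega
      have := hs.par_lt u (by omega) hu
      rw [top_self (u := u) h, top_self (u := par u) (by omega), if_neg (by omega), if_pos hu1, hu1]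
    · rw [ih (by omega) h]

theorem merged_iff {k u v : ℕ} :
    top n par (k + 1) u = v ↔
      (top n par k u = n - 1 - k ∧ par (n - 1 - k) = v) ∨
      (top n par k u ≠ n - 1 - k ∧ top n par k u = v) := by
  simp only [top]
  split_ifs with h <;> simp [h]

/-- The values that result from merging: the smaller one in absolute value is kept. -/
theorem closer_cases (y a : ℝ) :
    (Closer y a ∧ |y| ≤ |a| ∧ (|y| = |a| → y < 0)) ∨
      (¬ Closer y a ∧ |a| ≤ |y| ∧ (|y| = |a| → 0 ≤ y)) := by
  by_cases h : Closer y a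
  · refine .inl ⟨h, ?_, ?_⟩
    · rcases h with h | h
      · exact (abs_lt_iff_mul_self_lt.mpr h).le
      · exact abs_le_iff_mul_self_le.mpr h.1
    · intro he
      rcases h with h | h
      · exact absurd he (abs_lt_iff_mul_self_lt.mpr h).ne
      · exact h.2
  · refine .inr ⟨h, ?_, ?_⟩
    · by_contra hc
      exact h (.inl (abs_lt_iff_mul_self_lt.mp (not_le.mp hc)))
    · intro he
      by_contra hc
      exact h (.inr ⟨abs_le_iff_mul_self_le.mp he.le, not_le.mp hc⟩)

/-! #### The centers cover all vertices -/

/-- What the state says about the merged set `S` at `v`, for the value `z`. -/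
def Served (R rd : ℕ → ℝ) (δ : ℕ → ℕ × ℝ → ℝ) (cs : List (ℕ × ℝ)) (S : Set ℕ) (v : ℕ) (z : ℝ) :
    Prop :=
  (z < 0 → ∃ c ∈ cs, δ v c ≤ -z) ∧
    ∀ u ∈ S, (∃ c ∈ cs, δ u c ≤ R u) ∨ (0 ≤ z ∧ z ≤ R u - (rd u - rd v))

theorem Served.mono {δ : ℕ → ℕ × ℝ → ℝ} {cs cs' : List (ℕ × ℝ)} {S : Set ℕ} {v : ℕ} {z : ℝ}
    (h : Served R rd δ cs S v z) (hc : cs ⊆ cs') : Served R rd δ cs' S v z := by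
  refine ⟨fun hz => ?_, fun u hu => ?_⟩
  · obtain ⟨c, h1, h2⟩ := h.1 hz
    exact ⟨c, hc h1, h2⟩
  · rcases h.2 u hu with ⟨c, h1, h2⟩ | h
    · exact .inl ⟨c, hc h1, h2⟩
    · exact .inr h

/-- The value closer to zero suffices. If it stands for a center, that center is near enough for the
demand `z'` of the other part; if it stands for a demand, that demand is the stricter of the two. -/
theorem Served.merge {δ : ℕ → ℕ × ℝ → ℝ} {cs : List (ℕ × ℝ)} {S S' : Set ℕ} {v : ℕ} {z z' : ℝ}
    (h : Served R rd δ cs S v z) (h' : Served R rd δ cs S' v z') (hz : |z| ≤ |z'|)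
    (hd : ∀ u ∈ S', ∀ c, δ u c ≤ rd u - rd v + δ v c) : Served R rd δ cs (S ∪ S') v z := by
  refine ⟨h.1, ?_⟩
  rintro u (hu | hu)
  · exact h.2 u hu
  · rcases h'.2 u hu with h2 | ⟨h2, h3⟩
    · exact .inl h2
    · rw [abs_of_nonneg h2] at hz
      rcases lt_or_ge z 0 with hn | hn
      · obtain ⟨c, hc, hc'⟩ := h.1 hn
        rw [abs_of_neg hn] at hz
        exact .inl ⟨c, hc, by linarith [hd u hu c]⟩
      · rw [abs_of_nonneg hn] at hz
        exact .inr ⟨hn, by linarith⟩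

/-- The distance `δ` to centers is abstract: only its change along an edge and its values at the
ends of the edge of a center matter. The bound through `top` carries a center found at the root of a
part down to all vertices of the part. -/
theorem greedy_served (hs : Shape n par len) (hR : ∀ i < n, 0 ≤ R i)
    (hrd : ∀ i, 0 < i → i < n → rd i = rd (par i) + len i) {δ : ℕ → ℕ × ℝ → ℝ}
    (hδ : ∀ i, 0 < i → i < n → ∀ c, δ i c ≤ len i + δ (par i) c ∧ δ (par i) c ≤ len i + δ i c)
    (hc : ∀ i t, 0 < i → i < n → 0 ≤ t → t ≤ len i →
      δ i (i, t) ≤ t ∧ δ (par i) (i, t) ≤ len i - t)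
    {k : ℕ} (hk : k < n) :
    (∀ v < n - k, Served R rd δ (greedy n par len R k).cs {u | u < n ∧ top n par k u = v} v
        ((greedy n par len R k).acc v)) ∧
      (∀ u < n, ∀ c, δ u c ≤ rd u - rd (top n par k u) + δ (top n par k u) c) ∧
      ∀ c ∈ (greedy n par len R k).cs, 0 < c.1 ∧ c.1 < n ∧ 0 ≤ c.2 ∧ c.2 ≤ len c.1 := by
  induction k with
  | zero =>
    refine ⟨fun v hv => ⟨fun h => absurd (hR v (by omega)) (not_le.mpr h), ?_⟩, ?_, ?_⟩
    · rintro u ⟨hu, rfl⟩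
      exact .inr ⟨hR _ hu, by simp [top, greedy]⟩
    · intro u hu c; simp [top]
    · simp [greedy]
  | succ k ih =>
    obtain ⟨h1, h2, h3⟩ := ih (by omega)
    set s := greedy n par len R k with hsd
    set i := n - 1 - k with hi
    have hi0 : 0 < i := by omega
    have hin : i < n := by omega
    have hpi := hs.par_lt i hi0 hin
    have hli := hs.len_nonneg i hi0 hin
    have hgr : greedy n par len R (k + 1) = gstep par len i s := rfl
    have hδi := hδ i hi0 hin
    have hrdi := hrd i hi0 hin
    have h2' : ∀ u < n, ∀ c, δ u c ≤ rd u - rd (top n par (k + 1) u) +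
        δ (top n par (k + 1) u) c := by
      intro u hu c
      have := h2 u hu c
      simp only [top]
      split_ifs with h
      · rw [h] at this
        have := (hδi c).1
        linarith
      · exact this
    have hcs : s.cs ⊆ (gstep par len i s).cs := by
      simp only [gstep]; split_ifs <;> simp
    -- the part of `i`, seen from its parent
    have hS : Served R rd δ (gstep par len i s).cs {u | u < n ∧ top n par k u = i} (par i)
        (s.acc i - len i) := by
      have hi1 := h1 i (by omega)
      rcases lt_or_ge (s.acc i) 0 with hx | hx
      · refine ⟨fun _ => ?_, fun u hu => ?_⟩
        · obtain ⟨c, hc1, hc2⟩ := hi1.1 hx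
          exact ⟨c, hcs hc1, by linarith [(hδi c).2]⟩
        · rcases hi1.2 u hu with ⟨c, hc1, hc2⟩ | h
          · exact .inl ⟨c, hcs hc1, hc2⟩
          · linarith [h.1]
      · rcases lt_or_ge (s.acc i - len i) 0 with hy | hy
        -- The new center lies as far up as the demand permits; its distance `len i - s.acc i` from
        -- the parent is the negated new value.
        · have hmem : (i, s.acc i) ∈ (gstep par len i s).cs := by
            simp [gstep, hx, hy]
          obtain ⟨hc1, hc2⟩ := hc i (s.acc i) hi0 hin hx (by linarith)
          refine ⟨fun _ => ⟨_, hmem, by linarith⟩, fun u hu => ?_⟩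
          rcases hi1.2 u hu with ⟨c, hc1, hc2⟩ | h
          · exact .inl ⟨c, hcs hc1, hc2⟩
          · refine .inl ⟨_, hmem, ?_⟩
            have := h2 u hu.1 (i, s.acc i)
            rw [hu.2] at this
            linarith [h.2]
        · refine ⟨fun h => absurd hy (not_le.mpr h), fun u hu => ?_⟩
          rcases hi1.2 u hu with ⟨c, hc1, hc2⟩ | h
          · exact .inl ⟨c, hcs hc1, hc2⟩
          · exact .inr ⟨hy, by linarith [h.2]⟩
    refine ⟨fun v hv => ?_, h2', ?_⟩
    · rw [hgr]
      by_cases hvp : v = par i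
      · subst hvp
        have hP := (h1 (par i) (by omega)).mono hcs
        have hset : {u | u < n ∧ top n par (k + 1) u = par i} =
            {u | u < n ∧ top n par k u = i} ∪ {u | u < n ∧ top n par k u = par i} := by
          ext u
          simp only [Set.mem_ofPred_eq, Set.mem_union, merged_iff, ← hi]
          constructor
          · rintro ⟨h, ⟨h', -⟩ | ⟨-, h'⟩⟩
            · exact .inl ⟨h, h'⟩
            · exact .inr ⟨h, h'⟩
          · rintro (⟨h, h'⟩ | ⟨h, h'⟩)
            · exact ⟨h, .inl ⟨h', trivial⟩⟩
            · exact ⟨h, .inr ⟨by omega, h'⟩⟩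
        rw [hset]
        rcases closer_cases (s.acc i - len i) (s.acc (par i)) with ⟨hcl, hle, -⟩ | ⟨hcl, hle, -⟩
        · have : (gstep par len i s).acc (par i) = s.acc i - len i := by simp [gstep, hcl]
          rw [this]
          refine hS.merge hP hle ?_
          rintro u ⟨hu, hu'⟩ c
          have := h2 u hu c
          rwa [hu'] at this
        · have : (gstep par len i s).acc (par i) = s.acc (par i) := by simp [gstep, hcl]
          rw [this, Set.union_comm]
          refine hP.merge hS hle ?_
          rintro u ⟨hu, hu'⟩ c
          have := h2 u hu c
          rw [hu'] at this
          linarith [(hδi c).1]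
      · have hacc : (gstep par len i s).acc v = s.acc v := by
          simp only [gstep]; split_ifs <;> simp [hvp]
        rw [hacc]
        have hset : {u | u < n ∧ top n par (k + 1) u = v} = {u | u < n ∧ top n par k u = v} := by
          ext u
          simp only [Set.mem_ofPred_eq, merged_iff, ← hi]
          constructor
          · rintro ⟨h, ⟨-, h'⟩ | ⟨-, h'⟩⟩
            · exact absurd h'.symm hvp
            · exact ⟨h, h'⟩
          · rintro ⟨h, h'⟩
            exact ⟨h, .inr ⟨by omega, h'⟩⟩
        rw [hset]
        exact (h1 v (by omega)).mono hcs
    · intro c hcm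
      rw [hgr] at hcm
      simp only [gstep] at hcm
      split_ifs at hcm with h
      · rcases List.mem_append.mp hcm with h' | h'
        · exact h3 c h'
        · rw [List.mem_singleton] at h'
          subst h'
          exact ⟨hi0, hin, h.1, by simpa using h.2.le⟩
      · exact h3 c hcm

/-! #### A set of vertices that needs that many centers -/

/-- In the merged set `S` at `v` with value `z`, the chosen vertices `I` are far from the outside,
except for one that is responsible for a value `z ≥ 0`. -/
def Spread (R rd : ℕ → ℝ) (I : Finset ℕ) (S : Set ℕ) (v : ℕ) (z : ℝ) : Prop :=
  (z < 0 → ∀ w ∈ I, w ∈ S → R w - (rd w - rd v) ≤ z) ∧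
    (0 ≤ z → ∃ w₀ ∈ I, w₀ ∈ S ∧ R w₀ - (rd w₀ - rd v) = z ∧
      ∀ w ∈ I, w ∈ S → w ≠ w₀ → R w - (rd w - rd v) < -z)

/-- The chosen vertices are pairwise independent. -/
def Indep (R : ℕ → ℝ) (D : ℕ → ℕ → ℝ) (I : Finset ℕ) (S : Set ℕ) : Prop :=
  ∀ w ∈ I, w ∈ S → ∀ w' ∈ I, w' ∈ S → w ≠ w' → R w + R w' < D w w'

-- The number `R w - (rd w - rd v)` tells how far the disc of `w` reaches beyond `v`. Discs from
-- different parts are disjoint when the sum of these reaches is negative. A losing demand could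
-- violate this through the one vertex responsible for it, which is dropped. If a demand wins
-- against a center, the tie rule makes the inequality between absolute values strict, and this
-- yields the strict inequality of `Indep`.
open Classical in
theorem Spread.merge {D : ℕ → ℕ → ℝ} {I : Finset ℕ} {S S' : Set ℕ} {v : ℕ} {z z' : ℝ}
    (h : Spread R rd I S v z) (h' : Spread R rd I S' v z') (hz : |z| ≤ |z'|)
    (ht : |z| = |z'| → 0 ≤ z → 0 ≤ z') (hd : Disjoint S S')
    (hI : Indep R D I S) (hI' : Indep R D I S')
    (hD : ∀ w ∈ S, ∀ w' ∈ S', (rd w - rd v) + (rd w' - rd v) ≤ D w w' ∧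
      (rd w - rd v) + (rd w' - rd v) ≤ D w' w) :
    ∃ J ⊆ I, (∀ w ∈ I, w ∉ S' → w ∈ J) ∧ Spread R rd J (S ∪ S') v z ∧ Indep R D J (S ∪ S') ∧
      I.card = J.card + if 0 ≤ z' then 1 else 0 := by
  have hdis : ∀ {w}, w ∈ S → w ∉ S' := fun hw hw' => (Set.disjoint_left.mp hd) hw hw'
  -- it suffices to bound the chosen vertices of the loser
  have key : ∀ J ⊆ I, (∀ w ∈ I, w ∉ S' → w ∈ J) →
      (z < 0 → ∀ w ∈ J, w ∈ S' → R w - (rd w - rd v) ≤ z) →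
      (0 ≤ z → ∀ w ∈ J, w ∈ S' → R w - (rd w - rd v) < -z) →
      Spread R rd J (S ∪ S') v z ∧ Indep R D J (S ∪ S') := by
    intro J hJ hJ' hneg hpos
    have hcross : ∀ w ∈ J, w ∈ S → ∀ w' ∈ J, w' ∈ S' →
        R w + R w' < (rd w - rd v) + (rd w' - rd v) := by
      intro w hw hwS w' hw' hwS'
      rcases lt_or_ge z 0 with hz0 | hz0
      · linarith [h.1 hz0 w (hJ hw) hwS, hneg hz0 w' hw' hwS']
      · obtain ⟨w₀, h0, h0S, h0z, h0o⟩ := h.2 hz0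
        have h1 := hpos hz0 w' hw' hwS'
        by_cases hww : w = w₀
        · subst hww; linarith
        · linarith [h0o w (hJ hw) hwS hww]
    refine ⟨⟨fun hz0 w hw hwS => ?_, fun hz0 => ?_⟩, ?_⟩
    · rcases hwS with hwS | hwS
      · exact h.1 hz0 w (hJ hw) hwS
      · exact hneg hz0 w hw hwS
    · obtain ⟨w₀, h0, h0S, h0z, h0o⟩ := h.2 hz0
      refine ⟨w₀, hJ' _ h0 (hdis h0S), .inl h0S, h0z, fun w hw hwS hww => ?_⟩
      rcases hwS with hwS | hwS
      · exact h0o w (hJ hw) hwS hww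
      · exact hpos hz0 w hw hwS
    · intro w hw hwS w' hw' hwS' hne
      rcases hwS with hwS | hwS <;> rcases hwS' with hwS' | hwS'
      · exact hI w (hJ hw) hwS w' (hJ hw') hwS' hne
      · exact (hcross w hw hwS w' hw' hwS').trans_le (hD w hwS w' hwS').1
      · have := (hcross w' hw' hwS' w hw hwS).trans_le (hD w' hwS' w hwS).2
        linarith
      · exact hI' w (hJ hw) hwS w' (hJ hw') hwS' hne
  rcases lt_or_ge z' 0 with hz' | hz'
  · refine ⟨I, subset_rfl, fun w hw _ => hw, ?_⟩
    rw [if_neg (not_le.mpr hz')]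
    rw [abs_of_neg hz'] at hz ht
    refine ⟨?_, ?_, rfl⟩ <;> [refine (key I subset_rfl (fun w hw _ => hw) ?_ ?_).1;
      refine (key I subset_rfl (fun w hw _ => hw) ?_ ?_).2]
    all_goals
      intro hz0 w hw hwS
      have h1 := h'.1 hz' w hw hwS
    · rw [abs_of_neg hz0] at hz; linarith
    · rw [abs_of_nonneg hz0] at hz ht
      rcases hz.lt_or_eq with h2 | h2
      · linarith
      · linarith [ht h2 hz0]
    · rw [abs_of_neg hz0] at hz; linarith
    · rw [abs_of_nonneg hz0] at hz ht
      rcases hz.lt_or_eq with h2 | h2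
      · linarith
      · linarith [ht h2 hz0]
  · obtain ⟨w₁, h1, h1S, h1z, h1o⟩ := h'.2 hz'
    rw [abs_of_nonneg hz'] at hz
    refine ⟨I.erase w₁, Finset.erase_subset _ _, fun w hw hwS => ?_, ?_⟩
    · exact Finset.mem_erase.mpr ⟨fun h => hwS (h ▸ h1S), hw⟩
    have hk := key (I.erase w₁) (Finset.erase_subset _ _)
      (fun w hw hwS => Finset.mem_erase.mpr ⟨fun h => hwS (h ▸ h1S), hw⟩)
      (fun hz0 w hw hwS => by
        rw [Finset.mem_erase] at hw
        have := h1o w hw.2 hwS hw.1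
        rw [abs_of_neg hz0] at hz; linarith)
      (fun hz0 w hw hwS => by
        rw [Finset.mem_erase] at hw
        have := h1o w hw.2 hwS hw.1
        rw [abs_of_nonneg hz0] at hz; linarith)
    refine ⟨hk.1, hk.2, ?_⟩
    rw [if_pos hz', Finset.card_erase_add_one h1]

-- At the start all vertices are chosen and all values are demands. A merge that discards a demand
-- drops one chosen vertex, and a demand that becomes a center on its edge trades a term of the sum
-- for a term of the list, so the count stays exact. The hypothesis `hD` bounds `D` below by
-- Lipschitz functions, which avoids any analysis of paths.
open Classical in
theorem greedy_spread (hs : Shape n par len) (hR : ∀ i < n, 0 ≤ R i)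
    (hrd : ∀ i, 0 < i → i < n → rd i = rd (par i) + len i) {D : ℕ → ℕ → ℝ}
    (hD : ∀ φ : ℕ → ℝ, (∀ i, 0 < i → i < n → |φ i - φ (par i)| ≤ len i) →
      ∀ u < n, ∀ v < n, φ u - φ v ≤ D u v) {k : ℕ} (hk : k < n) :
    ∃ I ⊆ Finset.range n,
      I.card = (greedy n par len R k).cs.length +
        ∑ v ∈ Finset.range (n - k), (if 0 ≤ (greedy n par len R k).acc v then 1 else 0) ∧
      ∀ v < n - k, Spread R rd I {u | u < n ∧ top n par k u = v} v
          ((greedy n par len R k).acc v) ∧ Indep R D I {u | u < n ∧ top n par k u = v} := by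
  induction k with
  | zero =>
    refine ⟨Finset.range n, subset_rfl, ?_, fun v hv => ⟨⟨fun h => ?_, fun h => ?_⟩, ?_⟩⟩
    · rw [Finset.sum_congr (s₁ := Finset.range (n - 0)) rfl (g := fun _ => 1) (fun v hv => if_pos
        (show 0 ≤ (greedy n par len R 0).acc v from hR v (by simpa using hv)))]
      simp [greedy]
    · exact absurd (hR v (by omega)) (not_le.mpr h)
    · refine ⟨v, Finset.mem_range.mpr (by omega), ⟨by omega, rfl⟩, by simp [greedy], ?_⟩
      rintro w _ ⟨_, hw⟩ hne
      exact absurd hw hne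
    · rintro w _ ⟨_, hw⟩ w' _ ⟨_, hw'⟩ hne
      exact absurd (hw.trans hw'.symm) hne
  | succ k ih =>
    obtain ⟨I, hIn, hcard, h1⟩ := ih (by omega)
    set s := greedy n par len R k with hsd
    set i := n - 1 - k with hi
    have hi0 : 0 < i := by omega
    have hin : i < n := by omega
    have hpi := hs.par_lt i hi0 hin
    have hli := hs.len_nonneg i hi0 hin
    have hrdi := hrd i hi0 hin
    have hgr : greedy n par len R (k + 1) = gstep par len i s := rfl
    obtain ⟨hi1, hi2⟩ := h1 i (by omega)
    obtain ⟨hp1, hp2⟩ := h1 (par i) (by omega)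
    set S : Set ℕ := {u | u < n ∧ top n par k u = i} with hS
    set P : Set ℕ := {u | u < n ∧ top n par k u = par i} with hP
    -- the part of `i`, seen from its parent
    have hi3 : Spread R rd I S (par i) (s.acc i - len i) := by
      rcases lt_or_ge (s.acc i) 0 with hx | hx
      · refine ⟨fun _ w hw hwS => ?_, fun h => by linarith⟩
        linarith [hi1.1 hx w hw hwS]
      · obtain ⟨w₀, h0, h0S, h0z, h0o⟩ := hi1.2 hx
        refine ⟨fun hy w hw hwS => ?_, fun hy => ⟨w₀, h0, h0S, by linarith, fun w hw hwS hww => ?_⟩⟩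
        · by_cases hww : w = w₀
          · subst hww; linarith
          · linarith [h0o w hw hwS hww]
        · linarith [h0o w hw hwS hww]
    have hdist : ∀ w ∈ S, ∀ w' ∈ P, (rd w - rd (par i)) + (rd w' - rd (par i)) ≤ D w w' ∧
        (rd w - rd (par i)) + (rd w' - rd (par i)) ≤ D w' w := by
      intro w hw w' hw'
      have hwS : top n par k w = i := hw.2
      have hwP : top n par k w' ≠ i := by rw [hw'.2]; omega
      -- The witness is the root distance, kept on the part of `i` and reflected at the height of
      -- `par i` elsewhere. The reflection fixes the value at `par i`, so the Lipschitz bound holds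
      -- across the edge from `i` too, and the difference between the two sides is the length of the
      -- way through `par i`.
      have hφ : ∀ j, 0 < j → j < n →
          |(if top n par k j = i then rd j else 2 * rd (par i) - rd j) -
            (if top n par k (par j) = i then rd (par j) else 2 * rd (par i) - rd (par j))|
            ≤ len j := by
        intro j hj0 hjn
        have hrj := hrd j hj0 hjn
        have hlj := hs.len_nonneg j hj0 hjn
        have hpj := hs.par_lt j hj0 hjn
        rcases Nat.lt_or_ge j (n - k) with hlt | hge
        · rw [top_self hlt, top_self (show par j < n - k by omega), if_neg (by omega : par j ≠ i)]
          split_ifs with hji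
          · rw [abs_le]; subst hji; constructor <;> linarith
          · rw [abs_le]; constructor <;> linarith
        · rw [top_par hs (by omega) hjn hge]
          split_ifs
          · rw [abs_le]; constructor <;> linarith
          · rw [abs_le]; constructor <;> linarith
      have hφ' : ∀ j, 0 < j → j < n →
          |-(if top n par k j = i then rd j else 2 * rd (par i) - rd j) -
            -(if top n par k (par j) = i then rd (par j) else 2 * rd (par i) - rd (par j))|
            ≤ len j := by
        intro j hj0 hjn
        have := hφ j hj0 hjn
        rwa [neg_sub_neg, abs_sub_comm]
      have e1 := hD (fun j => if top n par k j = i then rd j else 2 * rd (par i) - rd j) hφ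
        w hw.1 w' hw'.1
      have e2 := hD (fun j => -(if top n par k j = i then rd j else 2 * rd (par i) - rd j)) hφ'
        w' hw'.1 w hw.1
      simp only [if_pos hwS, if_neg hwP] at e1 e2
      constructor <;> linarith
    have hdisj : Disjoint S P := by
      rw [Set.disjoint_left]
      rintro u hu hu'
      have h1 : top n par k u = i := hu.2
      have h2 : top n par k u = par i := hu'.2
      omega
    have hset : {u | u < n ∧ top n par (k + 1) u = par i} = S ∪ P := by
      ext u
      simp only [hS, hP, Set.mem_ofPred_eq, Set.mem_union, merged_iff, ← hi]
      constructor
      · rintro ⟨h, ⟨h', -⟩ | ⟨-, h'⟩⟩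
        · exact .inl ⟨h, h'⟩
        · exact .inr ⟨h, h'⟩
      · rintro (⟨h, h'⟩ | ⟨h, h'⟩)
        · exact ⟨h, .inl ⟨h', trivial⟩⟩
        · exact ⟨h, .inr ⟨by omega, h'⟩⟩
    have hset' : ∀ v, v ≠ par i → v ≠ i → {u | u < n ∧ top n par (k + 1) u = v} =
        {u | u < n ∧ top n par k u = v} := by
      intro v hv hv'
      ext u
      simp only [Set.mem_ofPred_eq, merged_iff, ← hi]
      constructor
      · rintro ⟨h, ⟨-, h'⟩ | ⟨-, h'⟩⟩
        · exact absurd h'.symm hv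
        · exact ⟨h, h'⟩
      · rintro ⟨h, htop⟩
        exact ⟨h, .inr ⟨by omega, htop⟩⟩
    -- the result of the merge, with the kept value `z` and the other value `z'`
    obtain ⟨z, z', J, hJ, hJ', hacc, hzz, hJ1, hJ2, hJc⟩ : ∃ z z' : ℝ, ∃ J ⊆ I,
        (∀ w ∈ I, w ∉ S ∪ P → w ∈ J) ∧
        (∀ v, (gstep par len i s).acc v = if v = par i then z else s.acc v) ∧
        ((if 0 ≤ z then 1 else 0) + (if 0 ≤ z' then 1 else 0) =
          (if 0 ≤ s.acc i - len i then 1 else 0) + (if 0 ≤ s.acc (par i) then 1 else 0)) ∧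
        Spread R rd J (S ∪ P) (par i) z ∧ Indep R D J (S ∪ P) ∧
        I.card = J.card + if 0 ≤ z' then 1 else 0 := by
      rcases closer_cases (s.acc i - len i) (s.acc (par i)) with ⟨hcl, hle, ht⟩ | ⟨hcl, hle, ht⟩
      · obtain ⟨J, g1, g2, g3, g4, g5⟩ := hi3.merge hp1 hle
          (fun h h0 => absurd (ht h) (not_lt.mpr h0)) hdisj hi2 hp2 hdist
        refine ⟨_, _, J, g1, fun w hw hw' => g2 w hw (fun h => hw' (.inr h)), fun v => ?_, rfl,
          g3, g4, g5⟩
        simp only [gstep, if_pos hcl, Function.update_apply]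
      · obtain ⟨J, g1, g2, g3, g4, g5⟩ := hp1.merge hi3 hle
          (fun h _ => ht h.symm) hdisj.symm hp2 hi2
          (fun w hw w' hw' => by
            have := hdist w' hw' w hw
            constructor <;> linarith [this.1, this.2])
        rw [Set.union_comm] at g3 g4
        refine ⟨_, _, J, g1, fun w hw hw' => g2 w hw (fun h => hw' (.inl h)), fun v => ?_,
          add_comm _ _, g3, g4, g5⟩
        simp only [gstep, if_neg hcl]
        split_ifs with h
        · rw [h]
        · rfl
    refine ⟨J, hJ.trans hIn, ?_, fun v hv => ?_⟩
    · rw [hgr]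
      have hlen : (gstep par len i s).cs.length =
          s.cs.length + if 0 ≤ s.acc i ∧ s.acc i - len i < 0 then 1 else 0 := by
        simp only [gstep]; split_ifs <;> simp
      have hnk : n - k = i + 1 := by omega
      have hnk' : n - (k + 1) = i := by omega
      rw [hlen, hnk']
      rw [hnk, Finset.sum_range_succ] at hcard
      have hsum : ∑ v ∈ Finset.range i, (if 0 ≤ (gstep par len i s).acc v then 1 else 0) +
          (if 0 ≤ s.acc (par i) then 1 else 0) =
          ∑ v ∈ Finset.range i, (if 0 ≤ s.acc v then 1 else 0) + (if 0 ≤ z then 1 else 0) := by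
        have hm : par i ∈ Finset.range i := Finset.mem_range.mpr hpi
        rw [← Finset.add_sum_erase _ _ hm, ← Finset.add_sum_erase _ _ hm]
        rw [Finset.sum_congr rfl (g := fun v => if 0 ≤ s.acc v then 1 else 0)
          (fun v hv => by rw [hacc, if_neg (Finset.ne_of_mem_erase hv)])]
        rw [hacc, if_pos rfl]
        ring
      -- A demand either survives the edge or is converted into a center.
      have hx : (if 0 ≤ s.acc i then 1 else 0) = (if 0 ≤ s.acc i - len i then 1 else 0) +
          (if 0 ≤ s.acc i ∧ s.acc i - len i < 0 then 1 else 0) := by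
        by_cases hx : 0 ≤ s.acc i
        · by_cases hy : 0 ≤ s.acc i - len i
          · simp [hx, hy, not_lt.mpr hy, -sub_nonneg]
          · simp [hx, hy, not_le.mp hy]
        · have : ¬ 0 ≤ s.acc i - len i := fun h => hx (by linarith)
          simp [hx, this]
      omega
    · rw [hgr, hacc]
      by_cases hvp : v = par i
      · subst hvp
        rw [if_pos rfl, hset]
        exact ⟨hJ1, hJ2⟩
      · rw [if_neg hvp, hset' v hvp (by omega)]
        obtain ⟨g1, g2⟩ := h1 v (by omega)
        have hout : ∀ w ∈ {u | u < n ∧ top n par k u = v}, w ∉ S ∪ P := by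
          rintro w ⟨-, hw⟩ (h | h)
          · have : top n par k w = i := h.2
            omega
          · have : top n par k w = par i := h.2
            omega
        refine ⟨⟨fun h w hw hwS => g1.1 h w (hJ hw) hwS, fun h => ?_⟩,
          fun w hw hwS w' hw' hwS' => g2 w (hJ hw) hwS w' (hJ hw') hwS'⟩
        obtain ⟨w₀, a1, a2, a3, a4⟩ := g1.2 h
        exact ⟨w₀, hJ' w₀ a1 (hout _ a2), a2, a3, fun w hw => a4 w (hJ hw)⟩

/-- The placed centers, with one at the root if it is needed, cover all vertices. -/
theorem greedy_covers (hs : Shape n par len) (hR : ∀ i < n, 0 ≤ R i) (hn : 0 < n)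
    (hrd : ∀ i, 0 < i → i < n → rd i = rd (par i) + len i) {δ : ℕ → ℕ × ℝ → ℝ}
    (hδ : ∀ i, 0 < i → i < n → ∀ c, δ i c ≤ len i + δ (par i) c ∧ δ (par i) c ≤ len i + δ i c)
    (hc : ∀ i t, 0 < i → i < n → 0 ≤ t → t ≤ len i →
      δ i (i, t) ≤ t ∧ δ (par i) (i, t) ≤ len i - t) (hrd0 : rd 0 = 0) :
    ∀ u < n, (∃ c ∈ (greedy n par len R (n - 1)).cs, δ u c ≤ R u) ∨
      (0 ≤ (greedy n par len R (n - 1)).acc 0 ∧ rd u ≤ R u) := by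
  intro u hu
  obtain ⟨h, -, -⟩ := greedy_served hs hR hrd hδ hc (k := n - 1) (by omega)
  have ht := top_lt hs (k := n - 1) (by omega) hu
  rcases (h 0 (by omega)).2 u ⟨hu, by omega⟩ with hcase | hcase
  · exact .inl hcase
  · exact .inr ⟨hcase.1, by linarith [hcase.1, hcase.2]⟩

/-- As many pairwise independent vertices as the greedy algorithm places centers. -/
theorem greedy_indep (hs : Shape n par len) (hR : ∀ i < n, 0 ≤ R i) (hn : 0 < n)
    (hrd : ∀ i, 0 < i → i < n → rd i = rd (par i) + len i) {D : ℕ → ℕ → ℝ}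
    (hD : ∀ φ : ℕ → ℝ, (∀ i, 0 < i → i < n → |φ i - φ (par i)| ≤ len i) →
      ∀ u < n, ∀ v < n, φ u - φ v ≤ D u v) :
    ∃ I ⊆ Finset.range n, I.card = (greedy n par len R (n - 1)).count ∧
      ∀ w ∈ I, ∀ w' ∈ I, w ≠ w' → R w + R w' < D w w' := by
  obtain ⟨I, h1, h2, h3⟩ := greedy_spread hs hR hrd hD (k := n - 1) (by omega)
  have hn1 : n - (n - 1) = 1 := by omega
  refine ⟨I, h1, ?_, fun w hw w' hw' => ?_⟩
  · rw [h2, hn1, Finset.sum_range_one]; rfl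
  · have m : ∀ w ∈ I, w ∈ {u | u < n ∧ top n par (n - 1) u = 0} := fun w hw => by
      have hw := Finset.mem_range.mp (h1 hw)
      have := top_lt hs (k := n - 1) (by omega) hw
      exact ⟨hw, by omega⟩
    exact (h3 0 (by omega)).2 w hw (m w hw) w' hw' (m w' hw')

end PCenter

/-! ### The greedy algorithm with an undetermined cost, and weights for its steps. -/

namespace PCenter

/-! ### Affine functions on an open interval -/

/-- The affine function `a * α + b` changes its sign strictly between `lo` and `hi`. -/
def Crosses (lo hi a b : ℝ) : Prop := (a * lo + b) * (a * hi + b) < 0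

theorem crosses_iff {lo hi a b : ℝ} (h : lo < hi) :
    Crosses lo hi a b ↔ a ≠ 0 ∧ lo < -b / a ∧ -b / a < hi := by
  unfold Crosses
  by_cases ha : a = 0
  · subst ha
    simp only [zero_mul, zero_add, ne_eq, not_true_eq_false, false_and, iff_false, not_lt]
    exact mul_self_nonneg b
  · have e : (a * lo + b) * (a * hi + b) = (a * a) * ((lo - -b / a) * (hi - -b / a)) := by
      field_simp
      ring
    have haa : 0 < a * a := mul_self_pos.mpr ha
    rw [e, mul_neg_iff]
    constructor
    · rintro (⟨-, h1⟩ | ⟨h1, -⟩)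
      · rcases mul_neg_iff.mp h1 with ⟨h2, h3⟩ | ⟨h2, h3⟩
        · linarith
        · exact ⟨ha, by linarith, by linarith⟩
      · linarith
    · rintro ⟨-, h1, h2⟩
      exact .inl ⟨haa, mul_neg_of_neg_of_pos (by linarith) (by linarith)⟩

theorem Crosses.mono {lo hi lo' hi' a b : ℝ} (h : Crosses lo' hi' a b) (hl : lo ≤ lo')
    (hlh : lo' < hi') (hh : hi' ≤ hi) : Crosses lo hi a b := by
  rw [crosses_iff hlh] at h
  rw [crosses_iff (by linarith)]
  exact ⟨h.1, by linarith [h.2.1], by linarith [h.2.2]⟩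

/-- Inside the interval the function is a convex combination, with positive coefficients, of its two
end values, and these do not have strictly opposite signs. -/
theorem sign_const {lo hi a b : ℝ} (h : ¬ Crosses lo hi a b) (hlh : lo < hi) :
    (∀ α, lo < α → α < hi → 0 < a * α + b) ∨ (∀ α, lo < α → α < hi → a * α + b = 0) ∨
      (∀ α, lo < α → α < hi → a * α + b < 0) := by
  unfold Crosses at h
  have e : ∀ α, (hi - lo) * (a * α + b) = (hi - α) * (a * lo + b) + (α - lo) * (a * hi + b) :=
    fun α => by ring
  have hd : 0 < hi - lo := by linarith
  rcases lt_trichotomy (a * lo + b) 0 with h1 | h1 | h1 <;>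
  rcases lt_trichotomy (a * hi + b) 0 with h2 | h2 | h2
  · refine .inr (.inr fun α hα hα' => ?_)
    by_contra hc
    nlinarith [e α, mul_nonneg hd.le (not_lt.mp hc), mul_pos (sub_pos.mpr hα') (neg_pos.mpr h1),
      mul_pos (sub_pos.mpr hα) (neg_pos.mpr h2)]
  · refine .inr (.inr fun α hα hα' => ?_)
    by_contra hc
    have e := e α
    rw [h2] at e
    nlinarith [mul_nonneg hd.le (not_lt.mp hc), mul_pos (sub_pos.mpr hα') (neg_pos.mpr h1)]
  · exact absurd (mul_neg_of_neg_of_pos h1 h2) h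
  · refine .inr (.inr fun α hα hα' => ?_)
    by_contra hc
    have e := e α
    rw [h1] at e
    nlinarith [mul_nonneg hd.le (not_lt.mp hc), mul_pos (sub_pos.mpr hα) (neg_pos.mpr h2)]
  · refine .inr (.inl fun α hα hα' => ?_)
    have e := e α
    rw [h1, h2, mul_zero, mul_zero, add_zero] at e
    exact (mul_eq_zero.mp e).resolve_left hd.ne'
  · refine .inl fun α hα hα' => ?_
    have e := e α
    rw [h1, mul_zero, zero_add] at e
    exact pos_of_mul_pos_right (e ▸ mul_pos (sub_pos.mpr hα) h2) hd.le
  · exact absurd (mul_neg_of_pos_of_neg h1 h2) h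
  · refine .inl fun α hα hα' => ?_
    have e := e α
    rw [h2, mul_zero, add_zero] at e
    exact pos_of_mul_pos_right (e ▸ mul_pos (sub_pos.mpr hα') h1) hd.le
  · refine .inl fun α hα hα' => ?_
    exact pos_of_mul_pos_right ((e α) ▸ add_pos (mul_pos (sub_pos.mpr hα') h1)
      (mul_pos (sub_pos.mpr hα) h2)) hd.le

theorem nonneg_const {lo hi a b : ℝ} (h : ¬ Crosses lo hi a b) (hlh : lo < hi) {α β : ℝ}
    (hα : lo < α) (hα' : α < hi) (hβ : lo < β) (hβ' : β < hi) :
    0 ≤ a * α + b ↔ 0 ≤ a * β + b := by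
  rcases sign_const h hlh with h | h | h
  · exact iff_of_true (h α hα hα').le (h β hβ hβ').le
  · exact iff_of_true (h α hα hα').ge (h β hβ hβ').ge
  · exact iff_of_false (not_le.mpr (h α hα hα')) (not_le.mpr (h β hβ hβ'))

theorem pos_const {lo hi a b : ℝ} (h : ¬ Crosses lo hi a b) (hlh : lo < hi) {α β : ℝ}
    (hα : lo < α) (hα' : α < hi) (hβ : lo < β) (hβ' : β < hi) :
    0 < a * α + b ↔ 0 < a * β + b := by
  rcases sign_const h hlh with h | h | h
  · exact iff_of_true (h α hα hα') (h β hβ hβ')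
  · exact iff_of_false (h α hα hα').not_gt (h β hβ hβ').not_gt
  · exact iff_of_false (h α hα hα').not_gt (h β hβ hβ').not_gt

/-- The comparison of `a * α + b` with `a' * α + b'` is not yet decided on the interval. -/
def Unresolved (lo hi a b a' b' : ℝ) : Prop :=
  Crosses lo hi a b ∨ Crosses lo hi (a - a') (b - b') ∨ Crosses lo hi (a + a') (b + b')

/-- Factoring the difference of the squares reduces the quadratic comparison to the signs of `y`, `y
- a` and `y + a`. These are affine in the cost, and they are the three functions in `Unresolved`. -/
theorem closer_iff (y a : ℝ) :
    Closer y a ↔ (y - a) * (y + a) < 0 ∨ ((y - a) * (y + a) ≤ 0 ∧ y < 0) := by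
  have e : (y - a) * (y + a) = y * y - a * a := by ring
  rw [Closer, e, sub_neg, sub_nonpos]

theorem closer_const {lo hi a b a' b' : ℝ} (h : ¬ Unresolved lo hi a b a' b') (hlh : lo < hi)
    {α β : ℝ} (hα : lo < α) (hα' : α < hi) (hβ : lo < β) (hβ' : β < hi) :
    Closer (a * α + b) (a' * α + b') ↔ Closer (a * β + b) (a' * β + b') := by
  unfold Unresolved at h
  push Not at h
  obtain ⟨h1, h2, h3⟩ := h
  have e1 : ∀ α, a * α + b - (a' * α + b') = (a - a') * α + (b - b') := fun α => by ring
  have e2 : ∀ α, a * α + b + (a' * α + b') = (a + a') * α + (b + b') := fun α => by ring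
  have hn := nonneg_const h1 hlh hα hα' hβ hβ'
  have d := nonneg_const h2 hlh hα hα' hβ hβ'
  have d' := pos_const h2 hlh hα hα' hβ hβ'
  have e := nonneg_const h3 hlh hα hα' hβ hβ'
  have e' := pos_const h3 hlh hα hα' hβ hβ'
  rw [← not_lt, ← not_lt (b := (0 : ℝ)), not_iff_not] at hn d e
  rw [closer_iff, closer_iff, e1, e1, e2, e2, mul_neg_iff, mul_neg_iff, mul_nonpos_iff,
    mul_nonpos_iff, hn]
  simp only [d', e', ← not_lt, d, e]

/-! ### The greedy algorithm with the parameter in an open interval -/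

/-- The state of the symbolic run: the accumulated values are `A v * α + B v`, as long as
`blk v = 0`. -/
structure PState where
  A : ℕ → ℝ
  B : ℕ → ℝ
  blk : ℕ → ℕ

/-- The step of `i` can be considered. -/
def PState.Ready (par : ℕ → ℕ) (s : PState) (i : ℕ) : Prop := s.blk i = 0 ∧ s.blk (par i) = 0

/-- The comparisons of the step of `i` are not yet decided. -/
def PState.Undecided (lo hi : ℝ) (par : ℕ → ℕ) (len : ℕ → ℝ) (s : PState) (i : ℕ) : Prop :=
  Unresolved lo hi (s.A i) (s.B i - len i) (s.A (par i)) (s.B (par i))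

-- A step that cannot be carried out blocks its parent and thereby all later steps that need the
-- parent's value. A decided comparison has the same outcome throughout the interval, so it may be
-- evaluated at the midpoint.
open Classical in
noncomputable def pstep (lo hi : ℝ) (par : ℕ → ℕ) (len : ℕ → ℝ) (i : ℕ) (s : PState) : PState :=
  if ¬ s.Ready par i ∨ s.Undecided lo hi par len i then
    { s with blk := Function.update s.blk (par i) 1 }
  else if Closer (s.A i * ((lo + hi) / 2) + (s.B i - len i))
      (s.A (par i) * ((lo + hi) / 2) + s.B (par i)) then
    { s with
      A := Function.update s.A (par i) (s.A i)
      B := Function.update s.B (par i) (s.B i - len i) }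
  else s

/-- The state of the symbolic run after `k` steps. -/
noncomputable def pass (n : ℕ) (par : ℕ → ℕ) (len ra rb : ℕ → ℝ) (lo hi : ℝ) : ℕ → PState
  | 0 => ⟨ra, rb, fun _ => 0⟩
  | k + 1 => pstep lo hi par len (n - 1 - k) (pass n par len ra rb lo hi k)

variable {n : ℕ} {par : ℕ → ℕ} {len ra rb : ℕ → ℝ} {lo hi : ℝ}

/-- An unblocked value has never been touched by a step that was not carried out. Its sign is
constant too: it is a radius, nonnegative at both ends, or has come up an edge, and then a change of
sign was excluded by the first of the three comparisons. This constancy is what `count_const` needs.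
-/
theorem pass_link (hs : Shape n par len) (hlh : lo < hi)
    (hr : ∀ i < n, 0 ≤ ra i * lo + rb i ∧ 0 ≤ ra i * hi + rb i) {k : ℕ} (hk : k < n) :
    ∀ u < n, (pass n par len ra rb lo hi k).blk u = 0 →
      ¬ Crosses lo hi ((pass n par len ra rb lo hi k).A u) ((pass n par len ra rb lo hi k).B u) ∧
      ∀ α, lo < α → α < hi → (greedy n par len (fun i => ra i * α + rb i) k).acc u =
        (pass n par len ra rb lo hi k).A u * α + (pass n par len ra rb lo hi k).B u := by
  induction k with
  | zero =>
    intro u hu _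
    exact ⟨not_lt.mpr (mul_nonneg (hr u hu).1 (hr u hu).2), fun α _ _ => rfl⟩
  | succ k ih =>
    replace ih := ih (by omega)
    set s := pass n par len ra rb lo hi k with hsd
    set i := n - 1 - k with hi'
    have hin : i < n := by omega
    have hpi := hs.par_lt i (by omega) hin
    have hps : pass n par len ra rb lo hi (k + 1) = pstep lo hi par len i s := rfl
    rw [hps]
    intro u hu hb
    have hg : ∀ α, greedy n par len (fun i => ra i * α + rb i) (k + 1) =
        gstep par len i (greedy n par len (fun i => ra i * α + rb i) k) := fun α => rfl
    by_cases h1 : ¬ s.Ready par i ∨ s.Undecided lo hi par len i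
    · simp only [pstep, if_pos h1] at hb ⊢
      by_cases hup : u = par i
      · subst hup; simp at hb
      · rw [Function.update_of_ne hup] at hb
        refine ⟨(ih u hu hb).1, fun α hα hα' => ?_⟩
        rw [hg, ← (ih u hu hb).2 α hα hα']
        simp only [gstep]
        split_ifs <;> simp [hup]
    · have h1' := h1
      push Not at h1
      obtain ⟨⟨hbi, hbp⟩, hund⟩ := h1
      obtain ⟨ci, li⟩ := ih i hin hbi
      obtain ⟨cp, lp⟩ := ih (par i) (by omega) hbp
      have hm : lo < (lo + hi) / 2 ∧ (lo + hi) / 2 < hi := by constructor <;> linarith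
      have hcl : ∀ α, lo < α → α < hi →
          (Closer (s.A i * ((lo + hi) / 2) + (s.B i - len i))
            (s.A (par i) * ((lo + hi) / 2) + s.B (par i)) ↔
          Closer ((greedy n par len (fun i => ra i * α + rb i) k).acc i - len i)
            ((greedy n par len (fun i => ra i * α + rb i) k).acc (par i))) := by
        intro α hα hα'
        rw [li α hα hα', lp α hα hα', add_sub_assoc]
        exact closer_const hund hlh hm.1 hm.2 hα hα'
      have hb' : s.blk u = 0 := by
        simp only [pstep, if_neg h1'] at hb
        split_ifs at hb <;> exact hb
      by_cases hc : Closer (s.A i * ((lo + hi) / 2) + (s.B i - len i))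
            (s.A (par i) * ((lo + hi) / 2) + s.B (par i))
      · simp only [pstep, if_neg h1', if_pos hc]
        by_cases hup : u = par i
        · subst hup
          simp only [Function.update_self]
          refine ⟨fun h => hund (.inl h), fun α hα hα' => ?_⟩
          rw [hg]
          simp only [gstep, if_pos ((hcl α hα hα').mp hc), Function.update_self, li α hα hα']
          ring
        · simp only [Function.update_of_ne hup]
          refine ⟨(ih u hu hb').1, fun α hα hα' => ?_⟩
          rw [hg, ← (ih u hu hb').2 α hα hα']
          simp only [gstep, if_pos ((hcl α hα hα').mp hc), Function.update_of_ne hup]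
      · simp only [pstep, if_neg h1', if_neg hc]
        refine ⟨(ih u hu hb').1, fun α hα hα' => ?_⟩
        rw [hg, ← (ih u hu hb').2 α hα hα']
        simp only [gstep, if_neg (fun h => hc ((hcl α hα hα').mpr h))]

/-- What is decided stays decided, in the same way, when the interval shrinks. -/
theorem pass_mono {lo' hi' : ℝ} (hl : lo ≤ lo') (hlh : lo' < hi') (hh : hi' ≤ hi) (k u : ℕ)
    (hb : (pass n par len ra rb lo hi k).blk u = 0) :
    (pass n par len ra rb lo' hi' k).blk u = 0 ∧
      (pass n par len ra rb lo' hi' k).A u = (pass n par len ra rb lo hi k).A u ∧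
      (pass n par len ra rb lo' hi' k).B u = (pass n par len ra rb lo hi k).B u := by
  induction k generalizing u with
  | zero => exact ⟨rfl, rfl, rfl⟩
  | succ k ih =>
    have hps : ∀ lo hi, pass n par len ra rb lo hi (k + 1) =
      pstep lo hi par len (n - 1 - k) (pass n par len ra rb lo hi k) := fun _ _ => rfl
    rw [hps] at hb
    rw [hps, hps]
    set s := pass n par len ra rb lo hi k with hsd
    set s' := pass n par len ra rb lo' hi' k with hsd'
    set i := n - 1 - k with hid
    by_cases h1 : ¬ s.Ready par i ∨ s.Undecided lo hi par len i
    · simp only [pstep, if_pos h1] at hb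
      have hup : u ≠ par i := by
        rintro rfl
        simp at hb
      rw [Function.update_of_ne hup] at hb
      obtain ⟨g1, g2, g3⟩ := ih u hb
      simp only [pstep, if_pos h1]
      split_ifs <;> simp [hup, g1, g2, g3]
    · have h1' := h1
      push Not at h1
      obtain ⟨⟨hbi, hbp⟩, hund⟩ := h1
      obtain ⟨i1, i2, i3⟩ := ih i hbi
      obtain ⟨p1, p2, p3⟩ := ih (par i) hbp
      have hund' : ¬ s'.Undecided lo' hi' par len i := by
        unfold PState.Undecided at hund ⊢
        rw [i2, i3, p2, p3]
        rintro (h | h | h)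
        · exact hund (.inl (h.mono hl hlh hh))
        · exact hund (.inr (.inl (h.mono hl hlh hh)))
        · exact hund (.inr (.inr (h.mono hl hlh hh)))
      have h2 : ¬ (¬ s'.Ready par i ∨ s'.Undecided lo' hi' par len i) := by
        push Not
        exact ⟨⟨i1, p1⟩, hund'⟩
      have hb' : s.blk u = 0 := by
        simp only [pstep, if_neg h1'] at hb
        split_ifs at hb <;> exact hb
      obtain ⟨g1, g2, g3⟩ := ih u hb'
      -- Both midpoints lie in the larger interval, so evaluating at either gives the same answer.
      have hcl := closer_const hund (by linarith) (α := (lo + hi) / 2) (β := (lo' + hi') / 2)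
        (by linarith) (by linarith) (by linarith) (by linarith)
      by_cases hc : Closer (s.A i * ((lo + hi) / 2) + (s.B i - len i))
            (s.A (par i) * ((lo + hi) / 2) + s.B (par i))
      · have hc' := hcl.mp hc
        rw [← i2, ← i3, ← p2, ← p3] at hc'
        simp only [pstep, if_neg h1', if_neg h2, if_pos hc, if_pos hc', Function.update_apply]
        refine ⟨g1, ?_, ?_⟩ <;> split_ifs <;> simp only [i2, i3, g2, g3]
      · have hc' := fun h => hc (hcl.mpr h)
        rw [← i2, ← i3, ← p2, ← p3] at hc'
        simp only [pstep, if_neg h1', if_neg h2, if_neg hc, if_neg hc']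
        exact ⟨g1, g2, g3⟩

/-- The step of `i` has to wait for other steps. -/
def Waiting (n : ℕ) (par : ℕ → ℕ) (len ra rb : ℕ → ℝ) (lo hi : ℝ) (i : ℕ) : Prop :=
  ¬ (pass n par len ra rb lo hi (n - 1 - i)).Ready par i

/-- The step of `i` has undecided comparisons. -/
def Active (n : ℕ) (par : ℕ → ℕ) (len ra rb : ℕ → ℝ) (lo hi : ℝ) (i : ℕ) : Prop :=
  (pass n par len ra rb lo hi (n - 1 - i)).Ready par i ∧
    (pass n par len ra rb lo hi (n - 1 - i)).Undecided lo hi par len i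

/-- If no step waits and all comparisons are decided, the number of centers is constant. -/
theorem count_const (hs : Shape n par len) (hn : 0 < n) (hlh : lo < hi)
    (hr : ∀ i < n, 0 ≤ ra i * lo + rb i ∧ 0 ≤ ra i * hi + rb i)
    (hw : ∀ i, 0 < i → i < n → ¬ Waiting n par len ra rb lo hi i)
    (ha : ∀ i, 0 < i → i < n → ¬ Active n par len ra rb lo hi i) {α β : ℝ}
    (hα : lo < α) (hα' : α < hi) (hβ : lo < β) (hβ' : β < hi) :
    (greedy n par len (fun i => ra i * α + rb i) (n - 1)).count =
      (greedy n par len (fun i => ra i * β + rb i) (n - 1)).count := by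
  have key : ∀ k, k < n → (∀ u, (pass n par len ra rb lo hi k).blk u = 0) ∧
      (greedy n par len (fun i => ra i * α + rb i) k).cs.length =
        (greedy n par len (fun i => ra i * β + rb i) k).cs.length := by
    intro k
    induction k with
    | zero => intro _; exact ⟨fun _ => rfl, rfl⟩
    | succ k ih =>
      intro hk
      obtain ⟨h1, h2⟩ := ih (by omega)
      have hki : n - 1 - (n - 1 - k) = k := by omega
      have hw' := hw (n - 1 - k) (by omega) (by omega)
      have ha' := ha (n - 1 - k) (by omega) (by omega)
      unfold Active at ha'
      unfold Waiting at hw'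
      rw [hki] at ha' hw'
      have hc : ¬ (¬ (pass n par len ra rb lo hi k).Ready par (n - 1 - k) ∨
          (pass n par len ra rb lo hi k).Undecided lo hi par len (n - 1 - k)) := by
        tauto
      refine ⟨fun u => ?_, ?_⟩
      · simp only [pass, pstep, if_neg hc]
        split_ifs <;> exact h1 u
      · obtain ⟨c, l⟩ := pass_link hs hlh hr (k := k) (by omega) (n - 1 - k) (by omega) (h1 _)
        have hund : ¬ Crosses lo hi ((pass n par len ra rb lo hi k).A (n - 1 - k))
            ((pass n par len ra rb lo hi k).B (n - 1 - k) - len (n - 1 - k)) :=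
          fun h => hc (.inr (.inl h))
        -- The signs before and after the edge determine whether a center is placed.
        have e1 := nonneg_const c hlh hα hα' hβ hβ'
        have e2 := nonneg_const hund hlh hα hα' hβ hβ'
        simp only [greedy, gstep]
        rw [l α hα hα', l β hβ hβ', add_sub_assoc, add_sub_assoc]
        simp only [← not_le, e1, e2]
        split_ifs <;> simp [h2]
  obtain ⟨h1, h2⟩ := key (n - 1) (by omega)
  obtain ⟨c, l⟩ := pass_link hs hlh hr (k := n - 1) (by omega) 0 hn (h1 _)
  have e := nonneg_const c hlh hα hα' hβ hβ'
  unfold GState.count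
  rw [h2, l α hα hα', l β hβ hβ']
  simp only [e]

/-! ### Weights of the steps -/

/-- Auxiliary values for the weights: the next child of `u` gets four times the value at `u`. -/
noncomputable def nxt (par : ℕ → ℕ) : ℕ → ℕ → ℝ
  | 0 => fun _ => 1
  | j + 1 => if j = 0 then fun _ => 1 else
      Function.update (Function.update (nxt par j) (par j) (nxt par j (par j) * 4)) j
        (nxt par j (par j) * 4)

/-- The weight of the step of `i`: four times the weight of the next step that waits for it. -/
noncomputable def wt (par : ℕ → ℕ) (i : ℕ) : ℝ := nxt par i (par i) * 4

theorem nxt_pos (j u : ℕ) : 1 ≤ nxt par j u := by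
  induction j generalizing u with
  | zero => simp [nxt]
  | succ j ih =>
    simp only [nxt]
    split_ifs
    · exact le_rfl
    · have := ih (par j)
      simp only [Function.update_apply]
      split_ifs
      · linarith
      · linarith
      · exact ih u

theorem wt_pos (i : ℕ) : 1 ≤ wt par i := by
  have := nxt_pos (par := par) i (par i)
  unfold wt; linarith

theorem nxt_succ {j : ℕ} (hj : 0 < j) (u : ℕ) : nxt par (j + 1) u =
    if u = j then wt par j else if u = par j then wt par j else nxt par j u := by
  simp only [nxt, if_neg hj.ne', wt, Function.update_apply]

/-- Every child of a vertex contributes one factor 4 to the value stored there. With at most two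
children the weight grows at most sixteenfold per level, so logarithmic height keeps all weights
polynomial. -/
theorem wt_le (hs : Shape n par len)
    (hb : ∀ u, ((Finset.range n).filter (fun i => 0 < i ∧ par i = u)).card ≤ 2) {dep : ℕ → ℕ}
    (hd : ∀ i, 0 < i → i < n → dep i = dep (par i) + 1) {i : ℕ} (hi0 : 0 < i) (hi : i < n) :
    wt par i ≤ 16 ^ dep i := by
  -- The stored value starts as the weight of the step of `u`, or as 1 at the root, and is
  -- quadrupled by each child labelled below `j`.
  have key : ∀ j, 0 < j → j ≤ n → ∀ u < j, nxt par j u = (if u = 0 then 1 else wt par u) *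
      4 ^ ((Finset.range j).filter (fun i => 0 < i ∧ par i = u)).card := by
    intro j hj
    induction j, hj using Nat.le_induction with
    | base =>
      intro _ u hu
      obtain rfl : u = 0 := by omega
      simp [nxt, Finset.filter_singleton]
    | succ j hj ih =>
      intro hjn u hu
      have hp := hs.par_lt j hj (by omega)
      rw [nxt_succ hj, Finset.range_add_one, Finset.filter_insert]
      by_cases huj : u = j
      · subst huj
        have hempty : (Finset.range u).filter (fun i => 0 < i ∧ par i = u) = ∅ := by
          rw [Finset.filter_eq_empty_iff]
          rintro i hi ⟨h0, h1⟩
          have := Finset.mem_range.mp hi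
          have := hs.par_lt i h0 (by omega)
          omega
        rw [if_pos rfl, if_neg (by omega), if_neg (by omega), hempty]
        simp
      · rw [if_neg huj]
        by_cases hup : u = par j
        · have hc : 0 < j ∧ par j = u := ⟨by omega, hup.symm⟩
          rw [if_pos hup, if_pos hc, Finset.card_insert_of_notMem (by simp),
            pow_succ, ← mul_assoc, ← ih (by omega) u (by omega), hup]
          rfl
        · have hc : ¬ (0 < j ∧ par j = u) := fun h => hup h.2.symm
          rw [if_neg hup, if_neg hc]
          exact ih (by omega) u (by omega)
  have hstep : ∀ i, 0 < i → i < n → wt par i ≤ (if par i = 0 then 1 else wt par (par i)) * 16 := by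
    intro i hi0 hi
    have hp := hs.par_lt i hi0 hi
    have h := key (i + 1) (by omega) (by omega) (par i) (by omega)
    rw [nxt_succ hi0, if_neg (by omega), if_pos rfl] at h
    rw [h]
    have hc : ((Finset.range (i + 1)).filter (fun j => 0 < j ∧ par j = par i)).card ≤ 2 :=
      (Finset.card_le_card (Finset.filter_subset_filter _
        (Finset.range_subset_range.mpr (by omega)))).trans (hb (par i))
    have h4 : (4 : ℝ) ^ ((Finset.range (i + 1)).filter (fun j => 0 < j ∧ par j = par i)).card ≤ 16 :=
      (pow_le_pow_right₀ (by norm_num) hc).trans (by norm_num)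
    refine mul_le_mul_of_nonneg_left h4 ?_
    have := wt_pos (par := par) (par i)
    split_ifs <;> linarith
  induction i using Nat.strong_induction_on with
  | _ i ih =>
    have hp := hs.par_lt i hi0 hi
    refine (hstep i hi0 hi).trans ?_
    rw [hd i hi0 hi, pow_succ]
    refine mul_le_mul_of_nonneg_right ?_ (by norm_num)
    split_ifs with h0
    · exact one_le_pow₀ (by norm_num)
    · exact ih (par i) hp (by omega) (by omega)

open Classical in
/-- The waiting steps have at most a third of the weight of the active ones. -/
theorem three_mul_waiting_le (hs : Shape n par len) (hn : 0 < n) :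
    3 * ∑ i ∈ Finset.Ico 1 n, (if Waiting n par len ra rb lo hi i then wt par i else 0) ≤
      ∑ i ∈ Finset.Ico 1 n, (if Active n par len ra rb lo hi i then wt par i else 0) := by
  -- Blocked vertices hold credit, given by the second sum. An active step `i` pays `wt par i` into
  -- the credit of its parent. A waiting step finds the credit `4 * wt par i` at a blocked end of
  -- its edge: three quarters pay for its own term, and one quarter is the credit its parent keeps.
  have key : ∀ k, k < n →
      3 * ∑ i ∈ Finset.Ico (n - k) n, (if Waiting n par len ra rb lo hi i then wt par i else 0) +
      ∑ u ∈ Finset.range (n - k), (if (pass n par len ra rb lo hi k).blk u ≠ 0 then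
        4 * nxt par (n - k) u else 0) ≤
      ∑ i ∈ Finset.Ico (n - k) n, (if Active n par len ra rb lo hi i then wt par i else 0) := by
    intro k
    induction k with
    | zero => intro _; simp [pass]
    | succ k ih =>
      intro hk
      replace ih := ih (by omega)
      set s := pass n par len ra rb lo hi k with hsd
      obtain ⟨i, hid⟩ : ∃ i, i = n - 1 - k := ⟨_, rfl⟩
      have hnk : n - k = i + 1 := by omega
      have hnk' : n - (k + 1) = i := by omega
      have hki : n - 1 - i = k := by omega
      have hi0 : 0 < i := by omega
      have hin : i < n := by omega
      have hpi := hs.par_lt i hi0 hin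
      rw [hnk, Finset.sum_range_succ] at ih
      have hm : par i ∈ Finset.range i := Finset.mem_range.mpr hpi
      have hps : pass n par len ra rb lo hi (k + 1) = pstep lo hi par len i s := by
        rw [hid]; rfl
      rw [hnk', Finset.sum_eq_sum_Ico_succ_bot hin, Finset.sum_eq_sum_Ico_succ_bot hin,
        ← Finset.add_sum_erase _ _ hm, hps]
      rw [← Finset.add_sum_erase _ _ hm, nxt_succ hi0, nxt_succ hi0, if_neg hpi.ne, if_pos rfl,
        if_pos rfl] at ih
      have hoth : ∑ u ∈ (Finset.range i).erase (par i),
          (if (pstep lo hi par len i s).blk u ≠ 0 then 4 * nxt par i u else 0) =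
          ∑ u ∈ (Finset.range i).erase (par i),
          (if s.blk u ≠ 0 then 4 * nxt par (i + 1) u else 0) := by
        refine Finset.sum_congr rfl fun u hu => ?_
        have hup := Finset.ne_of_mem_erase hu
        have hui := Finset.mem_range.mp (Finset.mem_of_mem_erase hu)
        rw [nxt_succ hi0, if_neg hui.ne, if_neg hup]
        have : (pstep lo hi par len i s).blk u = s.blk u := by
          simp only [pstep]
          split_ifs <;> simp [hup]
        rw [this]
      rw [hoth]
      have hwt : 4 * nxt par i (par i) = wt par i := by unfold wt; ring
      rw [hwt]
      have hwp := wt_pos (par := par) i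
      by_cases hw : Waiting n par len ra rb lo hi i
      · have hna : ¬ Active n par len ra rb lo hi i := fun h => hw h.1
        rw [if_pos hw, if_neg hna]
        have hb : (pstep lo hi par len i s).blk (par i) ≠ 0 := by
          have hr : ¬ s.Ready par i := by
            have := hw
            unfold Waiting at this
            rwa [hki] at this
          simp [pstep, hr]
        rw [if_pos hb]
        have hr : s.blk i ≠ 0 ∨ s.blk (par i) ≠ 0 := by
          have := hw
          unfold Waiting PState.Ready at this
          rw [hki] at this
          tauto
        rcases hr with hr | hr
        · rw [if_pos hr] at ih
          have : (0 : ℝ) ≤ if s.blk (par i) ≠ 0 then 4 * wt par i else 0 := by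
            split_ifs <;> linarith
          linarith
        · rw [if_pos hr] at ih
          have : (0 : ℝ) ≤ if s.blk i ≠ 0 then 4 * wt par i else 0 := by
            split_ifs <;> linarith
          linarith
      · rw [if_neg hw]
        have hr : s.Ready par i := by
          have := hw
          unfold Waiting at this
          rw [hki] at this
          tauto
        rw [if_neg (not_not.mpr hr.1), if_neg (not_not.mpr hr.2)] at ih
        by_cases ha : Active n par len ra rb lo hi i
        · rw [if_pos ha]
          have : (if (pstep lo hi par len i s).blk (par i) ≠ 0 then wt par i else 0) ≤ wt par i := by
            split_ifs <;> linarith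
          linarith
        · have hu : ¬ s.Undecided lo hi par len i := by
            intro h
            apply ha
            unfold Active
            rw [hki]
            exact ⟨hr, h⟩
          have hb : (pstep lo hi par len i s).blk (par i) = 0 := by
            have hcc : ¬ (¬ s.Ready par i ∨ s.Undecided lo hi par len i) := by tauto
            simp only [pstep, if_neg hcc]
            split_ifs <;> exact hr.2
          rw [if_neg ha, if_neg (not_not.mpr hb)]
          linarith
  have h := key (n - 1) (by omega)
  have hn1 : n - (n - 1) = 1 := by omega
  rw [hn1] at h
  have : (0 : ℝ) ≤ ∑ u ∈ Finset.range 1, (if (pass n par len ra rb lo hi (n - 1)).blk u ≠ 0 then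
        4 * nxt par 1 u else 0) := by
    refine Finset.sum_nonneg fun u _ => ?_
    have := nxt_pos (par := par) 1 u
    split_ifs <;> linarith
  linarith

end PCenter

/-! ### Critical values, and the accounting of weights in one round. -/

namespace PCenter

/-! ### The critical values of the undecided comparisons -/

open Classical in
/-- The weight of the entries `(value, weight)` with values strictly between `lo` and `hi`. -/
noncomputable def inW (lo hi : ℝ) (l : List (ℝ × ℝ)) : ℝ :=
  (l.map fun e => if lo < e.1 ∧ e.1 < hi then e.2 else 0).sum

section inW

variable {lo hi : ℝ} {l l' : List (ℝ × ℝ)}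

@[simp] theorem inW_nil : inW lo hi [] = 0 := by simp [inW]

open Classical in
@[simp] theorem inW_cons (e : ℝ × ℝ) :
    inW lo hi (e :: l) = (if lo < e.1 ∧ e.1 < hi then e.2 else 0) + inW lo hi l := by
  simp [inW]

@[simp] theorem inW_append : inW lo hi (l ++ l') = inW lo hi l + inW lo hi l' := by
  simp [inW]

theorem inW_perm (h : l.Perm l') : inW lo hi l = inW lo hi l' := (h.map _).sum_eq

theorem inW_nonneg (h : ∀ e ∈ l, 0 ≤ e.2) : 0 ≤ inW lo hi l := by
  refine List.sum_nonneg fun x hx => ?_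
  obtain ⟨e, he, rfl⟩ := List.mem_map.mp hx
  split_ifs
  · exact h e he
  · exact le_rfl

theorem inW_mono {lo' hi' : ℝ} (h : ∀ e ∈ l, 0 ≤ e.2) (hl : lo ≤ lo') (hh : hi' ≤ hi) :
    inW lo' hi' l ≤ inW lo hi l := by
  refine List.sum_le_sum fun e he => ?_
  have := h e he
  split_ifs with h1 h2
  · exact le_rfl
  · exact absurd ⟨by linarith [h1.1], by linarith [h1.2]⟩ h2
  · exact this
  · exact le_rfl

theorem inW_eq_zero (h : ∀ e ∈ l, ¬ (lo < e.1 ∧ e.1 < hi)) : inW lo hi l = 0 := by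
  induction l with
  | nil => simp
  | cons e l ih =>
    rw [inW_cons, if_neg (h e (by simp)), ih fun e he => h e (by simp [he]), add_zero]

/-- This gap below 1 turns the geometric decrease of the potential into a bound on the number of
rounds. -/
theorem one_le_inW (h : ∀ e ∈ l, 1 ≤ e.2) (hp : 0 < inW lo hi l) : 1 ≤ inW lo hi l := by
  induction l with
  | nil => simp at hp
  | cons e l ih =>
    have hl : ∀ e ∈ l, 1 ≤ e.2 := fun e he => h e (by simp [he])
    rw [inW_cons] at hp ⊢
    split_ifs at hp ⊢
    · linarith [h e (by simp), inW_nonneg (lo := lo) (hi := hi) fun e he => zero_le_one.trans (hl e he)]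
    · rw [zero_add] at hp ⊢
      exact ih hl hp

/-- A weighted median halves the weight on both sides. -/
theorem inW_median {l₁ l₂ : List (ℝ × ℝ)} {e : ℝ × ℝ}
    (hs : (l₁ ++ e :: l₂).Pairwise fun x y => x.1 ≤ y.1) (hw : ∀ x ∈ l₁ ++ e :: l₂, 0 ≤ x.2)
    (he : lo < e.1 ∧ e.1 < hi)
    (h1 : 2 * inW lo hi l₁ ≤ inW lo hi (l₁ ++ e :: l₂))
    (h2 : inW lo hi (l₁ ++ e :: l₂) ≤ 2 * (inW lo hi l₁ + e.2)) :
    2 * inW lo e.1 (l₁ ++ e :: l₂) ≤ inW lo hi (l₁ ++ e :: l₂) ∧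
      2 * inW e.1 hi (l₁ ++ e :: l₂) ≤ inW lo hi (l₁ ++ e :: l₂) := by
  rw [List.pairwise_append, List.pairwise_cons] at hs
  obtain ⟨-, ⟨hs2, -⟩, hs3⟩ := hs
  have w1 : ∀ x ∈ l₁, 0 ≤ x.2 := fun x hx => hw x (by simp [hx])
  have w2 : ∀ x ∈ l₂, 0 ≤ x.2 := fun x hx => hw x (by simp [hx])
  have z1 : inW lo e.1 l₂ = 0 := inW_eq_zero fun x hx h => (hs2 x hx).not_gt h.2
  have z2 : inW e.1 hi l₁ = 0 :=
    inW_eq_zero fun x hx h => (hs3 x hx e (by simp)).not_gt h.1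
  have m1 : inW lo e.1 l₁ ≤ inW lo hi l₁ := inW_mono w1 le_rfl he.2.le
  have m2 : inW e.1 hi l₂ ≤ inW lo hi l₂ := inW_mono w2 he.1.le le_rfl
  simp only [inW_append, inW_cons, lt_irrefl, and_false, false_and, if_false, if_pos he] at *
  constructor <;> linarith

end inW

open Classical in
/-- The entry of an affine function that changes its sign. -/
noncomputable def entry (lo hi w a b : ℝ) : List (ℝ × ℝ) :=
  if Crosses lo hi a b then [(-b / a, w)] else []

/-- The entries for the comparison of `a * α + b` with `a' * α + b'`. -/
noncomputable def entries (lo hi w a b a' b' : ℝ) : List (ℝ × ℝ) :=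
  entry lo hi w a b ++ entry lo hi w (a - a') (b - b') ++ entry lo hi w (a + a') (b + b')

theorem entry_length_le (lo hi w a b : ℝ) : (entry lo hi w a b).length ≤ 1 := by
  unfold entry; split_ifs <;> simp

theorem entries_length_le (lo hi w a b a' b' : ℝ) :
    (entries lo hi w a b a' b').length ≤ 3 := by
  have h1 := entry_length_le lo hi w a b
  have h2 := entry_length_le lo hi w (a - a') (b - b')
  have h3 := entry_length_le lo hi w (a + a') (b + b')
  simp only [entries, List.length_append]
  omega

theorem mem_entry {lo hi w a b : ℝ} {e : ℝ × ℝ} (h : e ∈ entry lo hi w a b) : e.2 = w := by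
  unfold entry at h
  split_ifs at h
  · rw [List.mem_singleton] at h; rw [h]
  · simp at h

theorem mem_entries {lo hi w a b a' b' : ℝ} {e : ℝ × ℝ} (h : e ∈ entries lo hi w a b a' b') :
    e.2 = w := by
  simp only [entries, List.mem_append] at h
  rcases h with (h | h) | h <;> exact mem_entry h

theorem inW_entry_le {lo hi w a b lo' hi' : ℝ} (hw : 0 ≤ w) :
    inW lo' hi' (entry lo hi w a b) ≤ w := by
  unfold entry
  split_ifs
  · simp only [inW_cons, inW_nil, add_zero]
    split_ifs <;> simp [hw]
  · simpa using hw

theorem inW_entries_le {lo hi w a b a' b' lo' hi' : ℝ} (hw : 0 ≤ w) :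
    inW lo' hi' (entries lo hi w a b a' b') ≤ 3 * w := by
  simp only [entries, inW_append]
  linarith [inW_entry_le (lo := lo) (hi := hi) (a := a) (b := b) (lo' := lo') (hi' := hi') hw,
    inW_entry_le (lo := lo) (hi := hi) (a := a - a') (b := b - b') (lo' := lo') (hi' := hi') hw,
    inW_entry_le (lo := lo) (hi := hi) (a := a + a') (b := b + b') (lo' := lo') (hi' := hi') hw]

/-- A function that changes sign on the smaller interval did so on the larger one, hence was
recorded there, and its zero lies in the smaller one. -/
theorem le_inW_entry {lo hi w a b lo' hi' : ℝ} (hl : lo ≤ lo') (hlh : lo' < hi') (hh : hi' ≤ hi)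
    (hc : Crosses lo' hi' a b) : w ≤ inW lo' hi' (entry lo hi w a b) := by
  rw [entry, if_pos (hc.mono hl hlh hh)]
  rw [crosses_iff hlh] at hc
  simp [hc.2]

theorem le_inW_entries {lo hi w a b a' b' lo' hi' : ℝ} (hw : 0 ≤ w) (hl : lo ≤ lo')
    (hlh : lo' < hi') (hh : hi' ≤ hi) (hc : Unresolved lo' hi' a b a' b') :
    w ≤ inW lo' hi' (entries lo hi w a b a' b') := by
  have h0 : ∀ a b, 0 ≤ inW lo' hi' (entry lo hi w a b) := fun a b =>
    inW_nonneg fun e he => (mem_entry he).symm ▸ hw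
  simp only [entries, inW_append]
  rcases hc with h | h | h <;> have := le_inW_entry (w := w) hl hlh hh h
  · linarith [h0 (a - a') (b - b'), h0 (a + a') (b + b')]
  · linarith [h0 a b, h0 (a + a') (b + b')]
  · linarith [h0 (a - a') (b - b'), h0 a b]

/-! ### The accounting of one round -/

section round

variable (n : ℕ) (par : ℕ → ℕ) (len ra rb : ℕ → ℝ) (lo hi : ℝ) (seen : ℕ → ℕ)

open Classical in
/-- The entries that the step of `i` adds. -/
noncomputable def newOf (i : ℕ) : List (ℝ × ℝ) :=
  let s := pass n par len ra rb lo hi (n - 1 - i)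
  if s.Ready par i ∧ seen i = 0 then
    entries lo hi (wt par i) (s.A i) (s.B i - len i) (s.A (par i)) (s.B (par i)) else []

/-- The entries that the first `k` steps add. -/
noncomputable def newAll : ℕ → List (ℝ × ℝ)
  | 0 => []
  | k + 1 => newAll k ++ newOf n par len ra rb lo hi seen (n - 1 - k)

open Classical in
/-- For all smaller intervals, the entries account for the active steps among the seen ones. -/
def Account (Q : List (ℝ × ℝ)) : Prop :=
  ∀ lo' hi', lo ≤ lo' → lo' < hi' → hi' ≤ hi →
    ∑ i ∈ Finset.Ico 1 n, (if seen i ≠ 0 ∧ Active n par len ra rb lo' hi' i then wt par i else 0) ≤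
      inW lo' hi' Q

/-- The total weight of the steps that were never considered. -/
noncomputable def unseenW : ℝ := ∑ i ∈ Finset.Ico 1 n, if seen i = 0 then wt par i else 0

/-- The number of the steps that were never considered. -/
def unseen : ℕ := ∑ i ∈ Finset.Ico 1 n, if seen i = 0 then 1 else 0

end round

variable {n : ℕ} {par : ℕ → ℕ} {len ra rb : ℕ → ℝ} {lo hi : ℝ} {seen seen' : ℕ → ℕ}

/-- Needed for the weight inside an interval as well as for the number of entries. -/
theorem sum_newAll {M : Type*} [AddCommMonoid M] (f : List (ℝ × ℝ) → M) (h0 : f [] = 0)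
    (ha : ∀ l l', f (l ++ l') = f l + f l') {k : ℕ} (hk : k < n) :
    f (newAll n par len ra rb lo hi seen k) =
      ∑ i ∈ Finset.Ico (n - k) n, f (newOf n par len ra rb lo hi seen i) := by
  induction k with
  | zero => simp [newAll, h0]
  | succ k ih =>
    have h1 : n - (k + 1) < n := by omega
    have h2 : n - (k + 1) + 1 = n - k := by omega
    have h3 : n - 1 - k = n - (k + 1) := by omega
    rw [Finset.sum_eq_sum_Ico_succ_bot h1, h2, newAll, ha, ih (by omega), h3, add_comm]

theorem mem_newAll {k : ℕ} {e : ℝ × ℝ} (h : e ∈ newAll n par len ra rb lo hi seen k) :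
    1 ≤ e.2 := by
  induction k with
  | zero => simp [newAll] at h
  | succ k ih =>
    rcases List.mem_append.mp h with h | h
    · exact ih h
    · simp only [newOf] at h
      split_ifs at h
      · rw [mem_entries h]
        exact wt_pos (n - 1 - k)
      · simp at h

theorem ready_iff {i : ℕ} : (pass n par len ra rb lo hi (n - 1 - i)).Ready par i ↔
    ¬ Waiting n par len ra rb lo hi i := by
  unfold Waiting; tauto

/-- The effect of a round on the accounting. -/
theorem account_round (hs : Shape n par len) (hn : 0 < n) (hlh : lo < hi) {Q Q' : List (ℝ × ℝ)}
    (hA : Account n par len ra rb lo hi seen Q)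
    (hQ : Q'.Perm (newAll n par len ra rb lo hi seen (n - 1) ++ Q))
    (hseen : ∀ i, 0 < i → i < n →
      (seen' i = 0 ↔ seen i = 0 ∧ Waiting n par len ra rb lo hi i)) :
    Account n par len ra rb lo hi seen' Q' ∧
    inW lo hi Q' + 3 * unseenW n par seen' ≤ inW lo hi Q + 3 * unseenW n par seen ∧
    3 * unseenW n par seen' ≤ inW lo hi Q' ∧
    (newAll n par len ra rb lo hi seen (n - 1)).length + 3 * unseen n seen' ≤ 3 * unseen n seen ∧
    (inW lo hi Q' ≤ 0 → ∀ i, 0 < i → i < n →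
      ¬ Waiting n par len ra rb lo hi i ∧ ¬ Active n par len ra rb lo hi i) := by
  classical
  have hn1 : n - (n - 1) = 1 := by omega
  have hwp := fun i => wt_pos (par := par) i
  have hsum : ∀ lo' hi', inW lo' hi' Q' =
      ∑ i ∈ Finset.Ico 1 n, inW lo' hi' (newOf n par len ra rb lo hi seen i) + inW lo' hi' Q := by
    intro lo' hi'
    rw [inW_perm hQ, inW_append, sum_newAll (inW lo' hi') inW_nil (fun _ _ => inW_append)
      (by omega), hn1]
  -- A step that is active on a smaller interval and newly seen was ready on the present one. By
  -- `pass_mono` its coefficients are unchanged, so its new entries account for it.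
  have hA' : Account n par len ra rb lo hi seen' Q' := by
    intro lo' hi' hl hlh' hh
    rw [hsum]
    refine le_trans ?_ (add_le_add_right (hA lo' hi' hl hlh' hh) _)
    rw [← Finset.sum_add_distrib]
    refine Finset.sum_le_sum fun i hi' => ?_
    obtain ⟨hi0, hin⟩ := Finset.mem_Ico.mp hi'
    have hse := hseen i (by omega) hin
    have hw := hwp i
    -- Here and below `‹ℝ›` is the upper end of the smaller interval, whose name is shadowed by the
    -- membership of `i`.
    have hnn : 0 ≤ inW lo' ‹ℝ› (newOf n par len ra rb lo hi seen i) := by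
      refine inW_nonneg fun e he => ?_
      simp only [newOf] at he
      split_ifs at he
      · rw [mem_entries he]; linarith
      · simp at he
    by_cases ha : Active n par len ra rb lo' ‹ℝ› i
    · by_cases h0 : seen i = 0
      · by_cases hwt : Waiting n par len ra rb lo hi i
        · rw [if_neg (fun h => h.1 (hse.mpr ⟨h0, hwt⟩)), if_neg (fun h => h.1 h0)]
          linarith
        · have hr := ready_iff.mpr hwt
          have hle : wt par i ≤ inW lo' ‹ℝ› (newOf n par len ra rb lo hi seen i) := by
            simp only [newOf, if_pos (And.intro hr h0)]
            refine le_inW_entries (by linarith) hl hlh' hh ?_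
            have hu := ha.2
            unfold PState.Undecided at hu
            obtain ⟨-, i2, i3⟩ := pass_mono hl hlh' hh _ _ hr.1
            obtain ⟨-, p2, p3⟩ := pass_mono hl hlh' hh _ _ hr.2
            rwa [i2, i3, p2, p3] at hu
          have : (0 : ℝ) ≤ if seen i ≠ 0 ∧ Active n par len ra rb lo' ‹ℝ› i then wt par i else 0 := by
            split_ifs <;> linarith
          split_ifs <;> linarith
      · rw [if_pos (And.intro h0 ha)]
        split_ifs <;> linarith
    · rw [if_neg (fun h => ha h.2), if_neg (fun h => ha h.2)]
      linarith
  -- Active steps are ready, hence seen after this round, so the entries account for all of them.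
  have hact : ∑ i ∈ Finset.Ico 1 n, (if Active n par len ra rb lo hi i then wt par i else 0) ≤
      inW lo hi Q' := by
    refine le_trans (le_of_eq (Finset.sum_congr rfl fun i hi' => ?_)) (hA' lo hi le_rfl hlh le_rfl)
    obtain ⟨hi0, hin⟩ := Finset.mem_Ico.mp hi'
    by_cases ha : Active n par len ra rb lo hi i
    · have : seen' i ≠ 0 := fun h => ((hseen i (by omega) hin).mp h).2 ha.1
      rw [if_pos ha, if_pos ⟨this, ha⟩]
    · rw [if_neg ha, if_neg fun h => ha h.2]
  have hwait := three_mul_waiting_le (ra := ra) (rb := rb) (lo := lo) (hi := hi) hs hn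
  -- What is still unseen after the round was waiting in it; with `hwait` and `hact` this bounds the
  -- unseen weight by a third of the weight inside.
  have huns : unseenW n par seen' ≤
      ∑ i ∈ Finset.Ico 1 n, (if Waiting n par len ra rb lo hi i then wt par i else 0) := by
    refine Finset.sum_le_sum fun i hi' => ?_
    obtain ⟨hi0, hin⟩ := Finset.mem_Ico.mp hi'
    have := hwp i
    have := hseen i (by omega) hin
    split_ifs with h1 h2
    · exact le_rfl
    · exact absurd (this.mp h1).2 h2
    · linarith
    · exact le_rfl
  refine ⟨hA', ?_, by linarith, ?_, ?_⟩
  · rw [hsum]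
    -- The factor 3 of the unseen weight pays for the at most three entries of a step that becomes
    -- seen.
    have : ∑ i ∈ Finset.Ico 1 n, inW lo hi (newOf n par len ra rb lo hi seen i) +
        3 * unseenW n par seen' ≤ 3 * unseenW n par seen := by
      unfold unseenW
      rw [Finset.mul_sum, Finset.mul_sum, ← Finset.sum_add_distrib]
      refine Finset.sum_le_sum fun i hi' => ?_
      obtain ⟨hi0, hin⟩ := Finset.mem_Ico.mp hi'
      have hse := hseen i (by omega) hin
      have hw := hwp i
      by_cases h0 : seen i = 0
      · rw [if_pos h0]
        by_cases hwt : Waiting n par len ra rb lo hi i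
        · have : ¬ ((pass n par len ra rb lo hi (n - 1 - i)).Ready par i ∧ seen i = 0) :=
            fun h => ready_iff.mp h.1 hwt
          simp only [newOf, if_neg this, if_pos (hse.mpr ⟨h0, hwt⟩), inW_nil]
          linarith
        · have h1 : ¬ seen' i = 0 := fun h => hwt (hse.mp h).2
          rw [if_neg h1]
          have : (pass n par len ra rb lo hi (n - 1 - i)).Ready par i ∧ seen i = 0 :=
            ⟨ready_iff.mpr hwt, h0⟩
          simp only [newOf, if_pos this]
          linarith [inW_entries_le (lo := lo) (hi := hi) (lo' := lo) (hi' := hi)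
            (a := (pass n par len ra rb lo hi (n - 1 - i)).A i)
            (b := (pass n par len ra rb lo hi (n - 1 - i)).B i - len i)
            (a' := (pass n par len ra rb lo hi (n - 1 - i)).A (par i))
            (b' := (pass n par len ra rb lo hi (n - 1 - i)).B (par i))
            (show 0 ≤ wt par i by linarith)]
      · have h1 : ¬ seen' i = 0 := fun h => h0 (hse.mp h).1
        have : ¬ ((pass n par len ra rb lo hi (n - 1 - i)).Ready par i ∧ seen i = 0) :=
            fun h => h0 h.2
        simp only [newOf, if_neg this, if_neg h0, if_neg h1, inW_nil]
        linarith
    linarith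
  · rw [sum_newAll List.length rfl (fun _ _ => List.length_append) (by omega), hn1]
    unfold unseen
    rw [Finset.mul_sum, Finset.mul_sum, ← Finset.sum_add_distrib]
    refine Finset.sum_le_sum fun i hi' => ?_
    obtain ⟨hi0, hin⟩ := Finset.mem_Ico.mp hi'
    have hse := hseen i (by omega) hin
    by_cases h : (pass n par len ra rb lo hi (n - 1 - i)).Ready par i ∧ seen i = 0
    · have h1 : ¬ seen' i = 0 := fun h' => ready_iff.mp h.1 (hse.mp h').2
      simp only [newOf, if_pos h, if_pos h.2, if_neg h1]
      exact entries_length_le _ _ _ _ _ _ _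
    · simp only [newOf, if_neg h, List.length_nil]
      by_cases h1 : seen' i = 0
      · simp [h1, (hse.mp h1).1]
      · simp [h1]
  · intro h i hi0 hin
    have hz : ∀ P : ℕ → Prop, ∑ i ∈ Finset.Ico 1 n, (if P i then wt par i else 0) ≤ 0 →
        ¬ P i := by
      intro P hP hPi
      have := Finset.single_le_sum (s := Finset.Ico 1 n)
        (f := fun i => if P i then wt par i else 0) (fun j _ => by
          have := hwp j
          split_ifs <;> linarith) (Finset.mem_Ico.mpr ⟨hi0, hin⟩)
      simp only [if_pos hPi] at this
      linarith [hwp i]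
    exact ⟨hz _ (by linarith), hz _ (by linarith)⟩

end PCenter

/-! ### The metric of a tree network. -/

namespace TreeNetwork

/-! ### Distances in a tree network -/

variable {V : Type} (N : TreeNetwork V)

theorem path_isPath (u v : V) : (N.path u v).IsPath :=
  (N.isTree.existsUnique_path u v).choose_spec.1

theorem eq_path {u v : V} {p : N.graph.Walk u v} (hp : p.IsPath) : p = N.path u v :=
  (N.isTree.existsUnique_path u v).unique hp (N.path_isPath u v)

/-- Removing detours leaves the path; its edges are distinct and occur in the walk, and the omitted
lengths are nonnegative. All upper bounds for distances come from here. -/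
theorem dist_le_walk {u v : V} (p : N.graph.Walk u v) :
    N.dist u v ≤ (p.edges.map N.length).sum := by
  classical
  unfold dist
  rw [← N.eq_path p.bypass_isPath]
  have hnn : ∀ x ∈ p.edges.map N.length, 0 ≤ x := by
    intro x hx
    obtain ⟨e, he, rfl⟩ := List.mem_map.mp hx
    exact N.length_nonneg e (p.edges_subset_edgeSet he)
  obtain ⟨l, hl, hl'⟩ := List.subperm_of_subset p.bypass_isPath.isTrail.edges_nodup
    p.edges_bypass_subset_edges
  rw [← (hl.map N.length).sum_eq]
  exact (hl'.map N.length).sum_le_sum hnn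

theorem dist_nonneg (u v : V) : 0 ≤ N.dist u v := by
  refine List.sum_nonneg fun x hx => ?_
  obtain ⟨e, he, rfl⟩ := List.mem_map.mp hx
  exact N.length_nonneg e ((N.path u v).edges_subset_edgeSet he)

theorem dist_triangle (u v w : V) : N.dist u w ≤ N.dist u v + N.dist v w := by
  refine (N.dist_le_walk ((N.path u v).append (N.path v w))).trans (le_of_eq ?_)
  simp [dist, SimpleGraph.Walk.edges_append]

theorem dist_comm_le (u v : V) : N.dist u v ≤ N.dist v u := by
  refine (N.dist_le_walk (N.path v u).reverse).trans (le_of_eq ?_)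
  simp [dist, SimpleGraph.Walk.edges_reverse]

theorem dist_comm (u v : V) : N.dist u v = N.dist v u :=
  le_antisymm (N.dist_comm_le u v) (N.dist_comm_le v u)

theorem dist_self (u : V) : N.dist u u = 0 :=
  le_antisymm (by simpa using N.dist_le_walk (SimpleGraph.Walk.nil : N.graph.Walk u u))
    (N.dist_nonneg u u)

theorem dist_le_of_adj {u v : V} (h : N.graph.Adj u v) : N.dist u v ≤ N.length s(u, v) := by
  simpa using N.dist_le_walk h.toWalk

/-- A function that is 1-Lipschitz on the edges is 1-Lipschitz. -/
theorem sub_le_dist {φ : V → ℝ}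
    (h : ∀ a b, N.graph.Adj a b → φ a - φ b ≤ N.length s(a, b)) (u v : V) :
    φ u - φ v ≤ N.dist u v := by
  have : ∀ {u v : V} (p : N.graph.Walk u v), φ u - φ v ≤ (p.edges.map N.length).sum := by
    intro u v p
    induction p with
    | nil => simp
    | cons hab p ih =>
      have := h _ _ hab
      simp only [SimpleGraph.Walk.edges_cons, List.map_cons, List.sum_cons]
      linarith
  exact this _

variable {N} {r : V}

theorem path_eq_cons {v : V} (hv : v ≠ r) : ∃ h : N.graph.Adj v (N.parent r v),
    N.path v r = .cons h (N.path (N.parent r v) r) := by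
  have hn : ¬ (N.path v r).Nil := SimpleGraph.Walk.not_nil_of_ne hv
  refine ⟨SimpleGraph.Walk.adj_snd hn, ?_⟩
  exact (SimpleGraph.Walk.cons_tail_eq _ hn).symm.trans
    (congrArg _ (N.eq_path (N.path_isPath v r).tail))

theorem adj_parent {v : V} (hv : v ≠ r) : N.graph.Adj v (N.parent r v) := (path_eq_cons hv).1

theorem length_path {v : V} (hv : v ≠ r) :
    (N.path v r).length = (N.path (N.parent r v) r).length + 1 := by
  obtain ⟨h, e⟩ := path_eq_cons hv
  rw [e, SimpleGraph.Walk.length_cons]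

/-- If `a` lies on the path from `b` to the root, uniqueness of paths makes the edge its first step;
otherwise the edge followed by that path is the path from `a`. -/
theorem parent_of_adj {a b : V} (h : N.graph.Adj a b) :
    (a ≠ r ∧ N.parent r a = b) ∨ (b ≠ r ∧ N.parent r b = a) := by
  classical
  by_cases ha : a ∈ (N.path b r).support
  · right
    have hb : b ≠ r := by
      rintro rfl
      rw [← N.eq_path SimpleGraph.Walk.IsPath.nil] at ha
      simp only [SimpleGraph.Walk.support_nil, List.mem_singleton] at ha
      exact h.ne ha
    refine ⟨hb, ?_⟩
    have h1 : (N.path b r).takeUntil a ha = h.symm.toWalk :=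
      (N.eq_path ((N.path_isPath b r).takeUntil ha)).trans
        (N.eq_path (SimpleGraph.Walk.IsPath.of_adj h.symm)).symm
    have h2 := (N.path b r).take_spec ha
    rw [h1] at h2
    unfold parent
    rw [← h2]
    simp [SimpleGraph.Walk.snd]
  · left
    have hp : (SimpleGraph.Walk.cons h (N.path b r)).IsPath :=
      (SimpleGraph.Walk.cons_isPath_iff _ _).mpr ⟨N.path_isPath b r, ha⟩
    refine ⟨?_, ?_⟩
    · rintro rfl
      exact ha (SimpleGraph.Walk.end_mem_support _)
    · unfold parent
      rw [← N.eq_path hp]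
      simp

/-- Each of the two vertices may enter the edge of the point at either end, which gives four cases
of the triangle inequality. -/
theorem dist_le_distTo_add (u v : V) (x : N.Point) :
    N.dist u v ≤ N.distTo u x + N.distTo v x := by
  cases x with
  | vertex w =>
    have := N.dist_triangle u w v
    rwa [N.dist_comm w v] at this
  | edge a b h t h0 h1 =>
    simp only [distTo]
    have e1 := N.dist_triangle u a v
    have e2 := N.dist_triangle u b v
    have e3 := N.dist_triangle u a b
    have e4 := N.dist_triangle u b a
    have e5 := N.dist_le_of_adj h
    have e6 := N.dist_comm a b
    have e7 := N.dist_comm a v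
    have e8 := N.dist_comm b v
    rcases min_choice (N.dist u a + t) (N.dist u b + (N.length s(a, b) - t)) with h | h <;>
    rcases min_choice (N.dist v a + t) (N.dist v b + (N.length s(a, b) - t)) with h' | h' <;>
    rw [h, h'] <;> linarith

theorem distTo_nonneg (u : V) (x : N.Point) : 0 ≤ N.distTo u x := by
  have := dist_le_distTo_add u u x
  rw [N.dist_self] at this
  linarith

theorem Feasible.mono {p : ℕ} {α β : ℝ} (h : N.Feasible p α) (hle : α ≤ β) : N.Feasible p β := by
  obtain ⟨c, hc⟩ := h
  exact ⟨c, fun v => (hc v).imp fun i hi => hi.trans hle⟩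

theorem Feasible.nonneg {p : ℕ} {α : ℝ} (h : N.Feasible p α) (v : V) : 0 ≤ α := by
  obtain ⟨c, hc⟩ := h
  obtain ⟨i, hi⟩ := hc v
  exact le_trans (mul_nonneg (distTo_nonneg _ _) (N.weight_nonneg v)) hi

end TreeNetwork

/-! ### Labelled networks: radii, feasibility and the optimal cost. -/

namespace PCenter

/-! ### Labelled tree networks -/

/-- The vertices of the network are labelled by `0, …, n - 1`, away from the root. -/
structure Labels {n : ℕ} (N : TreeNetwork (Fin n)) (r : Fin n) (vtx : ℕ → Fin n) (par : ℕ → ℕ)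
    (len w : ℕ → ℝ) : Prop where
  inj : ∀ i < n, ∀ j < n, vtx i = vtx j → i = j
  root : vtx 0 = r
  par_lt : ∀ i, 0 < i → i < n → par i < i
  par_eq : ∀ i, 0 < i → i < n → N.parent r (vtx i) = vtx (par i)
  len_eq : ∀ i, 0 < i → i < n → len i = N.parentLength r (vtx i)
  w_eq : ∀ i < n, w i = N.weight (vtx i)

/-- The distances from the root, and the radii `ra i * α + rb i` within which a center must lie
for the cost `α`. -/
structure Radii (n : ℕ) (par : ℕ → ℕ) (len w rd ra rb : ℕ → ℝ) : Prop where
  rd_zero : rd 0 = 0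
  rd_eq : ∀ i, 0 < i → i < n → rd i = rd (par i) + len i
  pos : ∀ i < n, 0 < w i → ra i = 1 / w i ∧ rb i = 0
  zero : ∀ i < n, ¬ 0 < w i → ra i = 0 ∧ rb i = 2 * ∑ j ∈ Finset.range n, rd j

variable {n : ℕ} {N : TreeNetwork (Fin n)} {r : Fin n} {vtx : ℕ → Fin n} {par : ℕ → ℕ}
  {len w rd ra rb : ℕ → ℝ}

namespace Labels

theorem surj (hL : Labels N r vtx par len w) (v : Fin n) : ∃ i < n, vtx i = v := by
  have hinj : Function.Injective fun i : Fin n => vtx i := fun i j h =>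
    Fin.ext (hL.inj i i.2 j j.2 h)
  obtain ⟨i, hi⟩ := Finite.surjective_of_injective hinj v
  exact ⟨i, i.2, hi⟩

theorem ne_root (hL : Labels N r vtx par len w) {i : ℕ} (h0 : 0 < i) (hi : i < n) : vtx i ≠ r := by
  intro h
  have := hL.inj i hi 0 (by omega) (h.trans hL.root.symm)
  omega

theorem adj (hL : Labels N r vtx par len w) {i : ℕ} (h0 : 0 < i) (hi : i < n) : N.graph.Adj (vtx i) (vtx (par i)) := by
  rw [← hL.par_eq i h0 hi]
  exact TreeNetwork.adj_parent (hL.ne_root h0 hi)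

theorem length_eq (hL : Labels N r vtx par len w) {i : ℕ} (h0 : 0 < i) (hi : i < n) :
    N.length s(vtx i, vtx (par i)) = len i := by
  rw [hL.len_eq i h0 hi, TreeNetwork.parentLength, if_neg (hL.ne_root h0 hi), hL.par_eq i h0 hi]

theorem shape (hL : Labels N r vtx par len w) : Shape n par len where
  par_lt := hL.par_lt
  len_nonneg i h0 hi := by
    rw [← hL.length_eq h0 hi]
    exact N.length_nonneg _ (hL.adj h0 hi)

theorem dist_par_le (hL : Labels N r vtx par len w) {i : ℕ} (h0 : 0 < i) (hi : i < n) :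
    N.dist (vtx i) (vtx (par i)) ≤ len i := by
  rw [← hL.length_eq h0 hi]
  exact N.dist_le_of_adj (hL.adj h0 hi)

theorem exists_of_adj (hL : Labels N r vtx par len w) {a b : Fin n} (h : N.graph.Adj a b) : ∃ i, 0 < i ∧ i < n ∧
    ((a = vtx i ∧ b = vtx (par i)) ∨ (b = vtx i ∧ a = vtx (par i))) := by
  rcases TreeNetwork.parent_of_adj (r := r) h with ⟨h1, h2⟩ | ⟨h1, h2⟩
  · obtain ⟨i, hi, rfl⟩ := hL.surj a
    have h0 : 0 < i := Nat.pos_of_ne_zero fun h => h1 (h ▸ hL.root)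
    exact ⟨i, h0, hi, .inl ⟨rfl, h2.symm.trans (hL.par_eq i h0 hi)⟩⟩
  · obtain ⟨i, hi, rfl⟩ := hL.surj b
    have h0 : 0 < i := Nat.pos_of_ne_zero fun h => h1 (h ▸ hL.root)
    exact ⟨i, h0, hi, .inr ⟨rfl, h2.symm.trans (hL.par_eq i h0 hi)⟩⟩

/-- This supplies the hypothesis `hD` of `greedy_indep` for the distance of the network. -/
theorem sub_le_dist (hL : Labels N r vtx par len w) (φ : ℕ → ℝ) (hφ : ∀ i, 0 < i → i < n → |φ i - φ (par i)| ≤ len i)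
    (u : ℕ) (hu : u < n) (v : ℕ) (hv : v < n) : φ u - φ v ≤ N.dist (vtx u) (vtx v) := by
  choose inv hinv hvi using hL.surj
  have e : ∀ i < n, inv (vtx i) = i := fun i hi => hL.inj _ (hinv _) _ hi (hvi _)
  have := N.sub_le_dist (φ := fun v => φ (inv v)) (fun a b hab => ?_) (vtx u) (vtx v)
  · simpa [e u hu, e v hv] using this
  · obtain ⟨i, h0, hi, ⟨rfl, rfl⟩ | ⟨rfl, rfl⟩⟩ := hL.exists_of_adj hab
    · have := hL.par_lt i h0 hi
      rw [e i hi, e (par i) (by omega), hL.length_eq h0 hi]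
      exact (abs_le.mp (hφ i h0 hi)).2
    · have := hL.par_lt i h0 hi
      rw [e i hi, e (par i) (by omega), Sym2.eq_swap, hL.length_eq h0 hi]
      linarith [(abs_le.mp (hφ i h0 hi)).1]

theorem rd_nonneg (hL : Labels N r vtx par len w)
    (hR : Radii n par len w rd ra rb) {i : ℕ} (hi : i < n) : 0 ≤ rd i := by
  induction i using Nat.strong_induction_on with
  | _ i ih =>
    rcases Nat.eq_zero_or_pos i with rfl | h0
    · exact hR.rd_zero.ge
    · have := hL.par_lt i h0 hi
      rw [hR.rd_eq i h0 hi]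
      linarith [ih (par i) this (by omega), hL.shape.len_nonneg i h0 hi]

theorem dist_root_le (hL : Labels N r vtx par len w)
    (hR : Radii n par len w rd ra rb) {i : ℕ} (hi : i < n) : N.dist (vtx i) r ≤ rd i := by
  induction i using Nat.strong_induction_on with
  | _ i ih =>
    rcases Nat.eq_zero_or_pos i with rfl | h0
    · rw [hL.root, N.dist_self, hR.rd_zero]
    · have := hL.par_lt i h0 hi
      rw [hR.rd_eq i h0 hi]
      linarith [ih (par i) this (by omega), hL.dist_par_le h0 hi,
        N.dist_triangle (vtx i) (vtx (par i)) r]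

theorem rd_le_sum (hL : Labels N r vtx par len w)
    (hR : Radii n par len w rd ra rb) {i : ℕ} (hi : i < n) : rd i ≤ ∑ j ∈ Finset.range n, rd j :=
  Finset.single_le_sum (f := rd) (fun _ hj => hL.rd_nonneg hR (Finset.mem_range.mp hj))
    (Finset.mem_range.mpr hi)

/-- It makes the radius that `Radii` assigns to a vertex of weight zero no constraint at all, so
such vertices need no separate treatment in the sweep. -/
theorem distTo_le (hL : Labels N r vtx par len w)
    (hR : Radii n par len w rd ra rb) {i : ℕ} (hi : i < n) (x : N.Point) :
    N.distTo (vtx i) x ≤ 2 * ∑ j ∈ Finset.range n, rd j := by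
  have h2 : ∀ i < n, ∀ j < n, N.dist (vtx i) (vtx j) ≤ rd i + rd j := fun i hi j hj => by
    have := N.dist_triangle (vtx i) r (vtx j)
    rw [N.dist_comm r (vtx j)] at this
    linarith [hL.dist_root_le hR hi, hL.dist_root_le hR hj]
  have hs := hL.rd_le_sum hR hi
  cases x with
  | vertex v =>
    obtain ⟨j, hj, rfl⟩ := hL.surj v
    exact (h2 i hi j hj).trans (by linarith [hL.rd_le_sum hR hj])
  | edge a b hab t h0 h1 =>
    simp only [TreeNetwork.distTo]
    obtain ⟨j, hj0, hj, ⟨rfl, rfl⟩ | ⟨rfl, rfl⟩⟩ := hL.exists_of_adj hab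
    · refine (min_le_right _ _).trans ?_
      have hp := hL.par_lt j hj0 hj
      rw [hL.length_eq hj0 hj]
      linarith [h2 i hi (par j) (by omega), hR.rd_eq j hj0 hj, hL.rd_le_sum hR hj]
    · refine (min_le_left _ _).trans ?_
      have hp := hL.par_lt j hj0 hj
      rw [Sym2.eq_swap, hL.length_eq hj0 hj] at h1
      linarith [h2 i hi (par j) (by omega), hR.rd_eq j hj0 hj, hL.rd_le_sum hR hj]

theorem cost_le_iff (hL : Labels N r vtx par len w)
    (hR : Radii n par len w rd ra rb) {i : ℕ} (hi : i < n) {α : ℝ} (hα : 0 ≤ α) (x : N.Point) :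
    N.cost (vtx i) x ≤ α ↔ N.distTo (vtx i) x ≤ ra i * α + rb i := by
  unfold TreeNetwork.cost
  rw [← hL.w_eq i hi]
  by_cases hw : 0 < w i
  · obtain ⟨h1, h2⟩ := hR.pos i hi hw
    rw [h1, h2, add_zero, one_div, inv_mul_eq_div, le_div_iff₀ hw]
  · obtain ⟨h1, h2⟩ := hR.zero i hi hw
    have hw0 : w i = 0 := le_antisymm (not_lt.mp hw) (hL.w_eq i hi ▸ N.weight_nonneg _)
    rw [h1, h2, hw0, mul_zero, zero_mul, zero_add]
    exact iff_of_true hα (hL.distTo_le hR hi x)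

theorem radius_nonneg (hL : Labels N r vtx par len w)
    (hR : Radii n par len w rd ra rb) {i : ℕ} (hi : i < n) {α : ℝ} (hα : 0 ≤ α) : 0 ≤ ra i * α + rb i := by
  by_cases hw : 0 < w i
  · obtain ⟨h1, h2⟩ := hR.pos i hi hw
    rw [h1, h2, add_zero]
    positivity
  · obtain ⟨h1, h2⟩ := hR.zero i hi hw
    rw [h1, h2, zero_mul, zero_add]
    linarith [hL.rd_le_sum hR hi, hL.rd_nonneg hR hi]

/-- The centers of the greedy algorithm, padded with the root, cover all vertices. -/
theorem exists_covers (hL : Labels N r vtx par len w)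
    (hR : Radii n par len w rd ra rb) {p : ℕ} {α : ℝ} (hα : 0 ≤ α) (hn : 0 < n)
    (hc : (greedy n par len (fun i => ra i * α + rb i) (n - 1)).count ≤ p) :
    ∃ c : Fin p → N.Point, N.Covers c α ∧ ∀ k : Fin p, (c k).code =
      if h : (k : ℕ) < (greedy n par len (fun i => ra i * α + rb i) (n - 1)).cs.length then
        (((vtx ((greedy n par len (fun i => ra i * α + rb i) (n - 1)).cs[(k : ℕ)]).1 : Fin n) : ℕ),
          ((vtx (par ((greedy n par len (fun i => ra i * α + rb i) (n - 1)).cs[(k : ℕ)]).1) : Fin n)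
            : ℕ), ((greedy n par len (fun i => ra i * α + rb i) (n - 1)).cs[(k : ℕ)]).2)
      else ((r : ℕ), (r : ℕ), 0) := by
  have hr : ∀ i < n, 0 ≤ ra i * α + rb i := fun i hi => hL.radius_nonneg hR hi hα
  set s := greedy n par len (fun i => ra i * α + rb i) (n - 1) with hs
  -- The formula makes sense for all pairs, also for those that name no point of the network, so the
  -- change along an edge is bounded without side conditions.
  let δ : ℕ → ℕ × ℝ → ℝ := fun u c => min (N.dist (vtx u) (vtx c.1) + c.2)
    (N.dist (vtx u) (vtx (par c.1)) + (len c.1 - c.2))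
  have hδ : ∀ i, 0 < i → i < n → ∀ c, δ i c ≤ len i + δ (par i) c ∧
      δ (par i) c ≤ len i + δ i c := by
    intro i h0 hi c
    have h1 := hL.dist_par_le h0 hi
    have h2 := N.dist_comm (vtx i) (vtx (par i))
    constructor
    · simp only [δ]
      rw [← min_add_add_left]
      exact min_le_min (by linarith [N.dist_triangle (vtx i) (vtx (par i)) (vtx c.1)])
        (by linarith [N.dist_triangle (vtx i) (vtx (par i)) (vtx (par c.1))])
    · simp only [δ]
      rw [← min_add_add_left]
      exact min_le_min (by linarith [N.dist_triangle (vtx (par i)) (vtx i) (vtx c.1)])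
        (by linarith [N.dist_triangle (vtx (par i)) (vtx i) (vtx (par c.1))])
  have hδ' : ∀ i t, 0 < i → i < n → 0 ≤ t → t ≤ len i →
      δ i (i, t) ≤ t ∧ δ (par i) (i, t) ≤ len i - t := by
    intro i t _ _ _ _
    exact ⟨(min_le_left _ _).trans (by simp [N.dist_self]),
      (min_le_right _ _).trans (by simp [N.dist_self])⟩
  have hcov := greedy_covers hL.shape hr hn hR.rd_eq hδ hδ' hR.rd_zero
  obtain ⟨-, -, hval⟩ := greedy_served hL.shape hr hR.rd_eq hδ hδ' (k := n - 1) (by omega)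
  rw [← hs] at hcov hval
  have hpt : ∀ c ∈ s.cs, ∃ x : N.Point, x.code = (((vtx c.1 : Fin n) : ℕ),
      ((vtx (par c.1) : Fin n) : ℕ), c.2) ∧ ∀ u, N.distTo (vtx u) x = δ u c := by
    intro c hc
    obtain ⟨h0, h1, h2, h3⟩ := hval c hc
    refine ⟨.edge (vtx c.1) (vtx (par c.1)) (hL.adj h0 h1) c.2 h2
      (by rwa [hL.length_eq h0 h1]), rfl, fun u => ?_⟩
    simp only [TreeNetwork.distTo, δ, hL.length_eq h0 h1]
  choose pt hpt1 hpt2 using hpt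
  refine ⟨fun k => if h : (k : ℕ) < s.cs.length then pt (s.cs[(k : ℕ)]) (List.getElem_mem h)
    else .vertex r, ?_, ?_⟩
  · intro v
    obtain ⟨u, hu, rfl⟩ := hL.surj v
    unfold GState.count at hc
    rcases hcov u hu with ⟨c, hcm, hcd⟩ | ⟨h0, h1⟩
    · obtain ⟨k, hk, rfl⟩ := List.mem_iff_getElem.mp hcm
      refine ⟨⟨k, by omega⟩, ?_⟩
      rw [hL.cost_le_iff hR hu hα]
      simp only [hk, dif_pos]
      rwa [hpt2]
    · rw [if_pos h0] at hc
      refine ⟨⟨s.cs.length, by omega⟩, ?_⟩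
      rw [hL.cost_le_iff hR hu hα]
      simp only [lt_irrefl, dif_neg, not_false_eq_true]
      exact (hL.dist_root_le hR hu).trans h1
  · intro k
    dsimp only
    split_ifs with h
    · exact hpt1 _ _
    · rfl

/-- By the pigeonhole principle two vertices of `I` share a center, and the way through it would be
shorter than their distance. -/
theorem not_feasible_of_indep (hL : Labels N r vtx par len w)
    (hR : Radii n par len w rd ra rb) {p : ℕ} {α : ℝ} (hα : 0 ≤ α) {I : Finset ℕ}
    (hI : I ⊆ Finset.range n) (hp : p < I.card)
    (hind : ∀ u ∈ I, ∀ v ∈ I, u ≠ v →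
      (ra u * α + rb u) + (ra v * α + rb v) < N.dist (vtx u) (vtx v)) : ¬ N.Feasible p α := by
  rintro ⟨c, hc⟩
  choose f hf using hc
  obtain ⟨u, hu, v, hv, hne, he⟩ := Finset.exists_ne_map_eq_of_card_lt_of_maps_to
    (s := I) (t := (Finset.univ : Finset (Fin p))) (f := fun u => f (vtx u)) (by simpa using hp)
    (fun _ _ => by simp)
  have h1 := (hL.cost_le_iff hR (Finset.mem_range.mp (hI hu)) hα _).mp (hf (vtx u))
  have h2 := (hL.cost_le_iff hR (Finset.mem_range.mp (hI hv)) hα _).mp (hf (vtx v))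
  rw [← he] at h2
  linarith [hind u hu v hv hne,
    TreeNetwork.dist_le_distTo_add (vtx u) (vtx v) (c (f (vtx u)))]

theorem exists_indep (hL : Labels N r vtx par len w)
    (hR : Radii n par len w rd ra rb) {α : ℝ} (hα : 0 ≤ α) (hn : 0 < n) : ∃ I ⊆ Finset.range n,
    I.card = (greedy n par len (fun i => ra i * α + rb i) (n - 1)).count ∧
    ∀ u ∈ I, ∀ v ∈ I, u ≠ v →
      (ra u * α + rb u) + (ra v * α + rb v) < N.dist (vtx u) (vtx v) :=
  greedy_indep hL.shape (fun _ hi => hL.radius_nonneg hR hi hα) hn hR.rd_eq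
    (D := fun u v => N.dist (vtx u) (vtx v)) hL.sub_le_dist

/-- The greedy algorithm uses the minimum number of centers. -/
theorem feasible_iff (hL : Labels N r vtx par len w)
    (hR : Radii n par len w rd ra rb) {p : ℕ} {α : ℝ} (hα : 0 ≤ α) (hn : 0 < n) :
    N.Feasible p α ↔ (greedy n par len (fun i => ra i * α + rb i) (n - 1)).count ≤ p := by
  constructor
  · intro h
    by_contra hc
    obtain ⟨I, h1, h2, h3⟩ := hL.exists_indep hR hα hn
    exact hL.not_feasible_of_indep hR hα h1 (by omega) h3 h
  · intro h
    obtain ⟨c, hc, -⟩ := hL.exists_covers hR hα hn h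
    exact ⟨c, hc⟩

/-- The costs that are not feasible form an open set. -/
theorem exists_not_feasible (hL : Labels N r vtx par len w)
    (hR : Radii n par len w rd ra rb) {p : ℕ} {lo hi : ℝ} (h0 : 0 ≤ lo) (hlh : lo < hi) (hn : 0 < n)
    (hlo : ¬ N.Feasible p lo) : ∃ α, lo < α ∧ α < hi ∧ ¬ N.Feasible p α := by
  rw [hL.feasible_iff hR h0 hn, not_le] at hlo
  obtain ⟨I, h1, h2, h3⟩ := hL.exists_indep hR h0 hn
  -- Independence consists of finitely many strict inequalities that are continuous in the cost, so
  -- the witness of infeasibility at `lo` persists slightly above it.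
  have hev : ∀ᶠ α in nhdsWithin lo (Set.Ioi lo), ∀ u ∈ I, ∀ v ∈ I, u ≠ v →
      (ra u * α + rb u) + (ra v * α + rb v) < N.dist (vtx u) (vtx v) := by
    refine Filter.Eventually.filter_mono nhdsWithin_le_nhds ?_
    rw [Filter.eventually_all_finset]
    intro u hu
    rw [Filter.eventually_all_finset]
    intro v hv
    by_cases huv : u = v
    · exact Filter.Eventually.of_forall fun _ h => absurd huv h
    · have hcont : Continuous fun α : ℝ => (ra u * α + rb u) + (ra v * α + rb v) := by fun_prop
      filter_upwards [hcont.continuousAt.eventually_lt continuousAt_const (h3 u hu v hv huv)]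
        with α h _ using h
  obtain ⟨α, hα, hα1, hα2⟩ := (hev.and (Ioo_mem_nhdsGT hlh)).exists
  exact ⟨α, hα1, hα2, hL.not_feasible_of_indep hR (by linarith) h1 (by omega) hα⟩

/-- The optimal cost, once all comparisons are decided. -/
theorem le_of_feasible (hL : Labels N r vtx par len w)
    (hR : Radii n par len w rd ra rb) {p : ℕ} {lo hi : ℝ} (h0 : 0 ≤ lo) (hlh : lo < hi) (hn : 0 < n)
    (hlo : ¬ N.Feasible p lo)
    (hdec : ∀ i, 0 < i → i < n → ¬ Waiting n par len ra rb lo hi i ∧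
      ¬ Active n par len ra rb lo hi i) {β : ℝ} (hβ : N.Feasible p β) : hi ≤ β := by
  by_contra hc
  rw [not_le] at hc
  have hβ1 : lo < β := by
    by_contra h
    exact hlo (hβ.mono (not_lt.mp h))
  -- Some cost inside the interval is infeasible, and the number of centers is the same at `β`,
  -- which is feasible: a contradiction.
  obtain ⟨α, hα1, hα2, hα⟩ := hL.exists_not_feasible hR h0 hlh hn hlo
  have hcount := count_const hL.shape hn hlh
    (fun i hi' => ⟨hL.radius_nonneg hR hi' h0, hL.radius_nonneg hR hi' (by linarith)⟩)
    (fun i h h' => (hdec i h h').1) (fun i h h' => (hdec i h h').2) hα1 hα2 hβ1 hc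
  rw [hL.feasible_iff hR (by linarith) hn] at hα hβ
  omega

/-- A cost that is feasible with a center at the root. -/
theorem feasible_sum (hL : Labels N r vtx par len w)
    (hR : Radii n par len w rd ra rb) {p : ℕ} (hp : 1 ≤ p) :
    N.Feasible p (∑ i ∈ Finset.range n, rd i * w i) := by
  refine ⟨fun _ => .vertex r, fun v => ⟨⟨0, hp⟩, ?_⟩⟩
  obtain ⟨i, hi, rfl⟩ := hL.surj v
  have hw : ∀ i < n, 0 ≤ w i := fun i hi => hL.w_eq i hi ▸ N.weight_nonneg _
  calc N.cost (vtx i) (.vertex r) ≤ rd i * w i := by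
        unfold TreeNetwork.cost
        rw [← hL.w_eq i hi]
        exact mul_le_mul_of_nonneg_right (hL.dist_root_le hR hi) (hw i hi)
    _ ≤ _ := Finset.single_le_sum (f := fun i => rd i * w i)
        (fun j hj => mul_nonneg (hL.rd_nonneg hR (Finset.mem_range.mp hj))
          (hw j (Finset.mem_range.mp hj))) (Finset.mem_range.mpr hi)

end Labels

end PCenter

/-! ### The program, and its greedy feasibility test. -/

namespace PCenter

open RealRAM

notation:60 c:61 "⨾" d:60 => RealRAM.Prog.seq c d

/-! ### The program

Word variables: `0` number of vertices, `1` number of centers, `2` root, `3` number of labels,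
`4` vertex, `6`, `8`, `17` loop counters, `7` number of steps, `9` label, `10` label of the parent,
`11` number of centers below the root, `12` number of centers, `13` number of new entries,
`14` first free cell of the tape, `15`, `16` begin and end of the sorted entries, `18`, …, `21`
begin and end of two runs, `22` whether the search goes on.

Word arrays: `0` parents, `1`, `2` edges of the centers, `3` marks, `4` vertex of a label,
`5` label of a vertex, `6` parents of the labels, `7` blocked labels, `8` seen labels, `9`, `10` begin
and end of the runs.

Real variables: `0` result, `1` cost to be tested, `2`, `3` lower and upper bound, `4` midpoint,
`5`, `6`, `8`, …, `11` auxiliary values, `7` sum of the root distances, `12` weight of the entries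
between the bounds, `13` partial sum.

Real arrays: `0` lengths, `1` weights, `2` positions of the centers, `3` lengths by labels,
`4` weights by labels, `5` root distances, `6` auxiliary values for the weights of the steps,
`7` weights of the steps, `8`, `9` coefficients of the radii, `10` accumulated values, `11`, `12`
coefficients of the accumulated values, `13`, `14` tape of entries: values and weights. -/

/-- Label the vertex `4` if its parent is labelled. -/
def labelBody : Prog :=
  .ite (.and (.ile (.arr 3 (.var 4)) (.const 0)) (.ile (.const 1) (.arr 3 (.arr 0 (.var 4)))))
    (.istore 4 (.var 3) (.var 4) ⨾
      .istore 5 (.var 4) (.var 3) ⨾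
      .istore 6 (.var 3) (.arr 5 (.arr 0 (.var 4))) ⨾
      .rstore 3 (.var 3) (.arr 0 (.var 4)) ⨾
      .rstore 4 (.var 3) (.arr 1 (.var 4)) ⨾
      .istore 3 (.var 4) (.const 1) ⨾
      .iset 3 (.add (.var 3) (.const 1)))
    .skip

/-- Label the vertices away from the root. -/
def labelProg : Prog :=
  (.istore 4 (.const 0) (.var 2) ⨾
    .rstore 4 (.const 0) (.arr 1 (.var 2)) ⨾
    .istore 3 (.var 2) (.const 1) ⨾
    .iset 3 (.const 1)) ⨾
  .loop (.not (.ile (.var 0) (.var 3))) (.iset 4 (.const 0) ⨾ forUp 4 0 labelBody)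

/-- Root distances and weights of the steps. -/
def initBody : Prog :=
  .iset 10 (.arr 6 (.var 6)) ⨾
  .rstore 5 (.var 6) (.add (.arr 5 (.var 10)) (.arr 3 (.var 6))) ⨾
  .rset 7 (.add (.var 7) (.arr 5 (.var 6))) ⨾
  .rset 3 (.add (.var 3) (.mul (.arr 5 (.var 6)) (.arr 4 (.var 6)))) ⨾
  .rset 5 (.mul (.arr 6 (.var 10)) (.const 4)) ⨾
  .rstore 6 (.var 10) (.var 5) ⨾
  .rstore 6 (.var 6) (.var 5) ⨾
  .rstore 7 (.var 6) (.var 5)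

/-- Coefficients of the radii. -/
def radiusBody : Prog :=
  .ite (.rle (.arr 4 (.var 6)) (.const 0))
    (.rstore 8 (.var 6) (.const 0) ⨾ .rstore 9 (.var 6) (.add (.var 7) (.var 7)))
    (.rstore 8 (.var 6) (.div (.const 1) (.arr 4 (.var 6))) ⨾ .rstore 9 (.var 6) (.const 0))

/-- The first loop starts at label 1, as the root has no parent. Real variable `3` collects the sum
of `rd i * w i`, a cost feasible with one center at the root, which serves as the first upper bound.
-/
def initProg : Prog :=
  (.iset 7 (.sub (.var 0) (.const 1)) ⨾
    .rstore 6 (.const 0) (.const 1) ⨾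
    .rstore 5 (.const 0) (.const 0) ⨾
    .rset 7 (.const 0) ⨾
    .rset 3 (.const 0) ⨾
    .iset 6 (.const 1)) ⨾
  forUp 6 0 initBody ⨾ .iset 6 (.const 0) ⨾ forUp 6 0 radiusBody

/-- The test whether `y` is closer to zero than `a`. -/
def closerTest (y a : RExpr) : BExpr :=
  .or (.not (.rle (.mul a a) (.mul y y)))
    (.and (.rle (.mul y y) (.mul a a)) (.not (.rle (.const 0) y)))

/-- Variable `7` holds `n - 1`, so a counter `k` in variable `8` selects the label `n - 1 - k`, as
in `greedy`. -/
def greedyBody : Prog :=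
  (.iset 9 (.sub (.var 7) (.var 8)) ⨾
    .iset 10 (.arr 6 (.var 9)) ⨾
    .rset 5 (.arr 10 (.var 9)) ⨾
    .rset 6 (.sub (.var 5) (.arr 3 (.var 9))) ⨾
    .rset 8 (.arr 10 (.var 10))) ⨾
  .ite (.and (.rle (.const 0) (.var 5)) (.not (.rle (.const 0) (.var 6))))
    (.istore 1 (.var 11) (.arr 4 (.var 9)) ⨾
      .istore 2 (.var 11) (.arr 4 (.var 10)) ⨾
      .rstore 2 (.var 11) (.var 5) ⨾
      .iset 11 (.add (.var 11) (.const 1)))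
    .skip ⨾
  .ite (closerTest (.var 6) (.var 8)) (.rstore 10 (.var 10) (.var 6)) .skip

/-- The greedy algorithm for the cost in the real variable `1`. -/
def greedyProg : Prog :=
  .iset 6 (.const 0) ⨾
  forUp 6 0 (.rstore 10 (.var 6) (.add (.mul (.arr 8 (.var 6)) (.var 1)) (.arr 9 (.var 6)))) ⨾
  (.iset 11 (.const 0) ⨾ .iset 8 (.const 0)) ⨾
  forUp 8 7 greedyBody ⨾
  .ite (.rle (.const 0) (.arr 10 (.const 0))) (.iset 12 (.add (.var 11) (.const 1)))
    (.iset 12 (.var 11))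

/-- Record the critical value of the affine function with the given coefficients. -/
def crossTest (a b : RExpr) : Prog :=
  .ite (.not (.rle (.const 0) (.mul (.add (.mul a (.var 2)) b) (.add (.mul a (.var 3)) b))))
    (.istore 7 (.var 10) (.const 1) ⨾
      .ite (.ile (.arr 8 (.var 9)) (.const 0))
        (.rstore 13 (.var 14) (.div (.sub (.const 0) b) a) ⨾
          .rstore 14 (.var 14) (.arr 7 (.var 9)) ⨾
          .iset 13 (.add (.var 13) (.const 1)) ⨾
          .istore 9 (.var 13) (.var 14) ⨾
          .iset 14 (.add (.var 14) (.const 1)) ⨾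
          .istore 10 (.var 13) (.var 14))
        .skip)
    .skip

/-- The end of the loop body of the symbolic run. -/
def passUpdate : Prog :=
  .istore 8 (.var 9) (.const 1) ⨾
  .ite (.and (.ile (.arr 7 (.var 10)) (.const 0))
      (closerTest (.add (.mul (.var 8) (.var 4)) (.var 9))
        (.add (.mul (.var 10) (.var 4)) (.var 11))))
    (.rstore 11 (.var 10) (.var 8) ⨾ .rstore 12 (.var 10) (.var 9)) .skip

/-- The three tests correspond to the three functions of `Unresolved`. Each may set the same flag of
the parent, from which `passUpdate` learns whether the comparison is decided. -/
def passBody : Prog :=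
  (.iset 9 (.sub (.var 7) (.var 8)) ⨾ .iset 10 (.arr 6 (.var 9))) ⨾
  .ite (.or (.not (.ile (.arr 7 (.var 9)) (.const 0))) (.not (.ile (.arr 7 (.var 10)) (.const 0))))
    (.istore 7 (.var 10) (.const 1))
    ((.rset 8 (.arr 11 (.var 9)) ⨾
        .rset 9 (.sub (.arr 12 (.var 9)) (.arr 3 (.var 9))) ⨾
        .rset 10 (.arr 11 (.var 10)) ⨾
        .rset 11 (.arr 12 (.var 10))) ⨾
      crossTest (.var 8) (.var 9) ⨾
      crossTest (.sub (.var 8) (.var 10)) (.sub (.var 9) (.var 11)) ⨾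
      crossTest (.add (.var 8) (.var 10)) (.add (.var 9) (.var 11)) ⨾
      passUpdate)

/-- The symbolic run of the greedy algorithm between the bounds. -/
def passProg : Prog :=
  (.rset 4 (.div (.add (.var 2) (.var 3)) (.const 2)) ⨾ .iset 6 (.const 0)) ⨾
  forUp 6 0 (.rstore 11 (.var 6) (.arr 8 (.var 6)) ⨾ .rstore 12 (.var 6) (.arr 9 (.var 6)) ⨾
    .istore 7 (.var 6) (.const 0)) ⨾
  (.iset 13 (.const 0) ⨾ .iset 8 (.const 0)) ⨾
  forUp 8 7 passBody

/-- Move the smaller first entry of two runs to the end of the tape. -/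
def mergeStep : Prog :=
  .ite (.or (.ile (.var 21) (.var 20)) (.and (.not (.ile (.var 19) (.var 18)))
      (.rle (.arr 13 (.var 18)) (.arr 13 (.var 20)))))
    (.rstore 13 (.var 14) (.arr 13 (.var 18)) ⨾ .rstore 14 (.var 14) (.arr 14 (.var 18)) ⨾
      .iset 18 (.add (.var 18) (.const 1)))
    (.rstore 13 (.var 14) (.arr 13 (.var 20)) ⨾ .rstore 14 (.var 14) (.arr 14 (.var 20)) ⨾
      .iset 20 (.add (.var 20) (.const 1))) ⨾
  .iset 14 (.add (.var 14) (.const 1))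

/-- Merge two runs. -/
def mergeLoop : Prog :=
  .loop (.or (.not (.ile (.var 19) (.var 18))) (.not (.ile (.var 21) (.var 20)))) mergeStep

/-- Merge the next two runs of the queue into a new one. -/
def mergeBody : Prog :=
  (.iset 18 (.arr 9 (.add (.add (.var 17) (.var 17)) (.const 1))) ⨾
    .iset 19 (.arr 10 (.add (.add (.var 17) (.var 17)) (.const 1))) ⨾
    .iset 20 (.arr 9 (.add (.add (.var 17) (.var 17)) (.const 2))) ⨾
    .iset 21 (.arr 10 (.add (.add (.var 17) (.var 17)) (.const 2))) ⨾
    .istore 9 (.add (.add (.var 13) (.var 17)) (.const 1)) (.var 14)) ⨾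
  mergeLoop ⨾ .istore 10 (.add (.add (.var 13) (.var 17)) (.const 1)) (.var 14)

/-- Sort the new entries and merge them with the old ones. -/
def sortProg : Prog :=
  (.istore 9 (.add (.var 13) (.var 13)) (.var 15) ⨾
    .istore 10 (.add (.var 13) (.var 13)) (.var 16) ⨾
    .iset 17 (.const 0)) ⨾
  forUp 17 13 mergeBody ⨾
  (.iset 15 (.arr 9 (.add (.var 13) (.var 13))) ⨾ .iset 16 (.arr 10 (.add (.var 13) (.var 13))))

/-- The entry `6` lies between the bounds. -/
def insideTest : BExpr :=
  .and (.not (.rle (.arr 13 (.var 6)) (.var 2))) (.not (.rle (.var 3) (.arr 13 (.var 6))))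

/-- The weight of the entries between the bounds. -/
def totalProg : Prog :=
  (.rset 12 (.const 0) ⨾ .iset 6 (.var 15)) ⨾
  forUp 6 16 (.ite insideTest (.rset 12 (.add (.var 12) (.arr 14 (.var 6)))) .skip)

/-- The weighted median of the entries between the bounds. -/
def medianProg : Prog :=
  (.rset 13 (.const 0) ⨾ .iset 6 (.var 15)) ⨾
  forUp 6 16 (.ite (.and insideTest (.not (.rle (.var 12) (.add (.var 13) (.var 13)))))
    (.rset 13 (.add (.var 13) (.arr 14 (.var 6))) ⨾ .rset 1 (.arr 13 (.var 6))) .skip)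

/-- Collect the undecided comparisons. -/
def collectProg : Prog := passProg ⨾ sortProg ⨾ totalProg

/-- One round of the search. -/
def searchBody : Prog :=
  collectProg ⨾
  .ite (.rle (.var 12) (.const 0)) (.iset 22 (.const 0))
    (medianProg ⨾ greedyProg ⨾
      .ite (.ile (.var 12) (.var 1)) (.rset 3 (.var 1)) (.rset 2 (.var 1)))

def searchProg : Prog := .loop (.ile (.const 1) (.var 22)) searchBody

/-- Decide whether the cost zero is feasible. -/
def startProg : Prog :=
  .rset 1 (.const 0) ⨾ greedyProg ⨾
  (.rset 2 (.const 0) ⨾ .iset 14 (.const 0) ⨾ .iset 15 (.const 0) ⨾ .iset 16 (.const 0) ⨾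
    .ite (.ile (.var 12) (.var 1)) (.rset 3 (.const 0) ⨾ .iset 22 (.const 0)) (.iset 22 (.const 1)))

/-- Output the centers and the cost. -/
def outputProg : Prog :=
  .rset 1 (.var 3) ⨾ greedyProg ⨾ .iset 6 (.var 11) ⨾
  forUp 6 1 (.istore 1 (.var 6) (.var 2) ⨾ .istore 2 (.var 6) (.var 2) ⨾
    .rstore 2 (.var 6) (.const 0)) ⨾
  .rset 0 (.var 3)

/-- The program for the weighted discrete `p`-center problem. -/
def mainProg : Prog := labelProg ⨾ initProg ⨾ startProg ⨾ searchProg ⨾ outputProg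

/-! ### The greedy algorithm -/

/-- The cells that do not change after the initialization. -/
structure Env (n p : ℕ) (r : Fin n) (vtx : ℕ → Fin n) (par : ℕ → ℕ) (len ra rb : ℕ → ℝ)
    (σ : Store) : Prop where
  hn : σ.ivar 0 = n
  hp : σ.ivar 1 = p
  hroot : σ.ivar 2 = r
  hm : σ.ivar 7 = n - 1
  hvtx : ∀ i < n, σ.iarr 4 i = vtx i
  hpar : σ.iarr 6 = par
  hlen : σ.rarr 3 = len
  hwt : ∀ i, 0 < i → i < n → σ.rarr 7 i = wt par i
  hra : σ.rarr 8 = ra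
  hrb : σ.rarr 9 = rb

/-- The program does not write the cells of the environment. -/
def keepsEnv (c : Prog) : Bool :=
  !(c.writesI 0 || c.writesI 1 || c.writesI 2 || c.writesI 7 || c.writesIA 4 || c.writesIA 6 ||
    c.writesRA 3 || c.writesRA 7 || c.writesRA 8 || c.writesRA 9)

variable {n p W : ℕ} {r : Fin n} {vtx : ℕ → Fin n} {par : ℕ → ℕ} {len ra rb : ℕ → ℝ}

theorem Env.frame {σ σ' : Store} {c : RealRAM.Prog} (h : Env n p r vtx par len ra rb σ)
    (hf : Frame c σ σ') (hc : keepsEnv c = true) : Env n p r vtx par len ra rb σ' := by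
  simp only [keepsEnv, Bool.not_eq_true', Bool.or_eq_false_iff] at hc
  obtain ⟨⟨⟨⟨⟨⟨⟨⟨⟨h0, h1⟩, h2⟩, h3⟩, h4⟩, h5⟩, h6⟩, h7⟩, h8⟩, h9⟩ := hc
  exact ⟨(hf.i _ h0).trans h.hn, (hf.i _ h1).trans h.hp, (hf.i _ h2).trans h.hroot,
    (hf.i _ h3).trans h.hm, fun i hi => (congrFun (hf.ia _ h4) i).trans (h.hvtx i hi),
    (hf.ia _ h5).trans h.hpar, (hf.ra _ h6).trans h.hlen,
    fun i h0 hi => (congrFun (hf.ra _ h7) i).trans (h.hwt i h0 hi), (hf.ra _ h8).trans h.hra,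
    (hf.ra _ h9).trans h.hrb⟩

/-- The cells that hold the state of the greedy algorithm. -/
structure GreedyCells (n : ℕ) (vtx : ℕ → Fin n) (par : ℕ → ℕ) (s : GState) (σ : Store) : Prop where
  acc : ∀ u < n, σ.rarr 10 u = s.acc u
  len : σ.ivar 11 = s.cs.length
  cs : ∀ j c, s.cs[j]? = some c →
    σ.iarr 1 j = vtx c.1 ∧ σ.iarr 2 j = vtx (par c.1) ∧ σ.rarr 2 j = c.2

theorem exec_greedyBody {k : ℕ} {s : GState} {σ : Store} (hs : Shape n par len)
    (hE : Env n p r vtx par len ra rb σ) (hk : σ.ivar 8 = k) (hk' : k < n - 1)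
    (hg : GreedyCells n vtx par s σ) (hlen : s.cs.length + 1 ≤ W) (hW : 1 ≤ W) :
    ∃ σ' t, Exec W greedyBody σ σ' t ∧ t ≤ 100 ∧
      GreedyCells n vtx par (gstep par len (n - 1 - k) s) (σ'.setI 8 (k + 1)) := by
  have hp := hs.par_lt (n - 1 - k) (by omega) (by omega)
  obtain ⟨σ', t, h1, h2, h3⟩ := Prog.wp_sound (W := W) greedyBody (σ := σ)
    (Q := fun σ' => GreedyCells n vtx par (gstep par len (n - 1 - k) s) (σ'.setI 8 (k + 1))) (by
      have a1 := hg.acc (n - 1 - k) (by omega)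
      have a2 := hg.acc (par (n - 1 - k)) (by omega)
      have v1 := hE.hvtx (n - 1 - k) (by omega)
      have v2 := hE.hvtx (par (n - 1 - k)) (by omega)
      simp [greedyBody, closerTest, hE.hm, hE.hpar, hE.hlen, hk, a1, a2, v1, v2, hg.len]
      -- The four branches differ only in whether a center is placed (`q`) and whether the parent's
      -- value is replaced (`q'`).
      have key : ∀ (τ : Store) (q q' : Prop) [Decidable q] [Decidable q'],
          (q ↔ 0 ≤ s.acc (n - 1 - k) ∧ s.acc (n - 1 - k) - len (n - 1 - k) < 0) →
          (q' ↔ Closer (s.acc (n - 1 - k) - len (n - 1 - k)) (s.acc (par (n - 1 - k)))) →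
          (τ.rarr 10 = if q' then Function.update (σ.rarr 10) (par (n - 1 - k))
            (s.acc (n - 1 - k) - len (n - 1 - k)) else σ.rarr 10) →
          (τ.ivar 11 = if q then s.cs.length + 1 else s.cs.length) →
          (τ.iarr 1 = if q then Function.update (σ.iarr 1) s.cs.length (vtx (n - 1 - k))
            else σ.iarr 1) →
          (τ.iarr 2 = if q then Function.update (σ.iarr 2) s.cs.length (vtx (par (n - 1 - k)))
            else σ.iarr 2) →
          (τ.rarr 2 = if q then Function.update (σ.rarr 2) s.cs.length (s.acc (n - 1 - k))
            else σ.rarr 2) →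
          GreedyCells n vtx par (gstep par len (n - 1 - k) s) τ := by
        intro τ q q' _ _ hq hq' e1 e2 e3 e4 e5
        refine ⟨fun u hu => ?_, ?_, fun j c hj => ?_⟩
        · simp only [gstep, ← hq', e1]
          by_cases hh : q'
          · simp only [if_pos hh, Function.update_apply, hg.acc u hu]
          · simp only [if_neg hh, hg.acc u hu]
        · simp only [gstep, ← hq, e2]
          split_ifs <;> simp
        · simp only [gstep, ← hq] at hj
          by_cases hh : q
          · simp only [if_pos hh] at hj e3 e4 e5
            rw [e3, e4, e5]
            rw [List.getElem?_append] at hj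
            split_ifs at hj with hlt
            · simp only [Function.update_of_ne hlt.ne]
              exact hg.cs j c hj
            · obtain ⟨hj0, hc⟩ : j - s.cs.length = 0 ∧ (n - 1 - k, s.acc (n - 1 - k)) = c := by
                simpa [List.getElem?_cons] using hj
              obtain rfl : j = s.cs.length := by omega
              subst hc
              simp
          · simp only [if_neg hh] at hj e3 e4 e5
            rw [e3, e4, e5]
            exact hg.cs j c hj
      refine ⟨fun h1 h2 => ⟨⟨hW, hlen⟩, fun h3 => ?_, fun h3 h4 => ?_⟩,
        fun h1 => ⟨fun h3 => ?_, fun h3 h4 => ?_⟩⟩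
      · exact key _ True True (by simp [h1, h2]) (by simpa [Closer] using h3) (by simp) (by simp)
          (by simp) (by simp) (by simp)
      · exact key _ True False (by simp [h1, h2]) (by simpa [Closer, h3] using h4) (by simp)
          (by simp) (by simp) (by simp) (by simp)
      · exact key _ False True (by simpa using h1) (by simpa [Closer] using h3) (by simp)
          (by simp [hg.len]) (by simp) (by simp) (by simp)
      · exact key _ False False (by simpa using h1) (by simpa [Closer, h3] using h4) (by simp)
          (by simp [hg.len]) (by simp) (by simp) (by simp))
  exact ⟨σ', t, h1, h2.trans (by decide), h3⟩

theorem greedy_cs_length_le {R : ℕ → ℝ} (k : ℕ) : (greedy n par len R k).cs.length ≤ k := by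
  induction k with
  | zero => simp [greedy]
  | succ k ih =>
    simp only [greedy, gstep]
    split_ifs
    · simpa using ih
    · omega

theorem exec_greedyProg {σ : Store} {α : ℝ} (hs : Shape n par len) (hn : 0 < n) (hnW : n + 1 ≤ W)
    (hE : Env n p r vtx par len ra rb σ) (hα : σ.rvar 1 = α) :
    ∃ σ' t, Exec W greedyProg σ σ' t ∧ t ≤ 200 * n + 100 ∧
      GreedyCells n vtx par (greedy n par len (fun i => ra i * α + rb i) (n - 1)) σ' ∧
      σ'.ivar 12 = (greedy n par len (fun i => ra i * α + rb i) (n - 1)).count := by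
  have e0 : Exec W (.iset 6 (.const 0)) σ (σ.setI 6 0) 2 :=
    .iset σ 6 (.const 0) 0 (IExpr.eval_eq _ (by simp))
  have hE0 := hE.frame e0.frame (by decide)
  obtain ⟨σ₁, t₁, e1, b1, i1, -⟩ := exec_forUp (W := W) (i := 6) (l := 0)
    (c := .rstore 10 (.var 6) (.add (.mul (.arr 8 (.var 6)) (.var 1)) (.arr 9 (.var 6))))
    (fun j σ => ∀ u < j, σ.rarr 10 u = ra u * α + rb u) 20 0 n (σ₀ := σ.setI 6 0)
    (by decide) (by decide) (by simp) hE0.hn (by omega) (by omega) (by omega) (by simp)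
    (by
      intro j τ _ hj hτ hf hI
      have hEτ := hE0.frame hf (by decide)
      have hα' : τ.rvar 1 = α := (hf.r 1 (by decide)).trans (by simpa using hα)
      obtain ⟨σ', t, h1, h2, h3⟩ := Prog.wp_sound (W := W)
        (.rstore 10 (.var 6) (.add (.mul (.arr 8 (.var 6)) (.var 1)) (.arr 9 (.var 6)))) (σ := τ)
        (Q := fun σ' => ∀ u < j + 1, (σ'.setI 6 (j + 1)).rarr 10 u = ra u * α + rb u) (by
          simp only [Prog.wp, IExpr.Ok, RExpr.Ok, IExpr.val, RExpr.val, true_and, hτ, hEτ.hra,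
            hEτ.hrb, hα']
          intro u hu
          by_cases h : u = j
          · simp [h]
          · simpa [h] using hI u (by omega))
      exact ⟨σ', t, h1, h2.trans (by decide), h3⟩)
  have hE1 := hE0.frame e1.frame (by decide)
  have e2 : Exec W (.iset 11 (.const 0) ⨾ .iset 8 (.const 0)) σ₁ ((σ₁.setI 11 0).setI 8 0) 4 :=
    .seq _ _ _ _ _ _ _ (.iset σ₁ 11 (.const 0) 0 (IExpr.eval_eq _ (by simp)))
      (.iset (σ₁.setI 11 0) 8 (.const 0) 0 (IExpr.eval_eq _ (by simp)))
  have hE2 := hE1.frame e2.frame (by decide)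
  obtain ⟨σ₃, t₃, e3, b3, i3, -⟩ := exec_forUp (W := W) (i := 8) (l := 7) (c := greedyBody)
    (fun j σ => GreedyCells n vtx par (greedy n par len (fun i => ra i * α + rb i) j) σ) 100 0
    (n - 1) (σ₀ := (σ₁.setI 11 0).setI 8 0)
    (by decide) (by decide) (by simp) hE2.hm (by omega) (by omega) (by omega)
    ⟨by simpa [greedy] using i1, by simp [greedy], by simp [greedy]⟩
    (by
      intro j τ _ hj hτ hf hI
      have := greedy_cs_length_le (n := n) (par := par) (len := len)
        (R := fun i => ra i * α + rb i) j
      exact exec_greedyBody hs (hE2.frame hf (by decide)) hτ hj hI (by omega) (by omega))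
  have hl := greedy_cs_length_le (n := n) (par := par) (len := len)
    (R := fun i => ra i * α + rb i) (n - 1)
  obtain ⟨σ₄, t₄, e4, b4, i4, j4⟩ := Prog.wp_sound (W := W)
    (.ite (.rle (.const 0) (.arr 10 (.const 0))) (.iset 12 (.add (.var 11) (.const 1)))
      (.iset 12 (.var 11))) (σ := σ₃)
    (Q := fun σ' => GreedyCells n vtx par (greedy n par len (fun i => ra i * α + rb i) (n - 1)) σ' ∧
      σ'.ivar 12 = (greedy n par len (fun i => ra i * α + rb i) (n - 1)).count) (by
      simp only [Prog.wp, BExpr.Ok, BExpr.Holds, IExpr.Ok, RExpr.Ok, IExpr.val, RExpr.val,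
        i3.acc 0 hn, GState.count, i3.len]
      refine ⟨by simp, fun h => ⟨⟨trivial, by omega, by omega⟩, ⟨by simpa using i3.acc,
        by simpa using i3.len, by simpa using i3.cs⟩, ?_⟩, fun h => ⟨trivial, ⟨by simpa using i3.acc,
        by simpa using i3.len, by simpa using i3.cs⟩, ?_⟩⟩
      · rw [if_pos (by simpa using h)]; simp
      · rw [if_neg (by simpa using h)]; simp)
  refine ⟨σ₄, _, .seq _ _ _ _ _ _ _ e0 (.seq _ _ _ _ _ _ _ e1 (.seq _ _ _ _ _ _ _ e2
    (.seq _ _ _ _ _ _ _ e3 e4))), ?_, i4, j4⟩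
  have h4 : t₄ ≤ 20 := b4.trans (by decide)
  omega

end PCenter

/-! ### The symbolic run on the machine. -/

namespace PCenter

open RealRAM

variable {n p W : ℕ} {r : Fin n} {vtx : ℕ → Fin n} {par : ℕ → ℕ} {len ra rb : ℕ → ℝ}

/-! ### The symbolic run -/

/-- The entries in the cells `a, …, b - 1` of the tape. -/
def seg (v w : ℕ → ℝ) (a b : ℕ) : List (ℝ × ℝ) := (List.Ico a b).map fun i => (v i, w i)

section seg

variable {v w v' w' : ℕ → ℝ} {a b c : ℕ}

@[simp] theorem length_seg : (seg v w a b).length = b - a := by simp [seg]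

theorem seg_self : seg v w a a = [] := by simp [seg]

theorem seg_eq_nil (h : b ≤ a) : seg v w a b = [] := by simp [seg, List.Ico.eq_nil_of_le h]

theorem seg_succ (h : a ≤ b) : seg v w a (b + 1) = seg v w a b ++ [(v b, w b)] := by
  simp [seg, List.Ico.succ_top h]

theorem seg_cons (h : a < b) : seg v w a b = (v a, w a) :: seg v w (a + 1) b := by
  simp [seg, List.Ico.eq_cons h]

theorem seg_append (h : a ≤ b) (h' : b ≤ c) : seg v w a b ++ seg v w b c = seg v w a c := by
  rw [seg, seg, seg, ← List.map_append, List.Ico.append_consecutive h h']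

theorem seg_congr (h : ∀ i, a ≤ i → i < b → v i = v' i ∧ w i = w' i) :
    seg v w a b = seg v' w' a b := by
  refine List.map_congr_left fun i hi => ?_
  obtain ⟨h1, h2⟩ := List.Ico.mem.mp hi
  rw [(h i h1 h2).1, (h i h1 h2).2]

theorem seg_update_succ {x y : ℝ} (h : a ≤ b) :
    seg (Function.update v b x) (Function.update w b y) a (b + 1) = seg v w a b ++ [(x, y)] := by
  rw [seg_succ h, Function.update_self, Function.update_self]
  congr 1
  refine seg_congr fun i _ hi => ?_
  rw [Function.update_of_ne hi.ne, Function.update_of_ne hi.ne]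
  exact ⟨rfl, rfl⟩

end seg

/-- The cells that hold the state of the symbolic run. -/
structure PassCells (n : ℕ) (s : PState) (σ : Store) : Prop where
  A : ∀ u < n, σ.rarr 11 u = s.A u
  B : ∀ u < n, σ.rarr 12 u = s.B u
  blk : ∀ u < n, σ.iarr 7 u = s.blk u

/-- The list `l` is on the tape from the cell `m` on, in runs of length one; the cells before `m`
agree with `v` and `w`. -/
structure TapeCells (v w : ℕ → ℝ) (m : ℕ) (l : List (ℝ × ℝ)) (σ : Store) : Prop where
  cnt : σ.ivar 13 = l.length
  top : σ.ivar 14 = m + l.length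
  new : seg (σ.rarr 13) (σ.rarr 14) m (m + l.length) = l
  old : ∀ i < m, v i = σ.rarr 13 i ∧ w i = σ.rarr 14 i
  run : ∀ j, 0 < j → j ≤ l.length → σ.iarr 9 j + 1 = m + j ∧ σ.iarr 10 j = m + j

theorem TapeCells.congr {v w : ℕ → ℝ} {m : ℕ} {l : List (ℝ × ℝ)} {σ τ : Store}
    (h : TapeCells v w m l σ) (h13 : τ.ivar 13 = σ.ivar 13) (h14 : τ.ivar 14 = σ.ivar 14)
    (h1 : τ.rarr 13 = σ.rarr 13) (h2 : τ.rarr 14 = σ.rarr 14)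
    (h3 : τ.iarr 9 = σ.iarr 9) (h4 : τ.iarr 10 = σ.iarr 10) : TapeCells v w m l τ :=
  ⟨h13.trans h.cnt, h14.trans h.top, by rw [h1, h2]; exact h.new, by rw [h1, h2]; exact h.old,
    by rw [h3, h4]; exact h.run⟩

theorem TapeCells.push {v w : ℕ → ℝ} {m : ℕ} {l : List (ℝ × ℝ)} {σ τ : Store}
    (h : TapeCells v w m l σ) {x y : ℝ} (h13 : τ.ivar 13 = l.length + 1)
    (h14 : τ.ivar 14 = m + l.length + 1)
    (h1 : τ.rarr 13 = Function.update (σ.rarr 13) (m + l.length) x)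
    (h2 : τ.rarr 14 = Function.update (σ.rarr 14) (m + l.length) y)
    (h3 : τ.iarr 9 = Function.update (σ.iarr 9) (l.length + 1) (m + l.length))
    (h4 : τ.iarr 10 = Function.update (σ.iarr 10) (l.length + 1) (m + l.length + 1)) :
    TapeCells v w m (l ++ [(x, y)]) τ := by
  refine ⟨by simpa using h13, by simpa [add_assoc] using h14, ?_, fun i hi => ?_,
    fun j hj hj' => ?_⟩
  · rw [List.length_append, List.length_singleton, ← add_assoc, h1, h2,
      seg_update_succ (by omega), h.new]
  · rw [h1, h2, Function.update_of_ne (by omega), Function.update_of_ne (by omega)]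
    exact h.old i hi
  · simp only [List.length_append, List.length_singleton] at hj'
    rw [h3, h4]
    by_cases hl : j = l.length + 1
    · subst hl
      simp only [Function.update_self]
      omega
    · rw [Function.update_of_ne hl, Function.update_of_ne hl]
      exact h.run j hj (by omega)

/-- The expressions are evaluated again after the flag of the parent has been written; therefore
their values are prescribed in every memory with the same real variables. -/
theorem exec_crossTest {σ : Store} {a b : RExpr} {lo hi av bv wi : ℝ} {i q m : ℕ}
    {v w : ℕ → ℝ} {l : List (ℝ × ℝ)} (hlh : lo < hi) (hlo : σ.rvar 2 = lo) (hhi : σ.rvar 3 = hi)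
    (h9 : σ.ivar 9 = i) (h10 : σ.ivar 10 = q) (hwi : σ.rarr 7 i = wi)
    (ha : ∀ τ : Store, τ.rvar = σ.rvar → a.Ok W τ ∧ a.val τ = av)
    (hb : ∀ τ : Store, τ.rvar = σ.rvar → b.Ok W τ ∧ b.val τ = bv)
    (hT : TapeCells v w m l σ) (hW : m + l.length + 1 ≤ W) :
    ∃ σ' t, Exec W (crossTest a b) σ σ' t ∧ t ≤ (crossTest a b).cost ∧
      TapeCells v w m (l ++ if σ.iarr 8 i = 0 then entry lo hi wi av bv else []) σ' ∧
      (Crosses lo hi av bv → σ'.iarr 7 = Function.update (σ.iarr 7) q 1) ∧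
      (¬ Crosses lo hi av bv → σ'.iarr 7 = σ.iarr 7) := by
  have ha0 := ha σ rfl
  have hb0 := hb σ rfl
  refine Prog.wp_sound (W := W) (crossTest a b) ?_
  have ha1 : ∀ x j y, a.Ok W (σ.setIA x j y) ∧ a.val (σ.setIA x j y) = av := fun x j y => ha _ rfl
  have hb1 : ∀ x j y, b.Ok W (σ.setIA x j y) ∧ b.val (σ.setIA x j y) = bv := fun x j y => hb _ rfl
  simp only [crossTest, Prog.wp, IExpr.Ok, IExpr.val, RExpr.Ok, RExpr.val, BExpr.Ok, BExpr.Holds,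
    ha0, hb0, hlo, hhi, ha1, hb1, h10, true_and, and_true, not_le, not_lt, Rat.cast_zero]
  change (_ → _) ∧ (_ → _)
  refine ⟨fun hc => ⟨by omega, ?_, fun hz => ?_, fun hz => ?_⟩, fun hc => ?_⟩
  · simp
  · have hc' : Crosses lo hi av bv := hc
    -- A change of sign forces a nonzero slope, so the division is safe.
    have ha' : av ≠ 0 := ((crosses_iff hlh).mp hc').1
    simp [h9] at hz
    simp [h9, hT.cnt, hT.top, ha', hz, hwi]
    refine ⟨by omega, ⟨by omega, by omega⟩, ?_, fun h => absurd hc' h⟩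
    rw [entry, if_pos hc']
    exact hT.push (by simp) (by simp) (by simp) (by simp) (by simp) (by simp)
  · have hc' : Crosses lo hi av bv := hc
    simp [h9] at hz
    simp only [if_neg hz.ne', List.append_nil]
    exact ⟨hT.congr (by simp) (by simp) (by simp) (by simp) (by simp) (by simp),
      fun _ => by simp, fun h => absurd hc' h⟩
  · have hc' : ¬ Crosses lo hi av bv := not_lt.mpr hc
    simp only [entry, if_neg hc', ite_self, List.append_nil]
    exact ⟨hT, fun h => absurd h hc', fun _ => trivial⟩

open Classical in
theorem update_of_three {f₀ f₁ f₂ f₃ : ℕ → ℕ} {q : ℕ} {P₁ P₂ P₃ : Prop}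
    (x₁ : P₁ → f₁ = Function.update f₀ q 1) (y₁ : ¬ P₁ → f₁ = f₀)
    (x₂ : P₂ → f₂ = Function.update f₁ q 1) (y₂ : ¬ P₂ → f₂ = f₁)
    (x₃ : P₃ → f₃ = Function.update f₂ q 1) (y₃ : ¬ P₃ → f₃ = f₂) :
    f₃ = if P₁ ∨ P₂ ∨ P₃ then Function.update f₀ q 1 else f₀ := by
  by_cases h1 : P₁ <;> by_cases h2 : P₂ <;> by_cases h3 : P₃ <;> simp_all

-- The parent was unblocked before the three tests, so its flag now records exactly whether one of
-- them found a change of sign.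
open Classical in
theorem exec_passUpdate {s : PState} {σ σ₄ : Store} {lo hi : ℝ} {i : ℕ} (hr : s.Ready par i)
    (hpn : par i < n) (hP : PassCells n s σ) (i9' : σ₄.ivar 9 = i)
    (i10' : σ₄.ivar 10 = par i)
    (hblk : σ₄.iarr 7 = if s.Undecided lo hi par len i then
        Function.update (σ.iarr 7) (par i) 1 else σ.iarr 7)
    (r8 : σ₄.rvar 8 = s.A i) (r9 : σ₄.rvar 9 = s.B i - len i) (r10 : σ₄.rvar 10 = s.A (par i))
    (r11 : σ₄.rvar 11 = s.B (par i)) (mid1 : σ₄.rvar 4 = (lo + hi) / 2)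
    (A4 : σ₄.rarr 11 = σ.rarr 11) (B4 : σ₄.rarr 12 = σ.rarr 12) (hW : 1 ≤ W) :
    ∃ σ' t, Exec W passUpdate σ₄ σ' t ∧ t ≤ passUpdate.cost ∧
      PassCells n (pstep lo hi par len i s) σ' ∧
      (∀ v w m l, TapeCells v w m l σ₄ → TapeCells v w m l σ') ∧
      σ'.iarr 8 = if s.Ready par i then Function.update (σ₄.iarr 8) i 1 else σ₄.iarr 8 := by
  have hT : ∀ τ : Store, Frame passUpdate σ₄ τ →
      ∀ v w m l, TapeCells v w m l σ₄ → TapeCells v w m l τ := fun τ f v w m l T =>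
    T.congr (f.i 13 rfl) (f.i 14 rfl) (f.ra 13 rfl) (f.ra 14 rfl) (f.ia 9 rfl) (f.ia 10 rfl)
  obtain ⟨σ₅, t₅, e5, c5, P5, s5⟩ := Prog.wp_sound (W := W) (σ := σ₄) passUpdate
      (Q := fun τ => PassCells n (pstep lo hi par len i s) τ ∧
        τ.iarr 8 = if s.Ready par i then Function.update (σ₄.iarr 8) i 1 else σ₄.iarr 8) (by
    rw [if_pos hr]
    by_cases hu : s.Undecided lo hi par len i
    · rw [if_pos hu] at hblk
      simp only [passUpdate, closerTest, Prog.wp, BExpr.Ok, BExpr.Holds, RExpr.Ok, RExpr.val,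
        IExpr.Ok, IExpr.val, i9', i10', Store.setIA_iarr, Store.setIA_rvar, Store.setIA_ivar, hblk]
      refine ⟨trivial, hW, by simp, fun h => absurd h.1 (by simp), fun _ => ⟨?_, by simp⟩⟩
      rw [pstep, if_pos (.inr hu)]
      refine ⟨by simpa [A4] using hP.A, by simpa [B4] using hP.B, fun u hu => ?_⟩
      simp [hblk, Function.update_apply, hP.blk u hu]
    · rw [if_neg hu] at hblk
      have hz : σ.iarr 7 (par i) = 0 := (hP.blk _ hpn).trans hr.2
      have hst : pstep lo hi par len i s = if Closer (s.A i * ((lo + hi) / 2) + (s.B i - len i))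
          (s.A (par i) * ((lo + hi) / 2) + s.B (par i)) then
          { s with
            A := Function.update s.A (par i) (s.A i)
            B := Function.update s.B (par i) (s.B i - len i) } else s := by
        rw [pstep, if_neg (by simp [hr, hu])]
      rw [hst]
      simp only [passUpdate, closerTest, Prog.wp, BExpr.Ok, BExpr.Holds, RExpr.Ok, RExpr.val,
        IExpr.Ok, IExpr.val, i9', i10', Store.setIA_iarr, Store.setIA_rvar, Store.setIA_ivar, hblk,
        r8, r9, r10, r11, mid1, not_le, Rat.cast_zero]
      refine ⟨trivial, hW, by simp, fun h => ⟨trivial, trivial, trivial, trivial, ?_⟩,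
        fun h => ?_⟩
      · rw [if_pos (show Closer _ _ from h.2)]
        refine ⟨⟨fun u hu => ?_, fun u hu => ?_, fun u hu => ?_⟩, by simp⟩
        · simp [A4, Function.update_apply, hP.A u hu]
        · simp [B4, Function.update_apply, hP.B u hu, i10', r9]
        · simp [hblk, hP.blk u hu]
      · rw [if_neg (fun h' : Closer _ _ => h ⟨by simp [hz], h'⟩)]
        refine ⟨⟨fun u hu => ?_, fun u hu => ?_, fun u hu => ?_⟩, by simp⟩
        · simp [A4, hP.A u hu]
        · simp [B4, hP.B u hu]
        · simp [hblk, hP.blk u hu])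
  exact ⟨σ₅, t₅, e5, c5, P5, hT _ e5.frame, s5⟩

open Classical in
theorem exec_passBody {k : ℕ} {s : PState} {σ : Store} {lo hi : ℝ} {m : ℕ} {v w : ℕ → ℝ}
    {l : List (ℝ × ℝ)} (hs : Shape n par len) (hlh : lo < hi)
    (hE : Env n p r vtx par len ra rb σ) (hlo : σ.rvar 2 = lo) (hhi : σ.rvar 3 = hi)
    (hmid : σ.rvar 4 = (lo + hi) / 2) (hk : σ.ivar 8 = k) (hk' : k < n - 1)
    (hP : PassCells n s σ) (hT : TapeCells v w m l σ) (hW : m + l.length + 3 ≤ W) :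
    ∃ σ' t, Exec W passBody σ σ' t ∧ t ≤ 400 ∧
      PassCells n (pstep lo hi par len (n - 1 - k) s) σ' ∧
      TapeCells v w m (l ++ if s.Ready par (n - 1 - k) ∧ σ.iarr 8 (n - 1 - k) = 0 then
        entries lo hi (wt par (n - 1 - k)) (s.A (n - 1 - k)) (s.B (n - 1 - k) - len (n - 1 - k))
          (s.A (par (n - 1 - k))) (s.B (par (n - 1 - k))) else []) σ' ∧
      σ'.iarr 8 = (if s.Ready par (n - 1 - k) then Function.update (σ.iarr 8) (n - 1 - k) 1
        else σ.iarr 8) := by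
  have hp := hs.par_lt (n - 1 - k) (by omega) (by omega)
  have hwt := hE.hwt (n - 1 - k) (by omega) (by omega)
  obtain ⟨i, hi_def⟩ : ∃ i, i = n - 1 - k := ⟨_, rfl⟩
  rw [← hi_def] at hp hwt ⊢
  have hin : i < n := by omega
  have e0 : Exec W (.iset 9 (.sub (.var 7) (.var 8)) ⨾ .iset 10 (.arr 6 (.var 9))) σ
      ((σ.setI 9 i).setI 10 (par i)) (4 + 3) := by
    refine .seq _ _ _ _ _ _ _ (.iset σ 9 _ i ?_) (.iset (σ.setI 9 i) 10 _ (par i) ?_)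
    · rw [IExpr.eval_eq _ (by simp)]; simp [hE.hm, hk, hi_def]
    · rw [IExpr.eval_eq _ (by simp)]; simp [hE.hpar]
  set σ₀ := (σ.setI 9 i).setI 10 (par i) with hσ₀
  have b1 : σ₀.iarr 7 i = s.blk i := by simpa [hσ₀] using hP.blk i hin
  have b2 : σ₀.iarr 7 (par i) = s.blk (par i) := by simpa [hσ₀] using hP.blk (par i) (by omega)
  by_cases hr : s.Ready par i
  · have hr1 := hr.1
    have hr2 := hr.2
    -- the four coefficients
    obtain ⟨σ₁, t₁, e1, c1, r8, r9, r10, r11⟩ := Prog.wp_sound (W := W) (σ := σ₀)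
      (.rset 8 (.arr 11 (.var 9)) ⨾ .rset 9 (.sub (.arr 12 (.var 9)) (.arr 3 (.var 9))) ⨾
        .rset 10 (.arr 11 (.var 10)) ⨾ .rset 11 (.arr 12 (.var 10)))
      (Q := fun τ => τ.rvar 8 = s.A i ∧ τ.rvar 9 = s.B i - len i ∧ τ.rvar 10 = s.A (par i) ∧
        τ.rvar 11 = s.B (par i)) (by
          simp [hσ₀, hP.A i hin, hP.B i hin, hP.A (par i) (by omega), hP.B (par i) (by omega),
            hE.hlen])
    have f1 := e1.frame
    have i9 : σ₁.ivar 9 = i := (f1.i 9 (by decide)).trans (by simp [hσ₀])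
    have i10 : σ₁.ivar 10 = par i := (f1.i 10 (by decide)).trans (by simp [hσ₀])
    have s8 : σ₁.iarr 8 = σ.iarr 8 := (f1.ia 8 (by decide)).trans (by simp [hσ₀])
    have s7 : σ₁.iarr 7 = σ.iarr 7 := (f1.ia 7 (by decide)).trans (by simp [hσ₀])
    have lo1 : σ₁.rvar 2 = lo := (f1.r 2 (by decide)).trans (by simpa [hσ₀] using hlo)
    have hi1 : σ₁.rvar 3 = hi := (f1.r 3 (by decide)).trans (by simpa [hσ₀] using hhi)
    have mid1 : σ₁.rvar 4 = (lo + hi) / 2 := (f1.r 4 (by decide)).trans (by simpa [hσ₀] using hmid)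
    have w1 : σ₁.rarr 7 i = wt par i := by rw [f1.ra 7 (by decide)]; simpa [hσ₀] using hwt
    have T1 : TapeCells v w m l σ₁ := hT.congr ((f1.i 13 (by decide)).trans (by simp [hσ₀]))
      ((f1.i 14 (by decide)).trans (by simp [hσ₀])) (f1.ra 13 (by decide)) (f1.ra 14 (by decide))
      (f1.ia 9 (by decide)) (f1.ia 10 (by decide))
    have A1 : σ₁.rarr 11 = σ.rarr 11 := f1.ra 11 (by decide)
    have B1 : σ₁.rarr 12 = σ.rarr 12 := f1.ra 12 (by decide)
    -- the first comparison
    obtain ⟨σ₂, t₂, e2, c2, T2, x2, y2⟩ := exec_crossTest (W := W) (a := .var 8) (b := .var 9) hlh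
      lo1 hi1 i9 i10 w1 (av := s.A i) (bv := s.B i - len i)
      (fun τ hτ => by simp [hτ, r8]) (fun τ hτ => by simp [hτ, r9]) T1 (by omega)
    have v2 : σ₂.rvar = σ₁.rvar := funext fun x => e2.frame.r x rfl
    rw [s8] at T2
    have l2 := entry_length_le lo hi (wt par i) (s.A i) (s.B i - len i)
    have l2' : (l ++ if σ.iarr 8 i = 0 then entry lo hi (wt par i) (s.A i) (s.B i - len i)
        else []).length ≤ l.length + 1 := by
      split_ifs <;> simp <;> omega
    -- the second comparison
    obtain ⟨σ₃, t₃, e3, c3, T3, x3, y3⟩ := exec_crossTest (W := W) (a := .sub (.var 8) (.var 10))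
      (b := .sub (.var 9) (.var 11)) (σ := σ₂) hlh (by rw [v2, lo1]) (by rw [v2, hi1])
      ((e2.frame.i 9 rfl).trans i9) ((e2.frame.i 10 rfl).trans i10)
      ((congrFun (e2.frame.ra 7 rfl) i).trans w1) (av := s.A i - s.A (par i))
      (bv := s.B i - len i - s.B (par i)) (fun τ hτ => by simp [hτ, v2, r8, r10])
      (fun τ hτ => by simp [hτ, v2, r9, r11]) T2 (by omega)
    have v3 : σ₃.rvar = σ₁.rvar := (funext fun x => e3.frame.r x rfl).trans v2
    have f2 := e2.frame.ia 8 rfl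
    rw [f2, s8] at T3
    have l3 := entry_length_le lo hi (wt par i) (s.A i - s.A (par i))
      (s.B i - len i - s.B (par i))
    have l3' : ((l ++ if σ.iarr 8 i = 0 then entry lo hi (wt par i) (s.A i) (s.B i - len i)
        else []) ++ if σ.iarr 8 i = 0 then entry lo hi (wt par i) (s.A i - s.A (par i))
          (s.B i - len i - s.B (par i)) else []).length ≤ l.length + 2 := by
      rw [List.length_append]
      split_ifs at l2' ⊢ <;> simp at l2' ⊢ <;> omega
    -- the third comparison
    obtain ⟨σ₄, t₄, e4, c4, T4, x4, y4⟩ := exec_crossTest (W := W) (a := .add (.var 8) (.var 10))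
      (b := .add (.var 9) (.var 11)) (σ := σ₃) hlh (by rw [v3, lo1]) (by rw [v3, hi1])
      ((e3.frame.i 9 rfl).trans ((e2.frame.i 9 rfl).trans i9))
      ((e3.frame.i 10 rfl).trans ((e2.frame.i 10 rfl).trans i10))
      ((congrFun (e3.frame.ra 7 rfl) i).trans ((congrFun (e2.frame.ra 7 rfl) i).trans w1))
      (av := s.A i + s.A (par i))
      (bv := s.B i - len i + s.B (par i)) (fun τ hτ => by simp [hτ, v3, r8, r10])
      (fun τ hτ => by simp [hτ, v3, r9, r11]) T3 (by omega)
    have v4 : σ₄.rvar = σ₁.rvar := (funext fun x => e4.frame.r x rfl).trans v3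
    have f3 := e3.frame.ia 8 rfl
    rw [f3, f2, s8] at T4
    have i9' : σ₄.ivar 9 = i := (e4.frame.i 9 rfl).trans ((e3.frame.i 9 rfl).trans
      ((e2.frame.i 9 rfl).trans i9))
    have i10' : σ₄.ivar 10 = par i := (e4.frame.i 10 rfl).trans ((e3.frame.i 10 rfl).trans
      ((e2.frame.i 10 rfl).trans i10))
    have s8' : σ₄.iarr 8 = σ.iarr 8 := (e4.frame.ia 8 rfl).trans (f3.trans (f2.trans s8))
    have A4 : σ₄.rarr 11 = σ.rarr 11 := (e4.frame.ra 11 rfl).trans ((e3.frame.ra 11 rfl).trans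
      ((e2.frame.ra 11 rfl).trans A1))
    have B4 : σ₄.rarr 12 = σ.rarr 12 := (e4.frame.ra 12 rfl).trans ((e3.frame.ra 12 rfl).trans
      ((e2.frame.ra 12 rfl).trans B1))
    have hblk : σ₄.iarr 7 = if s.Undecided lo hi par len i then
        Function.update (σ.iarr 7) (par i) 1 else σ.iarr 7 := by
      rw [← s7]
      convert update_of_three x2 y2 x3 y3 x4 y4
      exact Iff.rfl
    have hnew : ((l ++ if σ.iarr 8 i = 0 then entry lo hi (wt par i) (s.A i) (s.B i - len i)
        else []) ++ if σ.iarr 8 i = 0 then entry lo hi (wt par i) (s.A i - s.A (par i))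
          (s.B i - len i - s.B (par i)) else []) ++ (if σ.iarr 8 i = 0 then
        entry lo hi (wt par i) (s.A i + s.A (par i)) (s.B i - len i + s.B (par i)) else []) =
        l ++ if s.Ready par i ∧ σ.iarr 8 i = 0 then entries lo hi (wt par i) (s.A i)
          (s.B i - len i) (s.A (par i)) (s.B (par i)) else [] := by
      by_cases h8 : σ.iarr 8 i = 0 <;> simp [hr, h8, entries]
    rw [hnew] at T4
    obtain ⟨σ₅, t₅, e5, c5, P5, T5, s5⟩ := exec_passUpdate hr (by omega) hP i9' i10' hblk
      (by rw [v4, r8]) (by rw [v4, r9]) (by rw [v4, r10]) (by rw [v4, r11]) (by rw [v4, mid1]) A4 B4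
      (W := W) (by omega)
    rw [s8'] at s5
    have T5 := T5 _ _ _ _ T4
    refine ⟨σ₅, _, .seq _ _ _ _ _ _ _ e0 (.ite_false _ _ _ _ _ _ (BExpr.eval_false (by simp) ?_)
      (.seq _ _ _ _ _ _ _ e1 (.seq _ _ _ _ _ _ _ e2 (.seq _ _ _ _ _ _ _ e3
        (.seq _ _ _ _ _ _ _ e4 e5))))), ?_, P5, T5, s5⟩
    · have := b1.trans hr1
      have := b2.trans hr2
      simp_all
    · have d1 : t₁ ≤ 40 := c1.trans (by decide)
      have d2 : t₂ ≤ 65 := c2.trans (by decide)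
      have d3 : t₃ ≤ 75 := c3.trans (by decide)
      have d4 : t₄ ≤ 75 := c4.trans (by decide)
      have d5 : t₅ ≤ 100 := c5.trans (by decide)
      simp only [BExpr.ops, IExpr.ops]
      omega
  · have hnr : ¬ (s.blk i = 0 ∧ s.blk (par i) = 0) := hr
    refine ⟨_, _, .seq _ _ _ _ _ _ _ e0 (.ite_true _ _ _ _ _ _ (BExpr.eval_true (by simp) ?_)
      (.istore σ₀ 7 (.var 10) (.const 1) (par i) 1
        (by rw [IExpr.eval_eq _ (by simp)]; simp [hσ₀])
        (IExpr.eval_eq _ (by simp; omega)))), ?_, ?_, ?_, ?_⟩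
    · have h1 : σ₀.iarr 7 (σ₀.ivar 9) = s.blk i := by simpa [hσ₀] using b1
      have h2 : σ₀.iarr 7 (σ₀.ivar 10) = s.blk (par i) := by simpa [hσ₀] using b2
      simp only [BExpr.Holds, IExpr.val, h1, h2]
      omega
    · simp [BExpr.ops, IExpr.ops]
    · change PassCells n _ (σ₀.setIA 7 (par i) 1)
      rw [pstep, if_pos (.inl hr)]
      refine ⟨by simpa [hσ₀] using hP.A, by simpa [hσ₀] using hP.B, fun u hu => ?_⟩
      simp [hσ₀, Function.update_apply, hP.blk u hu]
    · change TapeCells v w m _ (σ₀.setIA 7 (par i) 1)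
      rw [if_neg (fun h => hr h.1), List.append_nil]
      exact hT.congr (by simp [hσ₀]) (by simp [hσ₀]) (by simp [hσ₀]) (by simp [hσ₀])
        (by simp [hσ₀]) (by simp [hσ₀])
    · change (σ₀.setIA 7 (par i) 1).iarr 8 = _
      rw [if_neg hr]
      simp [hσ₀]

theorem length_newAll_le {lo hi : ℝ} {seen : ℕ → ℕ} (k : ℕ) :
    (newAll n par len ra rb lo hi seen k).length ≤ 3 * k := by
  induction k with
  | zero => simp [newAll]
  | succ k ih =>
    rw [newAll, List.length_append]
    have : (newOf n par len ra rb lo hi seen (n - 1 - k)).length ≤ 3 := by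
      unfold newOf
      dsimp only
      split_ifs
      · exact entries_length_le _ _ _ _ _ _ _
      · simp
    omega

theorem exec_passProg {σ : Store} {lo hi : ℝ} {m : ℕ} (hs : Shape n par len) (hn : 0 < n)
    (hlh : lo < hi) (hE : Env n p r vtx par len ra rb σ) (hlo : σ.rvar 2 = lo) (hhi : σ.rvar 3 = hi)
    (hm : σ.ivar 14 = m) (hW : m + 3 * n + 3 ≤ W) :
    ∃ σ' t, Exec W passProg σ σ' t ∧ t ≤ 500 * n + 100 ∧
      TapeCells (σ.rarr 13) (σ.rarr 14) m (newAll n par len ra rb lo hi (σ.iarr 8) (n - 1)) σ' ∧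
      ∀ i, 0 < i → i < n →
        (σ'.iarr 8 i = 0 ↔ σ.iarr 8 i = 0 ∧ Waiting n par len ra rb lo hi i) := by
  have e0 : Exec W (.rset 4 (.div (.add (.var 2) (.var 3)) (.const 2)) ⨾ .iset 6 (.const 0)) σ
      ((σ.setR 4 ((lo + hi) / 2)).setI 6 0) (6 + 2) :=
    .seq _ _ _ _ _ _ _ (.rset σ 4 _ _ (by rw [RExpr.eval_eq _ (by simp)]; simp [hlo, hhi]))
      (.iset (σ.setR 4 ((lo + hi) / 2)) 6 (.const 0) 0 (IExpr.eval_eq _ (by simp)))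
  set σ₀ := (σ.setR 4 ((lo + hi) / 2)).setI 6 0 with hσ₀
  have hE0 := hE.frame e0.frame (by decide)
  obtain ⟨σ₁, t₁, e1, b1, i1, -⟩ := exec_forUp (W := W) (i := 6) (l := 0)
    (c := .rstore 11 (.var 6) (.arr 8 (.var 6)) ⨾ .rstore 12 (.var 6) (.arr 9 (.var 6)) ⨾
      .istore 7 (.var 6) (.const 0))
    (fun j σ => ∀ u < j, σ.rarr 11 u = ra u ∧ σ.rarr 12 u = rb u ∧ σ.iarr 7 u = 0) 20 0 n
    (σ₀ := σ₀) (by decide) (by decide) (by simp [hσ₀]) hE0.hn (by omega) (by omega) (by omega)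
    (by simp)
    (by
      intro j τ _ hj hτ hf hI
      have hEτ := hE0.frame hf (by decide)
      obtain ⟨σ', t, h1, h2, h3⟩ := Prog.wp_sound (W := W)
        (.rstore 11 (.var 6) (.arr 8 (.var 6)) ⨾ .rstore 12 (.var 6) (.arr 9 (.var 6)) ⨾
          .istore 7 (.var 6) (.const 0)) (σ := τ)
        (Q := fun σ' => ∀ u < j + 1, (σ'.setI 6 (j + 1)).rarr 11 u = ra u ∧
          (σ'.setI 6 (j + 1)).rarr 12 u = rb u ∧ (σ'.setI 6 (j + 1)).iarr 7 u = 0) (by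
          simp only [Prog.wp, IExpr.Ok, RExpr.Ok, IExpr.val, RExpr.val, true_and, hτ, hEτ.hra,
            hEτ.hrb, Store.setRA_ivar, Store.setRA_rarr]
          refine ⟨by omega, fun u hu => ?_⟩
          by_cases h : u = j
          · simp [h]
          · simpa [h] using hI u (by omega))
      exact ⟨σ', t, h1, h2.trans (by decide), h3⟩)
  have hE1 := hE0.frame e1.frame (by decide)
  have e2 : Exec W (.iset 13 (.const 0) ⨾ .iset 8 (.const 0)) σ₁ ((σ₁.setI 13 0).setI 8 0) 4 :=
    .seq _ _ _ _ _ _ _ (.iset σ₁ 13 (.const 0) 0 (IExpr.eval_eq _ (by simp)))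
      (.iset (σ₁.setI 13 0) 8 (.const 0) 0 (IExpr.eval_eq _ (by simp)))
  have hE2 := hE1.frame e2.frame (by decide)
  have f1 := e1.frame
  obtain ⟨σ₃, t₃, e3, b3, i3, -⟩ := exec_forUp (W := W) (i := 8) (l := 7) (c := passBody)
    (fun j τ => PassCells n (pass n par len ra rb lo hi j) τ ∧
      TapeCells (σ.rarr 13) (σ.rarr 14) m (newAll n par len ra rb lo hi (σ.iarr 8) j) τ ∧
      -- Steps not yet reached keep the mark of the previous round, which decides whether their
      -- entries are new.
      (∀ i, i + j < n → τ.iarr 8 i = σ.iarr 8 i) ∧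
      ∀ i, n ≤ i + j → i < n →
        (τ.iarr 8 i = 0 ↔ σ.iarr 8 i = 0 ∧ Waiting n par len ra rb lo hi i)) 400 0 (n - 1)
    (σ₀ := (σ₁.setI 13 0).setI 8 0)
    (by decide) (by decide) (by simp) hE2.hm (by omega) (by omega) (by omega)
    ⟨⟨fun u hu => by simpa [pass] using (i1 u hu).1, fun u hu => by simpa [pass] using (i1 u hu).2.1,
        fun u hu => by simpa [pass] using (i1 u hu).2.2⟩,
      ⟨by simp [newAll], by simpa [newAll, hσ₀, hm] using f1.i 14 rfl, by simp [newAll, seg_self],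
        fun i _ => by
          have h1 := f1.ra 13 rfl
          have h2 := f1.ra 14 rfl
          simp [h1, h2, hσ₀], by simp [newAll]; omega⟩,
      fun i _ => by
        have h1 := f1.ia 8 rfl
        simp [h1, hσ₀], fun i hi hin => by omega⟩
    (by
      intro j τ _ hj hτ hf ⟨hP, hT, hu, hd⟩
      have hEτ := hE2.frame hf (by decide)
      have hl := length_newAll_le (n := n) (par := par) (len := len) (ra := ra) (rb := rb)
        (lo := lo) (hi := hi) (seen := σ.iarr 8) j
      obtain ⟨σ', t, h1, h2, h3, h4, h5⟩ := exec_passBody (W := W) hs hlh hEτ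
        ((hf.r 2 rfl).trans (by simpa [hσ₀, hlo] using f1.r 2 rfl))
        ((hf.r 3 rfl).trans (by simpa [hσ₀, hhi] using f1.r 3 rfl))
        ((hf.r 4 rfl).trans (by simpa [hσ₀] using f1.r 4 rfl)) hτ hj hP hT (by omega)
      have hjj : n - 1 - (n - 1 - j) = j := by omega
      have hself := hu (n - 1 - j) (by omega)
      refine ⟨σ', t, h1, h2, ⟨by simpa [pass] using h3.A, by simpa [pass] using h3.B,
        by simpa [pass] using h3.blk⟩, ?_, ?_, ?_⟩
      · refine TapeCells.congr ?_ (τ := σ'.setI 8 (j + 1)) (σ := σ') (by simp) (by simp) (by simp)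
          (by simp) (by simp) (by simp)
        rw [hself] at h4
        rw [newAll, newOf, hjj]
        convert h4
      · intro i hi
        rw [Store.setI_iarr, h5, ← hu i (by omega)]
        split_ifs
        · rw [Function.update_of_ne (by omega)]
        · rfl
      · intro i hi hin
        rw [Store.setI_iarr, h5]
        by_cases hij : i = n - 1 - j
        · subst hij
          unfold Waiting
          rw [hjj, ← hself]
          split_ifs with hr
          · simp [hr]
          · simp [hr]
        · rw [← hd i (by omega) hin]
          split_ifs
          · rw [Function.update_of_ne hij]
          · rfl)
  obtain ⟨-, hT, -, hd⟩ := i3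
  refine ⟨σ₃, _, .seq _ _ _ _ _ _ _ e0 (.seq _ _ _ _ _ _ _ e1 (.seq _ _ _ _ _ _ _ e2 e3)), ?_, hT,
    fun i hi0 hin => hd i (by omega) hin⟩
  omega

end PCenter

/-! ### Sorting by merging a queue of runs. -/

namespace PCenter

open RealRAM

/-! ### Sorting -/

/-- The order of the entries. -/
noncomputable def entryLe (x y : ℝ × ℝ) : Bool := decide (x.1 ≤ y.1)

/-- A sorted list of entries. -/
def Ordered (l : List (ℝ × ℝ)) : Prop := l.Pairwise fun x y => x.1 ≤ y.1

theorem Ordered.merge {l l' : List (ℝ × ℝ)} (h : Ordered l) (h' : Ordered l') :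
    Ordered (l.merge l' entryLe) := by
  have := List.pairwise_merge (le := entryLe)
    (fun a b c hab hbc => by
      simp only [entryLe, decide_eq_true_eq] at *
      exact hab.trans hbc)
    (fun a b => by
      simp only [entryLe, Bool.or_eq_true, decide_eq_true_eq]
      exact le_total _ _) l l' (h.imp fun h => by simpa [entryLe] using h)
    (h'.imp fun h => by simpa [entryLe] using h)
  exact this.imp fun h => by simpa [entryLe] using h

/-- The invariant of the merge of the runs from `a` to `a'` and from `b` to `b'`: the smallest
entries have been moved to the end of the tape. -/
structure MergeCells (v w : ℕ → ℝ) (a a' b b' m x y : ℕ) (σ : Store) : Prop where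
  left : σ.ivar 18 = x
  left_end : σ.ivar 19 = a'
  right : σ.ivar 20 = y
  right_end : σ.ivar 21 = b'
  hx : a ≤ x ∧ x ≤ a'
  hy : b ≤ y ∧ y ≤ b'
  top : σ.ivar 14 = m + (x - a) + (y - b)
  old : ∀ i < m, v i = σ.rarr 13 i ∧ w i = σ.rarr 14 i
  out : seg (σ.rarr 13) (σ.rarr 14) m (m + (x - a) + (y - b)) ++
    (seg v w x a').merge (seg v w y b') entryLe = (seg v w a a').merge (seg v w b b') entryLe

theorem exec_mergeStep {W : ℕ} {v w : ℕ → ℝ} {a a' b b' m x y : ℕ} {σ : Store}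
    (h : MergeCells v w a a' b b' m x y σ) (ha : a' ≤ m) (hb : b' ≤ m)
    (hW : m + (a' - a) + (b' - b) ≤ W) (hne : x < a' ∨ y < b') :
    ∃ σ' t, Exec W mergeStep σ σ' t ∧ t ≤ 50 ∧
      ((x < a' ∧ MergeCells v w a a' b b' m (x + 1) y σ') ∨
        (y < b' ∧ MergeCells v w a a' b b' m x (y + 1) σ')) := by
  obtain ⟨h1, h2⟩ := h.hx
  obtain ⟨h3, h4⟩ := h.hy
  have ox : x < a' → v x = σ.rarr 13 x ∧ w x = σ.rarr 14 x := fun hx => h.old x (by omega)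
  have oy : y < b' → v y = σ.rarr 13 y ∧ w y = σ.rarr 14 y := fun hy => h.old y (by omega)
  obtain ⟨σ', t, e, c, q⟩ := Prog.wp_sound (W := W) (σ := σ) mergeStep (Q := fun σ' =>
      ((x < a' ∧ MergeCells v w a a' b b' m (x + 1) y σ') ∨
        (y < b' ∧ MergeCells v w a a' b b' m x (y + 1) σ'))) (by
    simp only [mergeStep, Prog.wp, BExpr.Ok, BExpr.Holds, IExpr.Ok, IExpr.val, RExpr.Ok, RExpr.val,
      h.left, h.right, h.left_end, h.right_end, h.top]
    refine ⟨by simp, fun hc => ?_, fun hc => ?_⟩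
    · have hx : x < a' := by omega
      refine ⟨trivial, trivial, trivial, trivial, ⟨trivial, by omega, by simp [h.left]; omega⟩,
        ⟨trivial, by omega, by simp [h.top]; omega⟩, .inl ⟨hx, ?_⟩⟩
      refine ⟨by simp [h.left], by simp [h.left_end], by simp [h.right], by simp [h.right_end],
        by omega, by omega, by simp [h.top]; omega, fun i hi => ?_, ?_⟩
      · have := h.old i hi
        simp [h.top, Function.update_of_ne (show i ≠ m + (x - a) + (y - b) by omega), this]
      · have e1 : m + (x + 1 - a) + (y - b) = m + (x - a) + (y - b) + 1 := by omega
        rw [e1]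
        simp only [Store.setI_rarr, Store.setRA_rarr, if_true, h.top, h.left, Store.setRA_ivar,
          Nat.reduceEqDiff, if_false]
        rw [seg_update_succ (by omega), ← h.out, List.append_assoc, seg_cons hx, ← (ox hx).1,
          ← (ox hx).2]
        congr 1
        rcases Nat.lt_or_ge y b' with hy | hy
        · rw [seg_cons hy, List.cons_merge_cons_pos]
          · rfl
          · have : σ.rarr 13 x ≤ σ.rarr 13 y := by
              rcases hc with hc | hc
              · omega
              · exact hc.2
            simpa [entryLe, (ox hx).1, (oy hy).1] using this
        · rw [seg_eq_nil hy]
          simp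
    · have hy : y < b' := by omega
      refine ⟨trivial, trivial, trivial, trivial, ⟨trivial, by omega, by simp [h.right]; omega⟩,
        ⟨trivial, by omega, by simp [h.top]; omega⟩, .inr ⟨hy, ?_⟩⟩
      refine ⟨by simp [h.left], by simp [h.left_end], by simp [h.right], by simp [h.right_end],
        by omega, by omega, by simp [h.top]; omega, fun i hi => ?_, ?_⟩
      · have := h.old i hi
        simp [h.top, Function.update_of_ne (show i ≠ m + (x - a) + (y - b) by omega), this]
      · have e1 : m + (x - a) + (y + 1 - b) = m + (x - a) + (y - b) + 1 := by omega
        rw [e1]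
        simp only [Store.setI_rarr, Store.setRA_rarr, if_true, h.top, h.right, Store.setRA_ivar,
          Nat.reduceEqDiff, if_false]
        rw [seg_update_succ (by omega), ← h.out, List.append_assoc, seg_cons hy, ← (oy hy).1,
          ← (oy hy).2]
        congr 1
        rcases Nat.lt_or_ge x a' with hx | hx
        · rw [seg_cons hx, List.cons_merge_cons_neg]
          · rfl
          · have : σ.rarr 13 y < σ.rarr 13 x := by
              by_contra hlt
              exact hc (.inr ⟨by omega, not_lt.mp hlt⟩)
            simpa [entryLe, (ox hx).1, (oy hy).1] using this
        · rw [seg_eq_nil hx]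
          simp)
  exact ⟨σ', t, e, c.trans (by decide), q⟩

theorem exec_mergeLoop {W : ℕ} {a a' b b' m : ℕ} {σ : Store} (h18 : σ.ivar 18 = a)
    (h19 : σ.ivar 19 = a') (h20 : σ.ivar 20 = b) (h21 : σ.ivar 21 = b') (h14 : σ.ivar 14 = m)
    (ha : a ≤ a') (hb : b ≤ b') (ham : a' ≤ m) (hbm : b' ≤ m)
    (hW : m + (a' - a) + (b' - b) ≤ W) :
    ∃ σ' t, Exec W mergeLoop σ σ' t ∧ t ≤ 60 * ((a' - a) + (b' - b)) + 10 ∧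
      σ'.ivar 14 = m + (a' - a) + (b' - b) ∧
      seg (σ'.rarr 13) (σ'.rarr 14) m (m + (a' - a) + (b' - b)) =
        (seg (σ.rarr 13) (σ.rarr 14) a a').merge (seg (σ.rarr 13) (σ.rarr 14) b b') entryLe ∧
      ∀ i < m, σ.rarr 13 i = σ'.rarr 13 i ∧ σ.rarr 14 i = σ'.rarr 14 i := by
  obtain ⟨σ', t, k, e, ⟨x, y, hM, hk⟩, ht, hn⟩ := exec_loop (W := W)
    (b := .or (.not (.ile (.var 19) (.var 18))) (.not (.ile (.var 21) (.var 20)))) (c := mergeStep)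
    (fun k τ => ∃ x y, MergeCells (σ.rarr 13) (σ.rarr 14) a a' b b' m x y τ ∧
      k = 60 * ((a' - x) + (b' - y))) σ (60 * ((a' - a) + (b' - b)))
    ⟨a, b, ⟨h18, h19, h20, h21, ⟨le_rfl, ha⟩, ⟨le_rfl, hb⟩, by simp [h14], by simp,
      by simp [seg_self]⟩, rfl⟩ (by simp)
    (by
      rintro k τ - ⟨x, y, hM, rfl⟩ hh
      have hne : x < a' ∨ y < b' := by
        simpa [hM.left, hM.right, hM.left_end, hM.right_end] using hh
      obtain ⟨τ', t, e, ht, hM' | hM'⟩ := exec_mergeStep hM ham hbm hW hne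
      · refine ⟨τ', t, _, e, ⟨x + 1, y, hM'.2, rfl⟩, ?_⟩
        simp only [BExpr.ops, IExpr.ops]
        omega
      · refine ⟨τ', t, _, e, ⟨x, y + 1, hM'.2, rfl⟩, ?_⟩
        simp only [BExpr.ops, IExpr.ops]
        omega)
  have hx := hM.hx
  have hy := hM.hy
  have hxy : x = a' ∧ y = b' := by
    simp [hM.left, hM.right, hM.left_end, hM.right_end] at hn
    omega
  obtain ⟨rfl, rfl⟩ := hxy
  refine ⟨σ', t, e, ?_, hM.top, ?_, hM.old⟩
  · simp only [BExpr.ops, IExpr.ops] at ht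
    omega
  · have := hM.out
    simpa [seg_self] using this

theorem exec_mergeBody {W : ℕ} {a a' b b' m k j : ℕ} {σ : Store} (h13 : σ.ivar 13 = k)
    (h17 : σ.ivar 17 = j) (h14 : σ.ivar 14 = m) (ha : σ.iarr 9 (2 * j + 1) = a)
    (ha' : σ.iarr 10 (2 * j + 1) = a') (hb : σ.iarr 9 (2 * j + 2) = b)
    (hb' : σ.iarr 10 (2 * j + 2) = b') (haa : a ≤ a') (hbb : b ≤ b') (ham : a' ≤ m) (hbm : b' ≤ m)
    (hW : m + (a' - a) + (b' - b) ≤ W) (hkW : 2 * j + 2 ≤ W) (hkW' : k + j + 1 ≤ W) :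
    ∃ σ' t, Exec W mergeBody σ σ' t ∧ t ≤ 60 * ((a' - a) + (b' - b)) + 80 ∧
      σ'.ivar 14 = m + (a' - a) + (b' - b) ∧
      seg (σ'.rarr 13) (σ'.rarr 14) m (m + (a' - a) + (b' - b)) =
        (seg (σ.rarr 13) (σ.rarr 14) a a').merge (seg (σ.rarr 13) (σ.rarr 14) b b') entryLe ∧
      (∀ i < m, σ.rarr 13 i = σ'.rarr 13 i ∧ σ.rarr 14 i = σ'.rarr 14 i) ∧
      σ'.iarr 9 = Function.update (σ.iarr 9) (k + j + 1) m ∧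
      σ'.iarr 10 = Function.update (σ.iarr 10) (k + j + 1) (m + (a' - a) + (b' - b)) := by
  rw [two_mul] at ha ha' hb hb'
  obtain ⟨σ₁, t₁, e1, c1, q1, q2, q3, q4, q5⟩ := Prog.wp_sound (W := W) (σ := σ)
    (.iset 18 (.arr 9 (.add (.add (.var 17) (.var 17)) (.const 1))) ⨾
      .iset 19 (.arr 10 (.add (.add (.var 17) (.var 17)) (.const 1))) ⨾
      .iset 20 (.arr 9 (.add (.add (.var 17) (.var 17)) (.const 2))) ⨾
      .iset 21 (.arr 10 (.add (.add (.var 17) (.var 17)) (.const 2))) ⨾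
      .istore 9 (.add (.add (.var 13) (.var 17)) (.const 1)) (.var 14))
    (Q := fun τ => τ.ivar 18 = a ∧ τ.ivar 19 = a' ∧ τ.ivar 20 = b ∧ τ.ivar 21 = b' ∧
      τ.iarr 9 = Function.update (σ.iarr 9) (k + j + 1) m) (by
      simp [h13, h17, h14, ha, ha', hb, hb']
      omega)
  have f1 := e1.frame
  have r1 : σ₁.rarr 13 = σ.rarr 13 := f1.ra 13 rfl
  have r2 : σ₁.rarr 14 = σ.rarr 14 := f1.ra 14 rfl
  obtain ⟨σ₂, t₂, e2, c2, p1, p2, p3⟩ := exec_mergeLoop (W := W) q1 q2 q3 q4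
    ((f1.i 14 rfl).trans h14) haa hbb ham hbm hW
  rw [r1, r2] at p2 p3
  have f2 := e2.frame
  have i13 : σ₂.ivar 13 = k := (f2.i 13 rfl).trans ((f1.i 13 rfl).trans h13)
  have i17 : σ₂.ivar 17 = j := (f2.i 17 rfl).trans ((f1.i 17 rfl).trans h17)
  have i9 : σ₂.iarr 9 = Function.update (σ.iarr 9) (k + j + 1) m := (f2.ia 9 rfl).trans q5
  have i10 : σ₂.iarr 10 = σ.iarr 10 := (f2.ia 10 rfl).trans (f1.ia 10 rfl)
  have e3 : Exec W (.istore 10 (.add (.add (.var 13) (.var 17)) (.const 1)) (.var 14)) σ₂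
      (σ₂.setIA 10 (k + j + 1) (m + (a' - a) + (b' - b))) (5 + 1 + 1) :=
    .istore σ₂ 10 _ _ _ _ (by
      rw [IExpr.eval_eq _ (by simp [i13, i17]; omega)]; simp [i13, i17])
      (by rw [IExpr.eval_eq _ (by simp)]; simp [p1])
  refine ⟨_, _, .seq _ _ _ _ _ _ _ e1 (.seq _ _ _ _ _ _ _ e2 e3), ?_, by simpa using p1,
    by simpa using p2, by simpa using p3, by simpa using i9, by simp [i10]⟩
  have : t₁ ≤ 60 := c1.trans (by decide)
  omega

/-- The queue of the sorted runs before the `j`-th merge. The runs `2 * j + 1, …, k + j` lie one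
after the other on the tape and contain the entries of `l`. -/
structure Queue (v w : ℕ → ℝ) (m k qs qe : ℕ) (l : List (ℝ × ℝ)) (j : ℕ) (σ : Store) : Prop where
  low : m ≤ σ.ivar 14
  old : ∀ i < m, v i = σ.rarr 13 i ∧ w i = σ.rarr 14 i
  next : ∀ i, 2 * j + 1 ≤ i → i < k + j → σ.iarr 10 i = σ.iarr 9 (i + 1)
  last : σ.iarr 10 (k + j) = σ.ivar 14
  le : ∀ i, 2 * j + 1 ≤ i → i ≤ k + j → σ.iarr 9 i ≤ σ.iarr 10 i ∧ σ.iarr 10 i ≤ σ.ivar 14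
  ordered : ∀ i, 2 * j + 1 ≤ i → i ≤ k + j →
    Ordered (seg (σ.rarr 13) (σ.rarr 14) (σ.iarr 9 i) (σ.iarr 10 i))
  perm : (seg (σ.rarr 13) (σ.rarr 14) (σ.iarr 9 (2 * j + 1)) (σ.ivar 14)).Perm l
  begin_old : σ.iarr 9 (2 * k) = qs
  end_old : σ.iarr 10 (2 * k) = qe
  bound : ∀ i, 1 ≤ i → i ≤ k + j → ∀ L, k < (2 * k + 1 - i) * 2 ^ L →
    σ.iarr 9 i ≤ m + k * (L + 1)

/-- The waiting runs contain each of the `k` entries once and are contiguous. A newly written run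
thus begins `k` cells after the first run it merges. -/
theorem Queue.top_eq {v w : ℕ → ℝ} {m k qs qe j : ℕ} {l : List (ℝ × ℝ)} {σ : Store}
    (h : Queue v w m k qs qe l j σ) (hl : l.length = k) (hj : j < k) :
    σ.ivar 14 = σ.iarr 9 (2 * j + 1) + k := by
  have h1 := h.perm.length_eq
  have h2 := h.le (2 * j + 1) le_rfl (by omega)
  rw [length_seg, hl] at h1
  omega

/-- Each level of merging copies the `k` entries once. The field `bound` encodes the level of run
`i` by `2 * k + 1 - i`: for the result `k + j + 1` of a merge this number is half of that for its
first input `2 * j + 1`. It is never 0, so `L` levels with `k < 2 ^ L` suffice. -/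
theorem Queue.begin_le {v w : ℕ → ℝ} {m k qs qe j i L : ℕ} {l : List (ℝ × ℝ)} {σ : Store}
    (h : Queue v w m k qs qe l j σ) (hj : j < k) (hi : 1 ≤ i) (hi' : i ≤ k + j) (hL : k < 2 ^ L) :
    σ.iarr 9 i ≤ m + k * (L + 1) := by
  refine h.bound i hi hi' L (hL.trans_le (Nat.le_mul_of_pos_left _ (by omega)))

theorem exec_queueStep {W : ℕ} {v w : ℕ → ℝ} {m k qs qe j L : ℕ} {l : List (ℝ × ℝ)} {σ : Store}
    (h : Queue v w m k qs qe l j σ) (hl : l.length = k) (hj : j + 1 < k) (h13 : σ.ivar 13 = k)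
    (h17 : σ.ivar 17 = j) (hL : k < 2 ^ L) (hW : m + k * (L + 3) ≤ W) (hW' : 2 * k ≤ W) :
    ∃ σ' t, Exec W mergeBody σ σ' t ∧ t + 60 * σ.ivar 14 ≤ 80 + 60 * σ'.ivar 14 ∧
      Queue v w m k qs qe l (j + 1) σ' := by
  have htop := h.top_eq hl (by omega)
  have l1 := h.le (2 * j + 1) le_rfl (by omega)
  have l2 := h.le (2 * j + 2) (by omega) (by omega)
  have n1 := h.next (2 * j + 1) le_rfl (by omega)
  have o1 := h.ordered (2 * j + 1) le_rfl (by omega)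
  have o2 := h.ordered (2 * j + 2) (by omega) (by omega)
  have bd := h.begin_le (i := 2 * j + 1) (by omega) (by omega) (by omega) hL
  have hmul : k * (L + 3) = k * (L + 1) + 2 * k := by ring
  obtain ⟨a, ha⟩ : ∃ a, σ.iarr 9 (2 * j + 1) = a := ⟨_, rfl⟩
  obtain ⟨b, hb⟩ : ∃ b, σ.iarr 9 (2 * j + 2) = b := ⟨_, rfl⟩
  obtain ⟨c, hc⟩ : ∃ c, σ.iarr 10 (2 * j + 2) = c := ⟨_, rfl⟩
  obtain ⟨M, hM⟩ : ∃ M, σ.ivar 14 = M := ⟨_, rfl⟩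
  rw [show 2 * j + 1 + 1 = 2 * j + 2 from rfl, hb] at n1
  rw [ha, hM] at htop
  rw [ha, n1, hM] at l1
  rw [hb, hc, hM] at l2
  rw [ha, n1] at o1
  rw [hb, hc] at o2
  rw [ha] at bd
  obtain ⟨σ', t, e, ht, p1, p2, p3, p4, p5⟩ := exec_mergeBody (W := W) h13 h17 hM ha n1 hb hc l1.1
    l2.1 l1.2 l2.2 (by omega) (by omega) (by omega)
  obtain ⟨M', hM'⟩ : ∃ M', M + (b - a) + (c - b) = M' := ⟨_, rfl⟩
  rw [hM'] at p1 p2 p5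
  have hlow := h.low
  rw [hM] at hlow
  have hMM : M ≤ M' := by omega
  have n2 : σ'.iarr 9 (2 * (j + 1) + 1) = c := by
    rw [p4]
    -- In this case the only run left is the one just written, and it begins where the former last
    -- run ended.
    by_cases hjk : 2 * (j + 1) + 1 = k + j + 1
    · rw [hjk, Function.update_self, ← hM, ← h.last, ← hc]
      congr 1
      omega
    · rw [Function.update_of_ne hjk, ← hc, h.next (2 * j + 2) (by omega) (by omega)]
      rfl
  have hseg : ∀ x y, y ≤ M → seg (σ'.rarr 13) (σ'.rarr 14) x y =
      seg (σ.rarr 13) (σ.rarr 14) x y := fun x y hy =>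
    (seg_congr fun i _ hi => p3 i (by omega)).symm
  refine ⟨σ', t, e, by rw [hM, p1]; omega, ⟨by omega, fun i hi => ?_, fun i hi hi' => ?_, ?_,
    fun i hi hi' => ?_, fun i hi hi' => ?_, ?_, ?_, ?_, fun i hi hi' L' hL' => ?_⟩⟩
  · exact ⟨(h.old i hi).1.trans (p3 i (by omega)).1, (h.old i hi).2.trans (p3 i (by omega)).2⟩
  · rw [p4, p5, Function.update_of_ne (by omega)]
    by_cases hik : i + 1 = k + j + 1
    · rw [hik, Function.update_self, ← hM, ← h.last]
      congr 1
      omega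
    · rw [Function.update_of_ne hik]
      exact h.next i (by omega) (by omega)
  · rw [p5, p1, ← add_assoc, Function.update_self]
  · rw [p4, p5, p1]
    by_cases hik : i = k + j + 1
    · simp only [hik, Function.update_self]
      omega
    · rw [Function.update_of_ne hik, Function.update_of_ne hik]
      have := h.le i (by omega) (by omega)
      omega
  · rw [p4, p5]
    by_cases hik : i = k + j + 1
    · simp only [hik, Function.update_self]
      rw [p2]
      exact o1.merge o2
    · rw [Function.update_of_ne hik, Function.update_of_ne hik]
      have := h.le i (by omega) (by omega)
      rw [hseg _ _ (by omega)]
      exact h.ordered i (by omega) (by omega)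
  · rw [n2, p1, ← seg_append l2.2 hMM, p2, hseg _ _ le_rfl]
    refine List.Perm.trans ?_ h.perm
    rw [ha, hM, ← seg_append (a := a) (b := c) (by omega) l2.2,
      ← seg_append (a := a) (b := b) l1.1 l2.1]
    exact List.perm_append_comm.trans ((List.merge_perm_append _).append_right _)
  · rw [p4, Function.update_of_ne (by omega)]
    exact h.begin_old
  · rw [p5, Function.update_of_ne (by omega)]
    exact h.end_old
  · rw [p4]
    by_cases hik : i = k + j + 1
    · rw [hik, Function.update_self]
      have hq : 2 * k + 1 - (k + j + 1) = k - j := by omega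
      rw [hik, hq] at hL'
      cases L' with
      | zero =>
        rw [pow_zero, mul_one] at hL'
        omega
      | succ L' =>
        have := h.bound (2 * j + 1) (by omega) (by omega) L' (by
          -- The first input lies one level lower, which accounts for the additional `k` cells.
          rw [show 2 * k + 1 - (2 * j + 1) = (k - j) * 2 by omega, mul_assoc, ← pow_succ']
          exact hL')
        rw [ha] at this
        have e1 : k * (L' + 1 + 1) = k * (L' + 1) + k := by ring
        omega
    · rw [Function.update_of_ne hik]
      exact h.bound i hi (by omega) _ hL'

/-- The state after the last merge, which involves the old sorted entries. -/
structure Sorted (v w : ℕ → ℝ) (m k qs qe L : ℕ) (l : List (ℝ × ℝ)) (σ : Store) : Prop where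
  le : σ.iarr 9 (2 * k) ≤ σ.iarr 10 (2 * k) ∧ σ.iarr 10 (2 * k) ≤ σ.ivar 14
  ordered : Ordered (seg (σ.rarr 13) (σ.rarr 14) (σ.iarr 9 (2 * k)) (σ.iarr 10 (2 * k)))
  perm : (seg (σ.rarr 13) (σ.rarr 14) (σ.iarr 9 (2 * k)) (σ.iarr 10 (2 * k))).Perm
    (l ++ seg v w qs qe)
  low : m ≤ σ.ivar 14
  bound : σ.ivar 14 ≤ m + k * (L + 3) + (qe - qs)
  bound_mul : σ.ivar 14 ≤ m + k * (L + 3 + (qe - qs))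

/-- The merges before this one unite the `k` new runs in the run `2 * k - 1`. The old entries were
stored in advance as the run `2 * k`, so the last merge takes them as its second input, and its
result replaces them under the same number. -/
theorem exec_queueLast {W : ℕ} {v w : ℕ → ℝ} {m k qs qe j L : ℕ} {l : List (ℝ × ℝ)} {σ : Store}
    (h : Queue v w m k qs qe l j σ) (hl : l.length = k) (hj : j + 1 = k) (h13 : σ.ivar 13 = k)
    (h17 : σ.ivar 17 = j) (hL : k < 2 ^ L) (hq : qs ≤ qe) (hqm : qe ≤ m)
    (ho : Ordered (seg v w qs qe)) (hW : m + k * (L + 3) + (qe - qs) ≤ W) (hW' : 2 * k ≤ W) :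
    ∃ σ' t, Exec W mergeBody σ σ' t ∧ t + 60 * σ.ivar 14 ≤ 80 + 60 * σ'.ivar 14 ∧
      Sorted v w m k qs qe L l σ' := by
  have htop := h.top_eq hl (by omega)
  have l1 := h.le (2 * j + 1) le_rfl (by omega)
  have o1 := h.ordered (2 * j + 1) le_rfl (by omega)
  have bd := h.begin_le (i := 2 * j + 1) (by omega) (by omega) (by omega) hL
  have hmul : k * (L + 3) = k * (L + 1) + 2 * k := by ring
  have hlow := h.low
  have n1 : σ.iarr 10 (2 * j + 1) = σ.ivar 14 := by
    rw [← h.last]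
    congr 1
    omega
  have hb := h.begin_old
  have hb' := h.end_old
  rw [show 2 * k = 2 * j + 2 by omega] at hb hb'
  obtain ⟨σ', t, e, ht, p1, p2, p3, p4, p5⟩ := exec_mergeBody (W := W) h13 h17 rfl rfl n1 hb hb'
    (by omega) hq le_rfl (by omega) (by omega) (by omega) (by omega)
  have hk : k + j + 1 = 2 * k := by omega
  rw [n1] at o1
  rw [hk] at p4 p5
  have hseg : seg v w qs qe = seg (σ.rarr 13) (σ.rarr 14) qs qe :=
    seg_congr fun i _ hi => h.old i (by omega)
  refine ⟨σ', t, e, by omega, ⟨?_, ?_, ?_, by omega, by omega, ?_⟩⟩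
  · rw [p4, p5, Function.update_self, Function.update_self, p1]
    omega
  · rw [p4, p5, Function.update_self, Function.update_self, p2]
    rw [hseg] at ho
    exact o1.merge ho
  · rw [p4, p5, Function.update_self, Function.update_self, p2, hseg]
    exact (List.merge_perm_append _).trans (h.perm.append_right _)
  · have : qe - qs ≤ k * (qe - qs) := Nat.le_mul_of_pos_left _ (by omega)
    rw [Nat.mul_add]
    omega

theorem TapeCells.queue {v w : ℕ → ℝ} {m qs qe : ℕ} {l : List (ℝ × ℝ)} {σ : Store}
    (h : TapeCells v w m l σ) (h1 : σ.iarr 9 (2 * l.length) = qs)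
    (h2 : σ.iarr 10 (2 * l.length) = qe) (hl : 0 < l.length)
    (hr : ∀ j, 0 < j → j ≤ l.length → σ.iarr 9 j + 1 = m + j ∧ σ.iarr 10 j = m + j) :
    Queue v w m l.length qs qe l 0 σ := by
  have ht := h.top
  refine ⟨by omega, h.old, fun i hi hi' => ?_, ?_, fun i hi hi' => ?_, fun i hi hi' => ?_, ?_, h1,
    h2, fun i hi hi' L _ => ?_⟩
  · have := hr i (by omega) (by omega)
    have := hr (i + 1) (by omega) (by omega)
    omega
  · have := hr l.length hl le_rfl
    rw [add_zero]
    omega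
  · have := hr i (by omega) (by omega)
    omega
  · have := hr i (by omega) (by omega)
    rw [this.2, show m + i = σ.iarr 9 i + 1 by omega, seg_succ le_rfl, seg_self]
    simp [Ordered]
  · have := hr 1 (by omega) (by omega)
    rw [show σ.iarr 9 (2 * 0 + 1) = m by simpa using this.1, ht, h.new]
  · have := hr i (by omega) (by omega)
    have : l.length ≤ l.length * (L + 1) := Nat.le_mul_of_pos_right _ (by omega)
    omega

theorem exec_sortProg {W : ℕ} {v w : ℕ → ℝ} {m qs qe L : ℕ} {l : List (ℝ × ℝ)} {σ : Store}
    (h : TapeCells v w m l σ) (h15 : σ.ivar 15 = qs) (h16 : σ.ivar 16 = qe) (hL : l.length < 2 ^ L)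
    (hq : qs ≤ qe) (hqm : qe ≤ m) (ho : Ordered (seg v w qs qe))
    (hW : m + l.length * (L + 3) + (qe - qs) ≤ W) (hW' : 2 * l.length + 1 ≤ W) :
    ∃ σ' t, Exec W sortProg σ σ' t ∧
      t ≤ 90 * l.length + 60 * (l.length * (L + 3) + (qe - qs)) + 100 ∧
      σ'.ivar 15 ≤ σ'.ivar 16 ∧ σ'.ivar 16 ≤ σ'.ivar 14 ∧
      Ordered (seg (σ'.rarr 13) (σ'.rarr 14) (σ'.ivar 15) (σ'.ivar 16)) ∧
      (seg (σ'.rarr 13) (σ'.rarr 14) (σ'.ivar 15) (σ'.ivar 16)).Perm (l ++ seg v w qs qe) ∧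
      σ'.ivar 14 ≤ m + l.length * (L + 3 + (qe - qs)) := by
  obtain ⟨k, hk⟩ : ∃ k, k = l.length := ⟨_, rfl⟩
  have hcnt := h.cnt
  rw [← hk] at hcnt hL hW hW' ⊢
  obtain ⟨σ₁, t₁, e1, c1, hr1, g9, g10, g17⟩ := Prog.wp_sound (W := W) (σ := σ)
    (.istore 9 (.add (.var 13) (.var 13)) (.var 15) ⨾
      .istore 10 (.add (.var 13) (.var 13)) (.var 16) ⨾ .iset 17 (.const 0))
    (Q := fun τ => (0 < k → ∀ j, 0 < j → j ≤ k → τ.iarr 9 j + 1 = m + j ∧ τ.iarr 10 j = m + j) ∧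
      τ.iarr 9 (2 * k) = qs ∧ τ.iarr 10 (2 * k) = qe ∧ τ.ivar 17 = 0) (by
      simp [hcnt, h15, h16, two_mul]
      refine ⟨by omega, fun hk0 j hj hj' => ?_⟩
      rw [Function.update_of_ne (by omega), Function.update_of_ne (by omega)]
      exact h.run j hj (by omega))
  have f1 := e1.frame
  have h13 : σ₁.ivar 13 = k := (f1.i 13 rfl).trans hcnt
  have h14 : σ₁.ivar 14 = m + k := (f1.i 14 rfl).trans (by rw [hk]; exact h.top)
  have r13 : σ₁.rarr 13 = σ.rarr 13 := f1.ra 13 rfl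
  have r14 : σ₁.rarr 14 = σ.rarr 14 := f1.ra 14 rfl
  -- Without new entries, run 0 is already the old list and nothing is copied; hence the factor `k`
  -- in `bound_mul`.
  have hS0 : k = 0 → Sorted v w m k qs qe L l σ₁ := by
    intro hk0
    have hl : l = [] := List.length_eq_zero_iff.mp (by omega)
    have hseg : seg v w qs qe = seg (σ.rarr 13) (σ.rarr 14) qs qe :=
      seg_congr fun i _ hi => h.old i (by omega)
    refine ⟨by omega, ?_, ?_, by omega, ?_, by simp [h14, hk0]⟩
    · rw [g9, g10, r13, r14, ← hseg]
      exact ho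
    · rw [g9, g10, r13, r14, ← hseg, hl]
      rfl
    · simp [h14, hk0]
  -- The time of the merges is charged to the growth of the tape, at 60 units per cell.
  obtain ⟨σ₂, t₂, e2, c2, i2, -⟩ := exec_forUp_amortized (W := W) (i := 17) (l := 13)
    (c := mergeBody)
    (fun j τ => (j < k → Queue v w m k qs qe l j τ) ∧ (j = k → Sorted v w m k qs qe L l τ))
    (fun τ => 60 * τ.ivar 14) 80 0 k (σ₀ := σ₁) (by decide) (by decide) g17 h13 (by omega)
    (by omega) (by omega)
    ⟨fun hk0 => by
      have hT : TapeCells v w m l σ₁ := ⟨by omega, by omega, by rw [r13, r14]; exact h.new,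
        by rw [r13, r14]; exact h.old, fun j hj hj' => hr1 hk0 j hj (by omega)⟩
      have := hT.queue (qs := qs) (qe := qe) (by rw [← hk]; exact g9) (by rw [← hk]; exact g10)
        (by omega) (by rw [← hk]; exact hr1 hk0)
      rwa [← hk] at this, fun hk0 => hS0 hk0.symm⟩
    (by
      intro j τ _ hj hτ hf hI
      have hQ := hI.1 hj
      have i13 : τ.ivar 13 = k := (hf.i 13 rfl).trans h13
      by_cases hjk : j + 1 < k
      · obtain ⟨τ', t, e, ht, hQ'⟩ := exec_queueStep hQ hk.symm hjk i13 hτ hL (W := W) (by omega)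
          (by omega)
        refine ⟨τ', t, e, by simpa using ht, fun _ => ?_, fun h => by omega⟩
        exact ⟨by simpa using hQ'.low, hQ'.old, hQ'.next, by simpa using hQ'.last,
          by simpa using hQ'.le, hQ'.ordered, by simpa using hQ'.perm, hQ'.begin_old, hQ'.end_old,
          hQ'.bound⟩
      · obtain ⟨τ', t, e, ht, hS⟩ := exec_queueLast hQ hk.symm (by omega) i13 hτ hL hq hqm ho
          (W := W) hW (by omega)
        refine ⟨τ', t, e, by simpa using ht, fun h => by omega, fun _ => ?_⟩
        exact ⟨by simpa using hS.le, hS.ordered, hS.perm, by simpa using hS.low,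
          by simpa using hS.bound, by simpa using hS.bound_mul⟩)
  have hS := i2.2 rfl
  have f2 := e2.frame
  have h13' : σ₂.ivar 13 = k := (f2.i 13 rfl).trans h13
  have e3 : Exec W (.iset 15 (.arr 9 (.add (.var 13) (.var 13))) ⨾
      .iset 16 (.arr 10 (.add (.var 13) (.var 13)))) σ₂
      ((σ₂.setI 15 (σ₂.iarr 9 (2 * k))).setI 16 (σ₂.iarr 10 (2 * k))) (5 + 5) := by
    refine .seq _ _ _ _ _ _ _ (.iset σ₂ 15 _ _ ?_) (.iset (σ₂.setI 15 _) 16 _ _ ?_)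
    · rw [IExpr.eval_eq _ (by simp [h13']; omega)]; simp [h13', two_mul]
    · rw [IExpr.eval_eq _ (by simp [h13']; omega)]; simp [h13', two_mul]
  have hb := hS.bound
  have hlow := hS.low
  refine ⟨_, _, .seq _ _ _ _ _ _ _ e1 (.seq _ _ _ _ _ _ _ e2 e3), ?_, by simpa using hS.le.1,
    by simpa using hS.le.2, by simpa using hS.ordered, by simpa using hS.perm, ?_⟩
  · have : t₁ ≤ 20 := c1.trans (by decide)
    simp only [h14] at c2
    omega
  · simpa using hS.bound_mul

end PCenter

/-! ### Weight and weighted median of the entries inside the interval. -/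

namespace PCenter

open RealRAM

/-! ### The weighted median -/

theorem exec_totalProg {W a b : ℕ} {lo hi : ℝ} {σ : Store} (h15 : σ.ivar 15 = a)
    (h16 : σ.ivar 16 = b) (hab : a ≤ b) (hW : b ≤ W) (hW1 : 1 ≤ W) (hlo : σ.rvar 2 = lo)
    (hhi : σ.rvar 3 = hi) :
    ∃ σ' t, Exec W totalProg σ σ' t ∧ t ≤ 40 * (b - a) + 20 ∧
      σ'.rvar 12 = inW lo hi (seg (σ.rarr 13) (σ.rarr 14) a b) := by
  have e0 : Exec W (.rset 12 (.const 0) ⨾ .iset 6 (.var 15)) σ ((σ.setR 12 0).setI 6 a) (2 + 2) :=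
    .seq _ _ _ _ _ _ _ (.rset σ 12 _ _ (by rw [RExpr.eval_eq _ (by simp)]; simp))
      (.iset (σ.setR 12 0) 6 _ _ (by rw [IExpr.eval_eq _ (by simp)]; simp [h15]))
  obtain ⟨σ', t, e, ht, hI, -⟩ := exec_forUp (W := W) (i := 6) (l := 16)
    (c := .ite insideTest (.rset 12 (.add (.var 12) (.arr 14 (.var 6)))) .skip)
    (fun j τ => τ.rvar 12 = inW lo hi (seg (σ.rarr 13) (σ.rarr 14) a j)) 30 a b
    (σ₀ := (σ.setR 12 0).setI 6 a) (by decide) (by decide) (by simp) (by simpa using h16) hab hW hW1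
    (by simp [seg_self])
    (by
      intro j τ haj hj hτ hf hI
      have r2 : τ.rvar 2 = lo := (hf.r 2 rfl).trans (by simpa using hlo)
      have r3 : τ.rvar 3 = hi := (hf.r 3 rfl).trans (by simpa using hhi)
      have r13 : τ.rarr 13 = σ.rarr 13 := (hf.ra 13 rfl).trans (by simp)
      have r14 : τ.rarr 14 = σ.rarr 14 := (hf.ra 14 rfl).trans (by simp)
      obtain ⟨σ', t, h1, h2, h3⟩ := Prog.wp_sound (W := W) (σ := τ)
        (.ite insideTest (.rset 12 (.add (.var 12) (.arr 14 (.var 6)))) .skip)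
        (Q := fun τ' => (τ'.setI 6 (j + 1)).rvar 12 =
          inW lo hi (seg (σ.rarr 13) (σ.rarr 14) a (j + 1))) (by
          simp only [insideTest, Prog.wp, BExpr.Ok, BExpr.Holds, IExpr.Ok, IExpr.val, RExpr.Ok,
            RExpr.val, r2, r3, r13, r14, hτ, hI, not_le]
          rw [seg_succ haj, inW_append]
          refine ⟨by simp, fun h => ⟨by simp, ?_⟩, fun h => ?_⟩
          · simp [inW_cons, h]
          · simp [inW_cons, h, hI])
      exact ⟨σ', t, h1, h2.trans (by decide), h3⟩)
  exact ⟨σ', _, .seq _ _ _ _ _ _ _ e0 e, by omega, hI⟩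

/-- Entries inside the interval are added up in sorted order until twice the partial sum reaches the
total. The entry that achieves this is the last one copied to real variable `1`, so it satisfies the
hypotheses of `inW_median`. -/
theorem exec_medianProg {W a b : ℕ} {lo hi : ℝ} {σ : Store} (h15 : σ.ivar 15 = a)
    (h16 : σ.ivar 16 = b) (hab : a ≤ b) (hW : b ≤ W) (hW1 : 1 ≤ W) (hlo : σ.rvar 2 = lo)
    (hhi : σ.rvar 3 = hi) (h12 : σ.rvar 12 = inW lo hi (seg (σ.rarr 13) (σ.rarr 14) a b))
    (hpos : 0 < σ.rvar 12) (ho : Ordered (seg (σ.rarr 13) (σ.rarr 14) a b))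
    (hw : ∀ e ∈ seg (σ.rarr 13) (σ.rarr 14) a b, 0 ≤ e.2) :
    ∃ σ' t, Exec W medianProg σ σ' t ∧ t ≤ 50 * (b - a) + 20 ∧
      lo < σ'.rvar 1 ∧ σ'.rvar 1 < hi ∧
      2 * inW lo (σ'.rvar 1) (seg (σ.rarr 13) (σ.rarr 14) a b) ≤
        inW lo hi (seg (σ.rarr 13) (σ.rarr 14) a b) ∧
      2 * inW (σ'.rvar 1) hi (seg (σ.rarr 13) (σ.rarr 14) a b) ≤
        inW lo hi (seg (σ.rarr 13) (σ.rarr 14) a b) := by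
  obtain ⟨T, hT⟩ : ∃ T, σ.rvar 12 = T := ⟨_, rfl⟩
  have e0 : Exec W (.rset 13 (.const 0) ⨾ .iset 6 (.var 15)) σ ((σ.setR 13 0).setI 6 a) (2 + 2) :=
    .seq _ _ _ _ _ _ _ (.rset σ 13 _ _ (by rw [RExpr.eval_eq _ (by simp)]; simp))
      (.iset (σ.setR 13 0) 6 _ _ (by rw [IExpr.eval_eq _ (by simp)]; simp [h15]))
  obtain ⟨σ', t, e, ht, hI, -⟩ := exec_forUp (W := W) (i := 6) (l := 16)
    (c := .ite (.and insideTest (.not (.rle (.var 12) (.add (.var 13) (.var 13)))))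
      (.rset 13 (.add (.var 13) (.arr 14 (.var 6))) ⨾ .rset 1 (.arr 13 (.var 6))) .skip)
    (fun j τ => (τ.rvar 13 + τ.rvar 13 < T ∧
        τ.rvar 13 = inW lo hi (seg (σ.rarr 13) (σ.rarr 14) a j)) ∨
      (T ≤ τ.rvar 13 + τ.rvar 13 ∧ ∃ c, a ≤ c ∧ c < b ∧ τ.rvar 1 = σ.rarr 13 c ∧
        lo < σ.rarr 13 c ∧ σ.rarr 13 c < hi ∧
        2 * inW lo hi (seg (σ.rarr 13) (σ.rarr 14) a c) ≤ T ∧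
        T ≤ 2 * (inW lo hi (seg (σ.rarr 13) (σ.rarr 14) a c) + σ.rarr 14 c))) 40 a b
    (σ₀ := (σ.setR 13 0).setI 6 a) (by decide) (by decide) (by simp) (by simpa using h16) hab hW hW1
    (.inl (by simpa [seg_self, ← hT] using hpos))
    (by
      intro j τ haj hj hτ hf hI
      have r2 : τ.rvar 2 = lo := (hf.r 2 rfl).trans (by simpa using hlo)
      have r3 : τ.rvar 3 = hi := (hf.r 3 rfl).trans (by simpa using hhi)
      have r12 : τ.rvar 12 = T := (hf.r 12 rfl).trans (by simpa using hT)
      have r13 : τ.rarr 13 = σ.rarr 13 := (hf.ra 13 rfl).trans (by simp)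
      have r14 : τ.rarr 14 = σ.rarr 14 := (hf.ra 14 rfl).trans (by simp)
      obtain ⟨σ', t, h1, h2, h3⟩ := Prog.wp_sound (W := W) (σ := τ)
        (.ite (.and insideTest (.not (.rle (.var 12) (.add (.var 13) (.var 13)))))
          (.rset 13 (.add (.var 13) (.arr 14 (.var 6))) ⨾ .rset 1 (.arr 13 (.var 6))) .skip)
        (Q := fun τ' => (τ'.rvar 13 + τ'.rvar 13 < T ∧
            τ'.rvar 13 = inW lo hi (seg (σ.rarr 13) (σ.rarr 14) a (j + 1))) ∨
          (T ≤ τ'.rvar 13 + τ'.rvar 13 ∧ ∃ c, a ≤ c ∧ c < b ∧ τ'.rvar 1 = σ.rarr 13 c ∧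
            lo < σ.rarr 13 c ∧ σ.rarr 13 c < hi ∧
            2 * inW lo hi (seg (σ.rarr 13) (σ.rarr 14) a c) ≤ T ∧
            T ≤ 2 * (inW lo hi (seg (σ.rarr 13) (σ.rarr 14) a c) + σ.rarr 14 c))) (by
          simp only [insideTest, Prog.wp, BExpr.Ok, BExpr.Holds, IExpr.Ok, IExpr.val, RExpr.Ok,
            RExpr.val, r2, r3, r12, r13, r14, hτ, not_le]
          rw [seg_succ haj, inW_append]
          refine ⟨by simp, fun h => ⟨by simp, by simp, ?_⟩, fun h => ?_⟩
          · simp only [Store.setR_rvar, Store.setR_rarr, Store.setR_ivar, if_true,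
              Nat.reduceEqDiff, if_false, r13, hτ, inW_cons, if_pos h.1, inW_nil, add_zero]
            rcases hI with ⟨q1, q2⟩ | ⟨q1, -⟩
            · rw [q2] at q1 ⊢
              rcases lt_or_ge (inW lo hi (seg (σ.rarr 13) (σ.rarr 14) a j) + σ.rarr 14 j +
                (inW lo hi (seg (σ.rarr 13) (σ.rarr 14) a j) + σ.rarr 14 j)) T with hlt | hge
              · exact .inl ⟨hlt, rfl⟩
              · exact .inr ⟨hge, j, haj, hj, by simp, h.1.1, h.1.2, by linarith, by linarith⟩
            · exact absurd q1 (not_le.mpr h.2)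
          · rcases hI with ⟨q1, q2⟩ | hI
            · have : ¬ (lo < σ.rarr 13 j ∧ σ.rarr 13 j < hi) := fun h' => h ⟨h', q1⟩
              exact .inl ⟨q1, by simp [this, q2]⟩
            · exact .inr hI)
      exact ⟨σ', t, h1, h2.trans (by decide), by simpa using h3⟩)
  refine ⟨σ', _, .seq _ _ _ _ _ _ _ e0 e, by omega, ?_⟩
  rw [← h12, hT]
  rw [hT] at hpos h12
  rcases hI with ⟨q1, q2⟩ | ⟨-, c, hac, hcb, q1, q2, q3, q4, q5⟩
  · linarith
  · rw [q1]
    refine ⟨q2, q3, ?_⟩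
    have hsplit : seg (σ.rarr 13) (σ.rarr 14) a b = seg (σ.rarr 13) (σ.rarr 14) a c ++
        (σ.rarr 13 c, σ.rarr 14 c) :: seg (σ.rarr 13) (σ.rarr 14) (c + 1) b := by
      rw [← seg_append hac hcb.le, seg_cons hcb]
    rw [h12] at q4 q5 ⊢
    rw [hsplit] at ho hw q4 q5 ⊢
    exact inW_median ho hw ⟨q2, q3⟩ q4 q5

end PCenter

/-! ### Labelling away from the root, root distances and radii. -/

namespace PCenter

open RealRAM

/-! ### Labelling -/

/-- The first `c` labels have been given to vertices. -/
structure LabelCells (n r c : ℕ) (σ : Store) : Prop where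
  cnt : σ.ivar 3 = c
  pos : 1 ≤ c
  lt : ∀ i < c, σ.iarr 4 i < n
  mark : ∀ i < c, σ.iarr 3 (σ.iarr 4 i) ≠ 0 ∧ σ.iarr 5 (σ.iarr 4 i) = i
  surj : ∀ v < n, σ.iarr 3 v ≠ 0 → ∃ i < c, σ.iarr 4 i = v
  root : σ.iarr 4 0 = r
  child : ∀ i, 0 < i → i < c → σ.iarr 6 i < i ∧ σ.iarr 4 (σ.iarr 6 i) = σ.iarr 0 (σ.iarr 4 i) ∧
    σ.rarr 3 i = σ.rarr 0 (σ.iarr 4 i)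
  weight : ∀ i < c, σ.rarr 4 i = σ.rarr 1 (σ.iarr 4 i)

theorem LabelCells.inj {n r c : ℕ} {σ : Store} (h : LabelCells n r c σ) {i j : ℕ} (hi : i < c)
    (hj : j < c) (he : σ.iarr 4 i = σ.iarr 4 j) : i = j := by
  rw [← (h.mark i hi).2, ← (h.mark j hj).2, he]

theorem LabelCells.le {n r c : ℕ} {σ : Store} (h : LabelCells n r c σ) : c ≤ n := by
  have := Finset.card_le_card_of_injOn (s := Finset.range c) (t := Finset.range n) (σ.iarr 4)
    (fun i hi => by simpa using h.lt i (by simpa using hi))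
    (fun i hi j hj he => h.inj (by simpa using hi) (by simpa using hj) he)
  simpa using this

theorem LabelCells.congr {n r c : ℕ} {σ τ : Store} (h : LabelCells n r c σ)
    (h1 : τ.ivar 3 = σ.ivar 3) (h2 : τ.iarr = σ.iarr) (h3 : τ.rarr = σ.rarr) :
    LabelCells n r c τ :=
  ⟨h1.trans h.cnt, h.pos, by rw [h2]; exact h.lt, by rw [h2]; exact h.mark,
    by rw [h2]; exact h.surj, by rw [h2]; exact h.root, by rw [h2, h3]; exact h.child,
    by rw [h2, h3]; exact h.weight⟩

theorem exec_labelBody {W n r c v : ℕ} {σ : Store} (h : LabelCells n r c σ) (h4 : σ.ivar 4 = v)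
    (hv : v < n) (hpv : σ.iarr 0 v < n) (hW : n + 1 ≤ W) :
    ∃ σ' t, Exec W labelBody σ σ' t ∧ t ≤ 60 ∧ (∃ c', LabelCells n r c' σ') ∧
      (∀ u, σ.iarr 3 u ≠ 0 → σ'.iarr 3 u ≠ 0) ∧
      (σ.iarr 3 (σ.iarr 0 v) ≠ 0 → σ'.iarr 3 v ≠ 0) := by
  have hcn := h.le
  obtain ⟨σ', t, e, ht, hq⟩ := Prog.wp_sound (W := W) (σ := σ) labelBody
    (Q := fun σ' => (∃ c', LabelCells n r c' σ') ∧ (∀ u, σ.iarr 3 u ≠ 0 → σ'.iarr 3 u ≠ 0) ∧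
      (σ.iarr 3 (σ.iarr 0 v) ≠ 0 → σ'.iarr 3 v ≠ 0)) (by
    simp only [labelBody, Prog.wp, BExpr.Ok, BExpr.Holds, IExpr.Ok, IExpr.val, RExpr.Ok, RExpr.val,
      h4, h.cnt, Store.setIA_ivar, Store.setIA_iarr, Store.setIA_rarr, Store.setRA_ivar,
      Store.setRA_rarr, Nat.reduceEqDiff, if_false]
    refine ⟨⟨⟨trivial, by omega⟩, by omega, trivial⟩, fun hc => ?_, fun hc => ?_⟩
    · obtain ⟨q, hq, hqv⟩ := h.surj _ hpv (by omega)
      have hne : ∀ i < c, σ.iarr 4 i ≠ v := fun i hi he => (h.mark i hi).1 (by rw [he]; omega)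
      have hpne : σ.iarr 0 v ≠ v := fun he => by rw [he] at hc; omega
      have hq5 := (h.mark q hq).2
      rw [hqv] at hq5
      refine ⟨trivial, trivial, trivial, trivial, trivial, trivial, trivial, trivial, trivial,
        trivial, trivial, by omega, ⟨trivial, by omega, by omega⟩, ⟨c + 1, ?_⟩, fun u hu => ?_,
        fun _ => by simp⟩
      · refine ⟨by simp, by omega, fun i hi => ?_, fun i hi => ?_, fun u hu hm => ?_, ?_,
          fun i hi hic => ?_, fun i hi => ?_⟩
        · rcases Nat.lt_succ_iff_lt_or_eq.mp hi with hi | rfl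
          · simpa [hi.ne] using h.lt i hi
          · simpa using hv
        · rcases Nat.lt_succ_iff_lt_or_eq.mp hi with hi | rfl
          · have := h.mark i hi
            simp only [Store.setI_iarr, Store.setIA_iarr, Store.setRA_iarr, Nat.reduceEqDiff,
              if_false, if_true, Function.update_of_ne hi.ne, Function.update_of_ne (hne i hi)]
            exact this
          · simp
        · by_cases huv : u = v
          · exact ⟨c, by omega, by simp [huv]⟩
          · obtain ⟨i, hi, he⟩ := h.surj u hu (by simpa [huv] using hm)
            exact ⟨i, by omega, by simpa [hi.ne] using he⟩
        · have := h.pos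
          simpa [show (0 : ℕ) ≠ c by omega] using h.root
        · rcases Nat.lt_succ_iff_lt_or_eq.mp hic with hic | rfl
          · obtain ⟨a1, a2, a3⟩ := h.child i hi hic
            simp only [Store.setI_iarr, Store.setIA_iarr, Store.setRA_iarr, Store.setI_rarr,
              Store.setIA_rarr, Store.setRA_rarr, Nat.reduceEqDiff, if_false, if_true,
              Function.update_of_ne hic.ne, OfNat.zero_ne_ofNat]
            refine ⟨a1, ?_, a3⟩
            rw [Function.update_of_ne (by omega)]
            exact a2
          · simp [hpne, hq5, hq, hqv, hq.ne]
        · rcases Nat.lt_succ_iff_lt_or_eq.mp hi with hi | rfl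
          · simpa [hi.ne] using h.weight i hi
          · simp
      · by_cases huv : u = v
        · simp [huv]
        · simpa [huv] using hu
    · refine ⟨⟨c, h⟩, fun u hu => hu, fun hp hz => hc ⟨by omega, by omega⟩⟩)
  exact ⟨σ', t, e, ht.trans (by decide), hq⟩

/-- A sweep labels every vertex whose parent was labelled before, so after `h` sweeps all vertices
of depth less than `h` are labelled. At most `H + 1` linear sweeps are needed, which is O(n log n)
in a balanced tree. -/
theorem exec_labelProg {W n r H : ℕ} {dep : ℕ → ℕ} {σ : Store} (hn : σ.ivar 0 = n)
    (hr : σ.ivar 2 = r) (hrn : r < n) (h3 : σ.iarr 3 = fun _ => 0)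
    (h5 : σ.iarr 5 = fun _ => 0)
    (hp : ∀ v < n, σ.iarr 0 v < n) (hd : ∀ v < n, v ≠ r → dep v = dep (σ.iarr 0 v) + 1)
    (hH : ∀ v < n, dep v ≤ H) (hW : n + 1 ≤ W) :
    ∃ σ' t, Exec W labelProg σ σ' t ∧ t ≤ (H + 1) * (69 * n + 20) + 50 ∧ LabelCells n r n σ' := by
  obtain ⟨σ₁, t₁, e1, c1, q1, q2⟩ := Prog.wp_sound (W := W) (σ := σ)
    (.istore 4 (.const 0) (.var 2) ⨾ .rstore 4 (.const 0) (.arr 1 (.var 2)) ⨾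
      .istore 3 (.var 2) (.const 1) ⨾ .iset 3 (.const 1))
    (Q := fun τ => LabelCells n r 1 τ ∧ τ.iarr 3 r ≠ 0) (by
      simp [hr]
      refine ⟨by omega, ⟨by simp, le_rfl, fun i hi => ?_, fun i hi => ?_,
        fun v hv hm => ?_, by simp, fun i hi hi' => by omega, fun i hi => ?_⟩⟩
      · obtain rfl : i = 0 := by omega
        simpa using hrn
      · obtain rfl : i = 0 := by omega
        simp [h5]
      · by_cases hvr : v = r
        · exact ⟨0, by omega, by simp [hvr]⟩
        · simp [h3, hvr] at hm
      · obtain rfl : i = 0 := by omega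
        simp)
  have f1 := e1.frame
  have n1 : σ₁.ivar 0 = n := (f1.i 0 rfl).trans hn
  have p1 : σ₁.iarr 0 = σ.iarr 0 := f1.ia 0 rfl
  obtain ⟨σ₂, t₂, m, e2, ⟨h, -, ⟨c, hL⟩, -⟩, c2, hx⟩ := exec_loop (W := W)
    (b := .not (.ile (.var 0) (.var 3))) (c := .iset 4 (.const 0) ⨾ forUp 4 0 labelBody)
    (fun m τ => ∃ h, m = (H + 1 - h) * (69 * n + 20) ∧ (∃ c, LabelCells n r c τ) ∧
      ∀ v < n, (v = r ∨ dep v < h) → τ.iarr 3 v ≠ 0) σ₁ ((H + 1) * (69 * n + 20))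
    ⟨0, rfl, ⟨1, q1⟩, fun v hv hvr => by
      rcases hvr with rfl | hvr
      · exact q2
      · omega⟩ (by simp)
    (by
      rintro m τ hf ⟨h, rfl, ⟨c, hL⟩, hm⟩ hlt
      have hf0 : τ.ivar 0 = n := (hf.i 0 rfl).trans n1
      have hfp : τ.iarr 0 = σ.iarr 0 := (hf.ia 0 rfl).trans p1
      have hcn : c < n := by simpa [hf0, hL.cnt] using hlt
      -- Otherwise all vertices would be labelled already, contrary to the test of the loop.
      have hh : h < H + 1 := by
        by_contra hh
        have hs : ∀ v < n, ∃ i < c, τ.iarr 4 i = v := fun v hv =>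
          hL.surj v hv (hm v hv (.inr (by have := hH v hv; omega)))
        have := Finset.card_le_card_of_surjOn (s := Finset.range c) (t := Finset.range n)
          (τ.iarr 4) (fun v hv => by
            obtain ⟨i, hi, he⟩ := hs v (by simpa using hv)
            exact ⟨i, by simpa using hi, he⟩)
        simp only [Finset.card_range] at this
        omega
      have e0 : Exec W (.iset 4 (.const 0)) τ (τ.setI 4 0) 2 :=
        .iset τ 4 (.const 0) 0 (IExpr.eval_eq _ (by simp))
      obtain ⟨τ', t, e, ht, ⟨hc', hmon, hnew⟩, -⟩ := exec_forUp (W := W) (i := 4) (l := 0)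
        (c := labelBody)
        (fun j τ' => (∃ c, LabelCells n r c τ') ∧ (∀ u, τ.iarr 3 u ≠ 0 → τ'.iarr 3 u ≠ 0) ∧
          ∀ u < j, τ.iarr 3 (σ.iarr 0 u) ≠ 0 → τ'.iarr 3 u ≠ 0) 60 0 n (σ₀ := τ.setI 4 0)
        (by decide) (by decide) (by simp) (by simpa using hf0) (by omega) (by omega) (by omega)
        ⟨⟨c, hL.congr (by simp) (by simp) (by simp)⟩, by simp, by simp⟩
        (by
          rintro j τ₁ - hj hτ hf' ⟨⟨c, hL⟩, hmon, hnew⟩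
          have hp' : τ₁.iarr 0 = σ.iarr 0 := (hf'.ia 0 rfl).trans (by simpa using hfp)
          obtain ⟨τ₂, t, e, ht, ⟨c', hL'⟩, a1, a2⟩ := exec_labelBody hL hτ hj
            (by rw [hp']; exact hp j hj) hW
          refine ⟨τ₂, t, e, ht, ⟨c', hL'.congr (by simp) (by simp) (by simp)⟩, fun u hu => ?_,
            fun u hu hm => ?_⟩
          · simpa using a1 u (hmon u hu)
          · rcases Nat.lt_succ_iff_lt_or_eq.mp hu with hu | rfl
            · simpa using a1 u (hnew u hu hm)
            · simpa using a2 (hmon _ (by rwa [hp'])))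
      refine ⟨τ', _, _, .seq _ _ _ _ _ _ _ e0 e, ⟨h + 1, rfl, hc', fun v hv hvd => ?_⟩, ?_⟩
      · by_cases hvr : v = r
        · exact hmon v (hm v hv (.inl hvr))
        · have := hd v hv hvr
          exact hnew v hv (hm _ (hp v hv) (.inr (by omega)))
      · have e3 : H + 1 - h = (H + 1 - (h + 1)) + 1 := by omega
        have e4 : (H + 1 - h) * (69 * n + 20) = (H + 1 - (h + 1)) * (69 * n + 20) + (69 * n + 20) := by
          rw [e3]
          ring
        simp only [BExpr.ops, IExpr.ops]
        omega)
  have hcn := hL.le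
  have n2 : σ₂.ivar 0 = n := (e2.frame.i 0 rfl).trans n1
  simp [n2, hL.cnt] at hx
  obtain rfl : c = n := by omega
  refine ⟨σ₂, _, .seq _ _ _ _ _ _ _ e1 e2, ?_, hL⟩
  have : t₁ ≤ 20 := c1.trans (by decide)
  simp only [BExpr.ops, IExpr.ops] at c2
  omega

/-! ### Initialization -/

theorem exec_initBody {W j : ℕ} {par : ℕ → ℕ} {len w : ℕ → ℝ} {σ : Store}
    (hpar : σ.iarr 6 = par) (hlen : σ.rarr 3 = len) (hw : σ.rarr 4 = w) (hj0 : 0 < j)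
    (hlt : par j < j) (hσ : σ.ivar 6 = j)
    (hI : (∀ u < j, σ.rarr 6 u = nxt par j u) ∧ (∀ i, 0 < i → i < j → σ.rarr 7 i = wt par i) ∧
      σ.rarr 5 0 = 0 ∧ (∀ i, 0 < i → i < j → par i < i ∧ σ.rarr 5 i = σ.rarr 5 (par i) + len i) ∧
      σ.rvar 7 = ∑ i ∈ Finset.range j, σ.rarr 5 i ∧
      σ.rvar 3 = ∑ i ∈ Finset.range j, σ.rarr 5 i * w i) :
    ∃ σ' t, Exec W initBody σ σ' t ∧ t ≤ 60 ∧
      ((∀ u < j + 1, σ'.rarr 6 u = nxt par (j + 1) u) ∧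
      (∀ i, 0 < i → i < j + 1 → σ'.rarr 7 i = wt par i) ∧ σ'.rarr 5 0 = 0 ∧
      (∀ i, 0 < i → i < j + 1 → par i < i ∧ σ'.rarr 5 i = σ'.rarr 5 (par i) + len i) ∧
      σ'.rvar 7 = ∑ i ∈ Finset.range (j + 1), σ'.rarr 5 i ∧
      σ'.rvar 3 = ∑ i ∈ Finset.range (j + 1), σ'.rarr 5 i * w i) := by
  obtain ⟨i1, i2, i3, i4, i5, i6⟩ := hI
  have hs : ∀ (g : ℝ → ℕ → ℝ) (x : ℝ), ∑ i ∈ Finset.range (j + 1),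
      g (Function.update (σ.rarr 5) j x i) i = ∑ i ∈ Finset.range j, g (σ.rarr 5 i) i + g x j := by
    intro g x
    rw [Finset.sum_range_succ, Function.update_self]
    congr 1
    refine Finset.sum_congr rfl fun i hi => ?_
    rw [Function.update_of_ne (Finset.mem_range.mp hi).ne]
  have hwt : nxt par j (par j) * 4 = wt par j := rfl
  obtain ⟨σ', t, e, ht, hq⟩ := Prog.wp_sound (W := W) (σ := σ) initBody
    (Q := fun τ => τ.rarr 5 = Function.update (σ.rarr 5) j (σ.rarr 5 (par j) + len j) ∧
      τ.rvar 7 = σ.rvar 7 + (σ.rarr 5 (par j) + len j) ∧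
      τ.rvar 3 = σ.rvar 3 + (σ.rarr 5 (par j) + len j) * w j ∧
      τ.rarr 6 = Function.update (Function.update (σ.rarr 6) (par j) (wt par j)) j (wt par j) ∧
      τ.rarr 7 = Function.update (σ.rarr 7) j (wt par j))
    (by simp [initBody, hσ, hpar, hlen, hw, i1 (par j) hlt, hwt])
  obtain ⟨q5, q7, q3, q6, q8⟩ := hq
  refine ⟨σ', t, e, ht.trans (by decide), fun u hu => ?_, fun i hi hij => ?_, ?_,
    fun i hi hij => ?_, ?_, ?_⟩
  · rw [q6, nxt_succ hj0]
    simp only [Function.update_apply]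
    split_ifs
    · rfl
    · rfl
    · exact i1 u (by omega)
  · rw [q8, Function.update_apply]
    split_ifs with h
    · rw [h]
    · exact i2 i hi (by omega)
  · rw [q5, Function.update_of_ne hj0.ne, i3]
  · rw [q5]
    rcases Nat.lt_succ_iff_lt_or_eq.mp hij with hij | rfl
    · obtain ⟨a1, a2⟩ := i4 i hi hij
      rw [Function.update_of_ne hij.ne, Function.update_of_ne (by omega)]
      exact ⟨a1, a2⟩
    · rw [Function.update_self, Function.update_of_ne hlt.ne]
      exact ⟨hlt, rfl⟩
  · rw [q7, q5, hs (fun x _ => x), i5]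
  · rw [q3, q5, hs (fun x i => x * w i), i6]

theorem exec_initProg {W n : ℕ} {par : ℕ → ℕ} {len w : ℕ → ℝ} {σ : Store} (hn : σ.ivar 0 = n)
    (h0 : 0 < n) (hpar : σ.iarr 6 = par) (hlen : σ.rarr 3 = len) (hw : σ.rarr 4 = w)
    (hlt : ∀ i, 0 < i → i < n → par i < i) (hW : n + 1 ≤ W) :
    ∃ σ' t rd, Exec W initProg σ σ' t ∧ t ≤ 200 * n + 100 ∧ σ'.ivar 7 = n - 1 ∧
      (∀ i, 0 < i → i < n → σ'.rarr 7 i = wt par i) ∧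
      Radii n par len w rd (σ'.rarr 8) (σ'.rarr 9) ∧
      σ'.rvar 3 = ∑ i ∈ Finset.range n, rd i * w i := by
  obtain ⟨σ₁, t₁, e1, c1, q7, q6, q5, r7, r3, i6⟩ := Prog.wp_sound (W := W) (σ := σ)
    (.iset 7 (.sub (.var 0) (.const 1)) ⨾ .rstore 6 (.const 0) (.const 1) ⨾
      .rstore 5 (.const 0) (.const 0) ⨾ .rset 7 (.const 0) ⨾ .rset 3 (.const 0) ⨾
      .iset 6 (.const 1))
    (Q := fun τ => τ.ivar 7 = n - 1 ∧ τ.rarr 6 0 = 1 ∧ τ.rarr 5 0 = 0 ∧ τ.rvar 7 = 0 ∧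
      τ.rvar 3 = 0 ∧ τ.ivar 6 = 1) (by simp [hn]; omega)
  have f1 := e1.frame
  obtain ⟨σ₂, t₂, e2, c2, i2, -⟩ := exec_forUp (W := W) (i := 6) (l := 0) (c := initBody)
    (fun j τ => (∀ u < j, τ.rarr 6 u = nxt par j u) ∧
      (∀ i, 0 < i → i < j → τ.rarr 7 i = wt par i) ∧
      τ.rarr 5 0 = 0 ∧ (∀ i, 0 < i → i < j → par i < i ∧ τ.rarr 5 i = τ.rarr 5 (par i) + len i) ∧
      τ.rvar 7 = ∑ i ∈ Finset.range j, τ.rarr 5 i ∧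
      τ.rvar 3 = ∑ i ∈ Finset.range j, τ.rarr 5 i * w i) 60 1 n (σ₀ := σ₁) (by decide) (by decide)
    i6 ((f1.i 0 rfl).trans hn) h0 (by omega) (by omega)
    ⟨fun u hu => by
      obtain rfl : u = 0 := by omega
      simp [q6, nxt], fun i hi hi' => by omega, q5, fun i hi hi' => by omega, by simp [r7, q5],
      by simp [r3, q5]⟩
    (by
      intro j τ hj0 hj hτ hf hI
      obtain ⟨τ', t, e, ht, hI'⟩ := exec_initBody (W := W)
        ((hf.ia 6 rfl).trans ((f1.ia 6 rfl).trans hpar))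
        ((hf.ra 3 rfl).trans ((f1.ra 3 rfl).trans hlen))
        ((hf.ra 4 rfl).trans ((f1.ra 4 rfl).trans hw)) hj0 (hlt j hj0 hj) hτ hI
      exact ⟨τ', t, e, ht, by simpa using hI'⟩)
  obtain ⟨-, j7, j0, j5, s7, s3⟩ := i2
  have f2 := e2.frame
  have n2 : σ₂.ivar 0 = n := (f2.i 0 rfl).trans ((f1.i 0 rfl).trans hn)
  have w2 : σ₂.rarr 4 = w := (f2.ra 4 rfl).trans ((f1.ra 4 rfl).trans hw)
  have e3 : Exec W (.iset 6 (.const 0)) σ₂ (σ₂.setI 6 0) 2 :=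
    .iset σ₂ 6 (.const 0) 0 (IExpr.eval_eq _ (by simp))
  obtain ⟨σ₄, t₄, e4, c4, i4, -⟩ := exec_forUp (W := W) (i := 6) (l := 0) (c := radiusBody)
    (fun j τ => (∀ i < j, 0 < w i → τ.rarr 8 i = 1 / w i ∧ τ.rarr 9 i = 0) ∧
      ∀ i < j, ¬ 0 < w i → τ.rarr 8 i = 0 ∧ τ.rarr 9 i = 2 * ∑ i ∈ Finset.range n, σ₂.rarr 5 i)
    40 0 n (σ₀ := σ₂.setI 6 0) (by decide) (by decide) (by simp) (by simpa using n2) (by omega)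
    (by omega) (by omega) (by simp)
    (by
      intro j τ _ hj hτ hf ⟨hI, hI'⟩
      have r4 : τ.rarr 4 = w := (hf.ra 4 rfl).trans (by simpa using w2)
      have v7 : τ.rvar 7 = ∑ i ∈ Finset.range n, σ₂.rarr 5 i := (hf.r 7 rfl).trans (by simpa using s7)
      obtain ⟨σ', t, h1, h2, h3⟩ := Prog.wp_sound (W := W) (σ := τ) radiusBody
        (Q := fun τ => (∀ i < j + 1, 0 < w i → τ.rarr 8 i = 1 / w i ∧ τ.rarr 9 i = 0) ∧
          ∀ i < j + 1, ¬ 0 < w i → τ.rarr 8 i = 0 ∧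
            τ.rarr 9 i = 2 * ∑ i ∈ Finset.range n, σ₂.rarr 5 i) (by
          simp only [radiusBody, Prog.wp, BExpr.Ok, BExpr.Holds, IExpr.Ok, IExpr.val, RExpr.Ok,
            RExpr.val, hτ, r4, v7, Rat.cast_zero, not_le, Store.setRA_ivar, Store.setRA_rvar]
          refine ⟨by simp, fun h => ⟨trivial, trivial, trivial, ⟨trivial, trivial⟩, ?_⟩,
            fun h => ⟨trivial, ⟨trivial, trivial, h.ne'⟩, trivial, trivial, ?_⟩⟩
          · refine ⟨fun i hi hwi => ?_, fun i hi hwi => ?_⟩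
            · have hij : i ≠ j := fun he => by rw [he] at hwi; linarith
              simpa [hij] using hI i (by omega) hwi
            · by_cases hij : i = j
              · simp [hij, two_mul]
              · simpa [hij] using hI' i (by omega) hwi
          · refine ⟨fun i hi hwi => ?_, fun i hi hwi => ?_⟩
            · by_cases hij : i = j
              · simp [hij]
              · simpa [hij] using hI i (by omega) hwi
            · have hij : i ≠ j := fun he => by rw [he] at hwi; exact hwi h
              simpa [hij] using hI' i (by omega) hwi)
      exact ⟨σ', t, h1, h2.trans (by decide), by simpa using h3⟩)
  have f4 := e4.frame
  refine ⟨σ₄, _, σ₂.rarr 5, .seq _ _ _ _ _ _ _ e1 (.seq _ _ _ _ _ _ _ e2 (.seq _ _ _ _ _ _ _ e3 e4)),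
    ?_, ?_, ?_, ⟨j0, fun i hi hin => (j5 i hi hin).2, i4.1, i4.2⟩, ?_⟩
  · have : t₁ ≤ 40 := c1.trans (by decide)
    omega
  · rw [f4.i 7 rfl]
    simpa using (f2.i 7 rfl).trans q7
  · rw [f4.ra 7 rfl]
    simpa using j7
  · rw [f4.r 3 rfl]
    simpa using s3

end PCenter

/-! ### The parametric search. -/

namespace PCenter

open RealRAM

/-! ### The search -/

variable {n p W : ℕ} {N : TreeNetwork (Fin n)} {r : Fin n} {vtx : ℕ → Fin n} {par : ℕ → ℕ}
  {len w rd ra rb : ℕ → ℝ}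

/-- The sorted entries on the tape. -/
def entriesOf (σ : Store) : List (ℝ × ℝ) := seg (σ.rarr 13) (σ.rarr 14) (σ.ivar 15) (σ.ivar 16)

/-- The invariant of the search in the interval from `lo` to `hi`. -/
structure SearchCells (N : TreeNetwork (Fin n)) (p : ℕ) (par : ℕ → ℕ) (len ra rb : ℕ → ℝ) (L : ℕ)
    (lo hi : ℝ) (σ : Store) : Prop where
  lower : σ.rvar 2 = lo
  upper : σ.rvar 3 = hi
  nonneg : 0 ≤ lo
  lt : lo < hi
  infeasible : ¬ N.Feasible p lo
  feasible : N.Feasible p hi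
  begin_le : σ.ivar 15 ≤ σ.ivar 16
  end_le : σ.ivar 16 ≤ σ.ivar 14
  ordered : Ordered (entriesOf σ)
  weights : ∀ e ∈ entriesOf σ, 1 ≤ e.2
  account : Account n par len ra rb lo hi (σ.iarr 8) (entriesOf σ)
  card : (entriesOf σ).length + 3 * unseen n (σ.iarr 8) ≤ 3 * n
  tape : σ.ivar 14 + 3 * unseen n (σ.iarr 8) * (L + 3 + 3 * n) ≤ 3 * n * (L + 3 + 3 * n)

/-- The potential that bounds the number of rounds. -/
noncomputable def potential (n : ℕ) (par : ℕ → ℕ) (lo hi : ℝ) (σ : Store) : ℝ :=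
  inW lo hi (entriesOf σ) + 3 * unseenW n par (σ.iarr 8)

/-- Sorting time and tape space are charged to the steps that become seen, each of which brings at
most three entries. An entry pays `L + 3` cells for the merges of new entries and up to `3 * n`
cells for copying the old ones. Copying the old entries still costs only linear time per round,
since there are never more than `3 * n`. -/
theorem exec_collectProg {L : ℕ} {lo hi : ℝ} {σ : Store} (hs : Shape n par len) (hn : 0 < n)
    (hE : Env n p r vtx par len ra rb σ) (h : SearchCells N p par len ra rb L lo hi σ)
    (hL : 3 * n < 2 ^ L)
    (hW : 3 * n * (L + 3 + 3 * n) + 3 * n * (L + 3) + 6 * n + 10 ≤ W) :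
    ∃ σ' t, Exec W collectProg σ σ' t ∧
      t + 3 * unseen n (σ'.iarr 8) * (60 * (L + 3) + 90) ≤
        1000 * n + 300 + 3 * unseen n (σ.iarr 8) * (60 * (L + 3) + 90) ∧
      SearchCells N p par len ra rb L lo hi σ' ∧
      potential n par lo hi σ' ≤ potential n par lo hi σ ∧
      3 * unseenW n par (σ'.iarr 8) ≤ inW lo hi (entriesOf σ') ∧
      σ'.rvar 12 = inW lo hi (entriesOf σ') ∧
      (inW lo hi (entriesOf σ') ≤ 0 → ∀ i, 0 < i → i < n →
        ¬ Waiting n par len ra rb lo hi i ∧ ¬ Active n par len ra rb lo hi i) := by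
  have hcard := h.card
  have htape := h.tape
  have hbl := h.begin_le
  have hel := h.end_le
  obtain ⟨m, hm⟩ : ∃ m, σ.ivar 14 = m := ⟨_, rfl⟩
  rw [hm] at htape hel
  obtain ⟨σ₁, t₁, e1, c1, hT, hseen⟩ := exec_passProg (W := W) hs hn h.lt hE h.lower h.upper hm
    (by omega)
  obtain ⟨l, hl⟩ : ∃ l, l = newAll n par len ra rb lo hi (σ.iarr 8) (n - 1) := ⟨_, rfl⟩
  rw [← hl] at hT
  have f1 := e1.frame
  have hlen3 : l.length ≤ 3 * n := by
    rw [hl]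
    exact (length_newAll_le _).trans (by omega)
  have hmul : l.length * (L + 3) ≤ 3 * n * (L + 3) := Nat.mul_le_mul_right _ hlen3
  have hQlen : (entriesOf σ).length = σ.ivar 16 - σ.ivar 15 := length_seg
  obtain ⟨σ₂, t₂, e2, c2, b2, b2', o2, p2, top2⟩ := exec_sortProg (W := W) hT (f1.i 15 rfl)
    (f1.i 16 rfl) (L := L) (by omega) hbl hel h.ordered (by omega) (by omega)
  have f2 := e2.frame
  have lo2 : σ₂.rvar 2 = lo := (f2.r 2 rfl).trans ((f1.r 2 rfl).trans h.lower)
  have hi2 : σ₂.rvar 3 = hi := (f2.r 3 rfl).trans ((f1.r 3 rfl).trans h.upper)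
  have s2 : σ₂.iarr 8 = σ₁.iarr 8 := f2.ia 8 rfl
  rw [hl] at p2
  obtain ⟨A1, A2, A3, A4, A5⟩ := account_round hs hn h.lt h.account p2 hseen
  rw [← hl] at A4 p2
  have hlen2 := p2.length_eq
  rw [length_seg, List.length_append, length_seg] at hlen2
  have htop : σ₂.ivar 14 + 3 * unseen n (σ₁.iarr 8) * (L + 3 + 3 * n) ≤
      3 * n * (L + 3 + 3 * n) := by
    have q1 : l.length * (L + 3 + (σ.ivar 16 - σ.ivar 15)) ≤ l.length * (L + 3 + 3 * n) :=
      Nat.mul_le_mul_left _ (by omega)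
    have q2 := Nat.mul_le_mul_right (L + 3 + 3 * n) A4
    rw [Nat.add_mul] at q2
    omega
  obtain ⟨σ₃, t₃, e3, c3, r12⟩ := exec_totalProg (W := W) rfl rfl b2 (by omega) (by omega) lo2 hi2
  have f3 := e3.frame
  have i8 : σ₃.iarr 8 = σ₁.iarr 8 := (f3.ia 8 rfl).trans s2
  have hQ : entriesOf σ₃ = seg (σ₂.rarr 13) (σ₂.rarr 14) (σ₂.ivar 15) (σ₂.ivar 16) := by
    rw [entriesOf, f3.ra 13 rfl, f3.ra 14 rfl, f3.i 15 rfl, f3.i 16 rfl]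
  refine ⟨σ₃, _, .seq _ _ _ _ _ _ _ e1 (.seq _ _ _ _ _ _ _ e2 e3), ?_,
    ⟨(f3.r 2 rfl).trans lo2, (f3.r 3 rfl).trans hi2, h.nonneg, h.lt, h.infeasible, h.feasible,
      by rw [f3.i 15 rfl, f3.i 16 rfl]; exact b2, by rw [f3.i 14 rfl, f3.i 16 rfl]; exact b2',
      hQ ▸ o2, fun e he => ?_, ?_, ?_, ?_⟩, ?_, ?_, ?_, ?_⟩
  · rw [i8]
    have q2 := Nat.mul_le_mul_right (60 * (L + 3) + 90) A4
    have q3 : (l.length + 3 * unseen n (σ₁.iarr 8)) * (60 * (L + 3) + 90) =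
      60 * (l.length * (L + 3)) + 90 * l.length +
        3 * unseen n (σ₁.iarr 8) * (60 * (L + 3) + 90) := by ring
    rw [q3] at q2
    omega
  · rw [hQ, p2.mem_iff, List.mem_append] at he
    rcases he with he | he
    · exact mem_newAll (hl ▸ he)
    · exact h.weights e he
  · rw [hQ, i8]; exact A1
  · rw [hQ, i8, length_seg]
    omega
  · rw [i8, f3.i 14 rfl]
    exact htop
  · rw [potential, potential, hQ, i8]
    exact A2
  · rw [hQ, i8]; exact A3
  · rw [hQ]; exact r12
  · rw [hQ]; exact A5

/-- The upper bound is the optimal cost. -/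
structure SearchDone (N : TreeNetwork (Fin n)) (p : ℕ) (σ : Store) : Prop where
  halted : σ.ivar 22 = 0
  feasible : N.Feasible p (σ.rvar 3)
  le : ∀ β, N.Feasible p β → σ.rvar 3 ≤ β

/-- Another interval, with the entries unchanged. -/
theorem SearchCells.shrink {L : ℕ} {lo hi lo' hi' : ℝ} {σ τ : Store}
    (h : SearchCells N p par len ra rb L lo hi σ) (hl : lo ≤ lo') (hlt : lo' < hi') (hh : hi' ≤ hi)
    (hlo : ¬ N.Feasible p lo') (hhi : N.Feasible p hi') (h2 : τ.rvar 2 = lo') (h3 : τ.rvar 3 = hi')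
    (h8 : τ.iarr 8 = σ.iarr 8) (h14 : τ.ivar 14 = σ.ivar 14) (h15 : τ.ivar 15 = σ.ivar 15)
    (h16 : τ.ivar 16 = σ.ivar 16) (r13 : τ.rarr 13 = σ.rarr 13) (r14 : τ.rarr 14 = σ.rarr 14) :
    SearchCells N p par len ra rb L lo' hi' τ ∧ entriesOf τ = entriesOf σ := by
  have hQ : entriesOf τ = entriesOf σ := by
    rw [entriesOf, entriesOf, h15, h16, r13, r14]
  refine ⟨⟨h2, h3, h.nonneg.trans hl, hlt, hlo, hhi, by rw [h15, h16]; exact h.begin_le,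
    by rw [h14, h16]; exact h.end_le, hQ ▸ h.ordered, hQ ▸ h.weights, ?_, by rw [hQ, h8]; exact h.card,
    by rw [h8, h14]; exact h.tape⟩, hQ⟩
  rw [hQ, h8]
  exact fun a b ha hab hb => h.account a b (hl.trans ha) hab (hb.trans hh)

theorem exec_searchBody {L R : ℕ} {lo hi : ℝ} {σ : Store} (hLb : Labels N r vtx par len w)
    (hR : Radii n par len w rd ra rb) (hn : 0 < n)
    (hE : Env n p r vtx par len ra rb σ) (h : SearchCells N p par len ra rb L lo hi σ)
    (hL : 3 * n < 2 ^ L) (hW : 3 * n * (L + 3 + 3 * n) + 3 * n * (L + 3) + 6 * n + 10 ≤ W)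
    (hΦ : potential n par lo hi σ < (4 / 3) ^ R) (h22 : σ.ivar 22 = 1) :
    ∃ σ' t, Exec W searchBody σ σ' t ∧
      t + 3 * unseen n (σ'.iarr 8) * (60 * (L + 3) + 90) ≤
        2000 * n + 600 + 3 * unseen n (σ.iarr 8) * (60 * (L + 3) + 90) ∧
      (SearchDone N p σ' ∨ ∃ R' lo' hi', R = R' + 1 ∧ σ'.ivar 22 = 1 ∧
        SearchCells N p par len ra rb L lo' hi' σ' ∧ potential n par lo' hi' σ' < (4 / 3) ^ R') := by
  obtain ⟨σ₁, t₁, e1, c1, hC, hpot, hle, r12, hdec⟩ := exec_collectProg hLb.shape hn hE h hL hW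
  have f1 := e1.frame
  have hE1 := hE.frame f1 (by decide)
  by_cases hT : inW lo hi (entriesOf σ₁) ≤ 0
  · have hopt : ∀ β, N.Feasible p β → hi ≤ β := fun β hβ =>
      hLb.le_of_feasible hR h.nonneg h.lt hn h.infeasible (hdec hT) hβ
    refine ⟨σ₁.setI 22 0, _, .seq _ _ _ _ _ _ _ e1 (.ite_true _ _ _ _ _ _
      (BExpr.eval_true (by simp) ?_) (.iset σ₁ 22 (.const 0) 0 (IExpr.eval_eq _ (by simp)))), ?_,
      .inl ⟨by simp, ?_, ?_⟩⟩
    · simpa [r12] using hT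
    · simp only [BExpr.ops, RExpr.ops, IExpr.ops, Store.setI_iarr]
      omega
    · simpa [hC.upper] using h.feasible
    · simpa [hC.upper] using hopt
  · rw [not_le] at hT
    have hT1 := one_le_inW hC.weights hT
    have hu0 : 0 ≤ unseenW n par (σ₁.iarr 8) := Finset.sum_nonneg fun i _ => by
      have := wt_pos (par := par) i
      split_ifs <;> linarith
    -- A potential below 1 leaves no room for an entry inside the interval.
    obtain ⟨R', rfl⟩ : ∃ R', R = R' + 1 := by
      rcases R with _ | R'
      · rw [pow_zero] at hΦ
        unfold potential at hΦ hpot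
        linarith
      · exact ⟨R', rfl⟩
    have hcard := hC.card
    have htape := hC.tape
    have hle16 := hC.end_le
    have hQlen : (entriesOf σ₁).length = σ₁.ivar 16 - σ₁.ivar 15 := length_seg
    obtain ⟨σ₂, t₂, e2, c2, m1, m2, m3, m4⟩ := exec_medianProg (W := W) rfl rfl hC.begin_le
      (by omega) (by omega) hC.lower hC.upper r12 (by rw [r12]; exact hT) hC.ordered
      (fun e he => zero_le_one.trans (hC.weights e he))
    have f2 := e2.frame
    have hE2 := hE1.frame f2 (by decide)
    obtain ⟨μ, hμ⟩ : ∃ μ, σ₂.rvar 1 = μ := ⟨_, rfl⟩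
    rw [hμ] at m1 m2 m3 m4
    obtain ⟨σ₃, t₃, e3, c3, -, q3⟩ := exec_greedyProg (W := W) hLb.shape hn (by omega) hE2 hμ
    have f3 := e3.frame
    have hE3 := hE2.frame f3 (by decide)
    have hfe := hLb.feasible_iff hR (p := p) (h.nonneg.trans m1.le) hn
    rw [← q3] at hfe
    have k8 : σ₃.iarr 8 = σ₁.iarr 8 := (f3.ia 8 rfl).trans (f2.ia 8 rfl)
    have k14 : σ₃.ivar 14 = σ₁.ivar 14 := (f3.i 14 rfl).trans (f2.i 14 rfl)
    have k15 : σ₃.ivar 15 = σ₁.ivar 15 := (f3.i 15 rfl).trans (f2.i 15 rfl)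
    have k16 : σ₃.ivar 16 = σ₁.ivar 16 := (f3.i 16 rfl).trans (f2.i 16 rfl)
    have k22 : σ₃.ivar 22 = 1 := (f3.i 22 rfl).trans ((f2.i 22 rfl).trans ((f1.i 22 rfl).trans h22))
    have k1 : σ₃.rvar 1 = μ := (f3.r 1 rfl).trans hμ
    have k2 : σ₃.rvar 2 = lo := (f3.r 2 rfl).trans ((f2.r 2 rfl).trans hC.lower)
    have k3 : σ₃.rvar 3 = hi := (f3.r 3 rfl).trans ((f2.r 3 rfl).trans hC.upper)
    have kr13 : σ₃.rarr 13 = σ₁.rarr 13 := (f3.ra 13 rfl).trans (f2.ra 13 rfl)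
    have kr14 : σ₃.rarr 14 = σ₁.rarr 14 := (f3.ra 14 rfl).trans (f2.ra 14 rfl)
    -- With I inside and U unseen, the potential drops from I + 3U to at most I/2 + 3U. This is at
    -- most three quarters of I + 3U because 3U ≤ I.
    have hfin : ∀ x : ℝ, 2 * x ≤ inW lo hi (entriesOf σ₁) →
        x + 3 * unseenW n par (σ₁.iarr 8) < (4 / 3) ^ R' := by
      intro x hx
      unfold potential at hΦ hpot
      rw [pow_succ] at hΦ
      linarith
    have htest : (BExpr.rle (.var 12) (.const 0)).Ok W σ₁ ∧
        ¬ (BExpr.rle (.var 12) (.const 0)).Holds σ₁ := by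
      simpa [r12] using hT
    by_cases hf : N.Feasible p μ
    · obtain ⟨hS, hQ⟩ := hC.shrink (τ := σ₃.setR 3 μ) le_rfl m1 m2.le h.infeasible hf (by simp [k2])
        (by simp) (by simpa using k8) (by simpa using k14) (by simpa using k15) (by simpa using k16)
        (by simpa using kr13) (by simpa using kr14)
      refine ⟨σ₃.setR 3 μ, _, .seq _ _ _ _ _ _ _ e1 (.ite_false _ _ _ _ _ _
        (BExpr.eval_false htest.1 htest.2) (.seq _ _ _ _ _ _ _ e2 (.seq _ _ _ _ _ _ _ e3
        (.ite_true _ _ _ _ _ _ (BExpr.eval_true (by simp) ?_) (.rset σ₃ 3 (.var 1) μ ?_))))), ?_,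
        .inr ⟨R', lo, μ, rfl, by simpa using k22, hS, ?_⟩⟩
      · simpa [hE3.hp] using hfe.mp hf
      · rw [RExpr.eval_eq _ (by simp)]; simp [k1]
      · simp only [BExpr.ops, RExpr.ops, IExpr.ops, Store.setR_iarr, k8]
        omega
      · rw [potential, hQ]
        simpa [k8] using hfin (inW lo μ (entriesOf σ₁)) m3
    · obtain ⟨hS, hQ⟩ := hC.shrink (τ := σ₃.setR 2 μ) m1.le m2 le_rfl hf h.feasible (by simp)
        (by simp [k3]) (by simpa using k8) (by simpa using k14) (by simpa using k15)
        (by simpa using k16) (by simpa using kr13) (by simpa using kr14)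
      refine ⟨σ₃.setR 2 μ, _, .seq _ _ _ _ _ _ _ e1 (.ite_false _ _ _ _ _ _
        (BExpr.eval_false htest.1 htest.2) (.seq _ _ _ _ _ _ _ e2 (.seq _ _ _ _ _ _ _ e3
        (.ite_false _ _ _ _ _ _ (BExpr.eval_false (by simp) ?_) (.rset σ₃ 2 (.var 1) μ ?_))))), ?_,
        .inr ⟨R', μ, hi, rfl, by simpa using k22, hS, ?_⟩⟩
      · simpa [hE3.hp] using fun h' => hf (hfe.mpr h')
      · rw [RExpr.eval_eq _ (by simp)]; simp [k1]
      · simp only [BExpr.ops, RExpr.ops, IExpr.ops, Store.setR_iarr, k8]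
        omega
      · rw [potential, hQ]
        simpa [k8] using hfin (inW μ hi (entriesOf σ₁)) m4

/-- At most `R` rounds test a median; one more finds that all comparisons are decided. -/
theorem exec_searchProg {L R : ℕ} {σ : Store} (hLb : Labels N r vtx par len w)
    (hR : Radii n par len w rd ra rb) (hn : 0 < n) (hE : Env n p r vtx par len ra rb σ)
    (h : SearchDone N p σ ∨ ∃ lo hi, σ.ivar 22 = 1 ∧ SearchCells N p par len ra rb L lo hi σ ∧
      potential n par lo hi σ < (4 / 3) ^ R)
    (hL : 3 * n < 2 ^ L)
    (hW : 3 * n * (L + 3 + 3 * n) + 3 * n * (L + 3) + 6 * n + 10 ≤ W) :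
    ∃ σ' t, Exec W searchProg σ σ' t ∧
      t ≤ (R + 1) * (2000 * n + 700) + 3 * n * (60 * (L + 3) + 90) + 10 ∧ SearchDone N p σ' := by
  have hun : ∀ seen, unseen n seen ≤ n := fun seen => by
    refine (Finset.sum_le_card_nsmul _ _ 1 fun i _ => by split_ifs <;> simp).trans ?_
    simp
  obtain ⟨σ', t, m, e, hI, ht, hx⟩ := exec_loop (W := W) (b := .ile (.const 1) (.var 22))
    (c := searchBody)
    (fun m τ => SearchDone N p τ ∨ ∃ R lo hi,
      m = (R + 1) * (2000 * n + 700) + 3 * unseen n (τ.iarr 8) * (60 * (L + 3) + 90) ∧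
      τ.ivar 22 = 1 ∧ SearchCells N p par len ra rb L lo hi τ ∧
      potential n par lo hi τ < (4 / 3) ^ R) σ
    ((R + 1) * (2000 * n + 700) + 3 * unseen n (σ.iarr 8) * (60 * (L + 3) + 90))
    (h.imp id fun ⟨lo, hi, h⟩ => ⟨R, lo, hi, rfl, h⟩) (fun m τ _ _ => by simp; omega)
    (by
      rintro m τ hf (hD | ⟨R, lo, hi, rfl, h22, hS, hΦ⟩) hb
      · simp [hD.halted] at hb
      · obtain ⟨τ', t, e, ht, hD | ⟨R', lo', hi', rfl, h22', hS', hΦ'⟩⟩ :=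
          exec_searchBody hLb hR hn (hE.frame hf (by decide)) hS hL hW hΦ h22
        · refine ⟨τ', t, 0, e, .inl hD, ?_⟩
          have : 2000 * n + 700 ≤ (R + 1) * (2000 * n + 700) :=
            Nat.le_mul_of_pos_left _ (by omega)
          simp only [BExpr.ops, IExpr.ops]
          omega
        · refine ⟨τ', t, _, e, .inr ⟨R', lo', hi', rfl, h22', hS', hΦ'⟩, ?_⟩
          have : (R' + 1 + 1) * (2000 * n + 700) = (R' + 1) * (2000 * n + 700) +
            (2000 * n + 700) := by ring
          simp only [BExpr.ops, IExpr.ops]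
          omega)
  refine ⟨σ', t, e, ?_, ?_⟩
  · have := Nat.mul_le_mul_right (60 * (L + 3) + 90) (Nat.mul_le_mul_left 3 (hun (σ.iarr 8)))
    simp only [BExpr.ops, IExpr.ops] at ht
    omega
  · rcases hI with hD | ⟨R, lo, hi, -, h22, -⟩
    · exact hD
    · simp [h22] at hx

end PCenter

/-! ### The whole program and its running time. -/

namespace PCenter

open RealRAM

variable {n p W : ℕ} {N : TreeNetwork (Fin n)} {r : Fin n} {vtx : ℕ → Fin n} {par : ℕ → ℕ}
  {len w rd ra rb : ℕ → ℝ}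

/-! ### The whole program -/

/-- The search needs an infeasible lower end. If the cost 0 is feasible it is optimal; otherwise it
is that end, and the feasible upper end is positive. -/
theorem exec_startProg {R : ℕ} (L : ℕ) {σ : Store} (hLb : Labels N r vtx par len w)
    (hR : Radii n par len w rd ra rb) (hn : 0 < n) (hp : 1 ≤ p)
    (hE : Env n p r vtx par len ra rb σ) (h3 : σ.rvar 3 = ∑ i ∈ Finset.range n, rd i * w i)
    (h8 : σ.iarr 8 = fun _ => 0) (hΦ : 3 * unseenW n par (fun _ => 0) < (4 / 3) ^ R)
    (hW : n + 1 ≤ W) :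
    ∃ σ' t, Exec W startProg σ σ' t ∧ t ≤ 200 * n + 150 ∧
      (SearchDone N p σ' ∨ ∃ lo hi, σ'.ivar 22 = 1 ∧ SearchCells N p par len ra rb L lo hi σ' ∧
        potential n par lo hi σ' < (4 / 3) ^ R) := by
  have e0 : Exec W (.rset 1 (.const 0)) σ (σ.setR 1 0) 2 :=
    .rset σ 1 (.const 0) 0 (by rw [RExpr.eval_eq _ (by simp)]; simp)
  have hE0 := hE.frame e0.frame (by decide)
  obtain ⟨σ₁, t₁, e1, c1, -, q1⟩ := exec_greedyProg (W := W) (α := 0) hLb.shape hn hW hE0 (by simp)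
  have f1 := e1.frame
  have hE1 := hE0.frame f1 (by decide)
  have k3 : σ₁.rvar 3 = ∑ i ∈ Finset.range n, rd i * w i := (f1.r 3 rfl).trans (by simpa using h3)
  have k8 : σ₁.iarr 8 = fun _ => 0 := (f1.ia 8 rfl).trans (by simpa using h8)
  have hfe := hLb.feasible_iff hR (p := p) le_rfl hn
  rw [← q1] at hfe
  have hsum := hLb.feasible_sum hR hp
  obtain ⟨σ₂, t₂, e2, c2, h2⟩ := Prog.wp_sound (W := W) (σ := σ₁)
    (.rset 2 (.const 0) ⨾ .iset 14 (.const 0) ⨾ .iset 15 (.const 0) ⨾ .iset 16 (.const 0) ⨾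
      .ite (.ile (.var 12) (.var 1)) (.rset 3 (.const 0) ⨾ .iset 22 (.const 0)) (.iset 22 (.const 1)))
    (Q := fun τ => SearchDone N p τ ∨ ∃ lo hi, τ.ivar 22 = 1 ∧
      SearchCells N p par len ra rb L lo hi τ ∧ potential n par lo hi τ < (4 / 3) ^ R) (by
      simp only [Prog.wp, BExpr.Ok, BExpr.Holds, IExpr.Ok, IExpr.val, RExpr.Ok, RExpr.val,
        Store.setI_ivar, Store.setR_ivar, Nat.reduceEqDiff, if_false, Rat.cast_zero, hE1.hp]
      refine ⟨trivial, by omega, by omega, by omega, by simp, fun h => ⟨trivial, by omega, .inl ?_⟩,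
        fun h => ⟨by omega, .inr ⟨0, ∑ i ∈ Finset.range n, rd i * w i, by simp, ?_⟩⟩⟩
      · have h0 : N.Feasible p 0 := hfe.mpr (by simpa [hE1.hp] using h)
        exact ⟨by simp, by simpa using h0, fun β hβ => by simpa using hβ.nonneg r⟩
      · have h0 : ¬ N.Feasible p 0 := fun h' => h (by simpa [hE1.hp] using hfe.mp h')
        have hun : unseen n (fun _ => 0) ≤ n := by simp [unseen]
        have hpos : 0 < ∑ i ∈ Finset.range n, rd i * w i := by
          rcases (hsum.nonneg r).lt_or_eq with h' | h'
          · exact h'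
          · exact absurd (h' ▸ hsum) h0
        refine ⟨⟨by simp, by simpa using k3, le_rfl, hpos, h0, hsum, by simp, by simp,
          by simp [entriesOf, seg_self, Ordered], by simp [entriesOf, seg_self],
          fun lo' hi' _ _ _ => by simp [entriesOf, seg_self, k8], ?_, ?_⟩, ?_⟩
        · simp only [entriesOf, length_seg, Store.setI_iarr, Store.setR_iarr, k8]
          simp
          omega
        · simp only [Store.setI_iarr, Store.setR_iarr, k8]
          simpa using hun
        · simpa [potential, entriesOf, seg_self, k8] using hΦ)
  refine ⟨σ₂, _, .seq _ _ _ _ _ _ _ e0 (.seq _ _ _ _ _ _ _ e1 e2), ?_, h2⟩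
  have : t₂ ≤ 40 := c2.trans (by decide)
  omega

/-- The greedy run at the optimal cost writes the centers below the root. The remaining positions
get the root, which also provides the center there when one is needed. -/
theorem exec_outputProg {σ : Store} (hLb : Labels N r vtx par len w)
    (hR : Radii n par len w rd ra rb) (hn : 0 < n)
    (hE : Env n p r vtx par len ra rb σ) (h : SearchDone N p σ) (hW : n + 1 ≤ W) (hpW : p ≤ W) :
    ∃ σ' t, Exec W outputProg σ σ' t ∧ t ≤ 200 * n + 30 * p + 150 ∧ N.IsSolution p σ' := by
  obtain ⟨α, hα⟩ : ∃ α, σ.rvar 3 = α := ⟨_, rfl⟩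
  have hfe := h.feasible
  have hopt := h.le
  rw [hα] at hfe hopt
  have hα0 := hfe.nonneg r
  have hcount := (hLb.feasible_iff hR hα0 hn).mp hfe
  obtain ⟨c, hc, hcode⟩ := hLb.exists_covers hR hα0 hn hcount
  obtain ⟨s, hs⟩ : ∃ s, s = greedy n par len (fun i => ra i * α + rb i) (n - 1) := ⟨_, rfl⟩
  rw [← hs] at hcount hcode
  have hle : s.cs.length ≤ p := le_trans (Nat.le_add_right _ _) hcount
  have e0 : Exec W (.rset 1 (.var 3)) σ (σ.setR 1 α) 2 :=
    .rset σ 1 (.var 3) α (by rw [RExpr.eval_eq _ (by simp)]; simp [hα])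
  have hE0 := hE.frame e0.frame (by decide)
  obtain ⟨σ₁, t₁, e1, c1, hG, -⟩ := exec_greedyProg (W := W) (α := α) hLb.shape hn hW hE0 (by simp)
  rw [← hs] at hG
  have f1 := e1.frame
  have hE1 := hE0.frame f1 (by decide)
  have k3 : σ₁.rvar 3 = α := (f1.r 3 rfl).trans (by simpa using hα)
  have e2 : Exec W (.iset 6 (.var 11)) σ₁ (σ₁.setI 6 s.cs.length) 2 :=
    .iset σ₁ 6 (.var 11) _ (by rw [IExpr.eval_eq _ (by simp)]; simp [hG.len])
  have hE2 := hE1.frame e2.frame (by decide)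
  obtain ⟨σ₃, t₃, e3, c3, ⟨i3, j3⟩, -⟩ := exec_forUp (W := W) (i := 6) (l := 1)
    (c := .istore 1 (.var 6) (.var 2) ⨾ .istore 2 (.var 6) (.var 2) ⨾
      .rstore 2 (.var 6) (.const 0))
    (fun j τ => (∀ j c, s.cs[j]? = some c →
        τ.iarr 1 j = vtx c.1 ∧ τ.iarr 2 j = vtx (par c.1) ∧ τ.rarr 2 j = c.2) ∧
      ∀ i, s.cs.length ≤ i → i < j → τ.iarr 1 i = r ∧ τ.iarr 2 i = r ∧ τ.rarr 2 i = 0) 20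
    s.cs.length p (σ₀ := σ₁.setI 6 s.cs.length) (by decide) (by decide) (by simp) hE2.hp hle hpW
    (by omega) ⟨by simpa using hG.cs, fun i hi hi' => by omega⟩
    (by
      intro j τ hlj hj hτ hf ⟨hI, hI'⟩
      have hEτ := hE2.frame hf (by decide)
      obtain ⟨σ', t, h1, h2, h3⟩ := Prog.wp_sound (W := W) (σ := τ)
        (.istore 1 (.var 6) (.var 2) ⨾ .istore 2 (.var 6) (.var 2) ⨾ .rstore 2 (.var 6) (.const 0))
        (Q := fun τ' => τ'.iarr 1 = Function.update (τ.iarr 1) j r ∧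
          τ'.iarr 2 = Function.update (τ.iarr 2) j r ∧
          τ'.rarr 2 = Function.update (τ.rarr 2) j 0) (by simp [hτ, hEτ.hroot])
      obtain ⟨h3, h4, h5⟩ := h3
      refine ⟨σ', t, h1, h2.trans (by decide), fun i c hic => ?_, fun i hi hij => ?_⟩
      · have hij : i ≠ j := by
          obtain ⟨hil, -⟩ := List.getElem?_eq_some_iff.mp hic
          omega
        simpa [h3, h4, h5, hij] using hI i c hic
      · by_cases hij' : i = j
        · simp [h3, h4, h5, hij']
        · simpa [h3, h4, h5, hij'] using hI' i hi (by omega))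
  have k3' : σ₃.rvar 3 = α := (e3.frame.r 3 rfl).trans (by simpa using k3)
  have e4 : Exec W (.rset 0 (.var 3)) σ₃ (σ₃.setR 0 α) 2 :=
    .rset σ₃ 0 (.var 3) α (by rw [RExpr.eval_eq _ (by simp)]; simp [k3'])
  refine ⟨_, _, .seq _ _ _ _ _ _ _ e0 (.seq _ _ _ _ _ _ _ e1 (.seq _ _ _ _ _ _ _ e2
    (.seq _ _ _ _ _ _ _ e3 e4))), ?_, c, fun i => ?_, ?_, ?_⟩
  · omega
  · rw [hcode i]
    split_ifs with hi
    · obtain ⟨a1, a2, a3⟩ := i3 i _ (List.getElem?_eq_getElem hi)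
      simp [a1, a2, a3]
    · obtain ⟨a1, a2, a3⟩ := j3 i (by omega) i.2
      simp [a1, a2, a3]
  · simpa using hc
  · simpa using hopt

theorem Labels.card_children_le (hLb : Labels N r vtx par len w) (hb : N.IsBinary r) (u : ℕ) :
    ((Finset.range n).filter (fun i => 0 < i ∧ par i = u)).card ≤ 2 := by
  classical
  have h := hb (vtx u)
  have hsub : (((Finset.range n).filter (fun i => 0 < i ∧ par i = u)).image vtx : Set (Fin n)) ⊆
      {x | x ≠ r ∧ N.parent r x = vtx u} := by
    intro x hx
    simp only [Finset.coe_image, Set.mem_image, Finset.mem_coe, Finset.mem_filter,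
      Finset.mem_range] at hx
    obtain ⟨i, ⟨hi, h0, rfl⟩, rfl⟩ := hx
    exact ⟨hLb.ne_root h0 hi, hLb.par_eq i h0 hi⟩
  have h2 := (Set.encard_le_encard hsub).trans h
  rw [Set.encard_coe_eq_coe_finsetCard, Finset.card_image_of_injOn] at h2
  · exact_mod_cast h2
  · intro i hi j hj hij
    simp only [Finset.coe_filter, Finset.mem_range, Set.mem_ofPred_eq] at hi hj
    exact hLb.inj i hi.1 j hj.1 hij

/-- This is the potential before the first round, when there are no entries yet. -/
theorem Labels.three_mul_unseenW_lt (hLb : Labels N r vtx par len w) (hb : N.IsBinary r) {H : ℕ}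
    (hH : ∀ v, (N.path v r).length ≤ H) (hn : 0 < n) :
    3 * unseenW n par (fun _ => 0) < 3 * n * 16 ^ H := by
  have h1 : unseenW n par (fun _ => 0) ≤ ∑ i ∈ Finset.Ico 1 n, (16 : ℝ) ^ H := by
    refine Finset.sum_le_sum fun i hi => ?_
    obtain ⟨h0, hin⟩ := Finset.mem_Ico.mp hi
    rw [if_pos rfl]
    refine (wt_le hLb.shape (hLb.card_children_le hb) (dep := fun i => (N.path (vtx i) r).length)
      (fun i h0 hi => ?_) h0 hin).trans (pow_le_pow_right₀ (by norm_num) (hH _))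
    rw [← hLb.par_eq i h0 hi]
    exact TreeNetwork.length_path (hLb.ne_root h0 hi)
  rw [Finset.sum_const, Nat.card_Ico, nsmul_eq_mul, Nat.cast_sub hn] at h1
  have : (0 : ℝ) < 16 ^ H := by positivity
  push_cast at h1
  linarith

-- The default `r` only makes the labelling total; it is never used for labels below `n`.
open Classical in
theorem LabelCells.labels {σ : Store} (h : LabelCells n r n σ)
    (h0 : σ.iarr 0 = (N.input r p).iarr 0) (h1 : σ.rarr 0 = (N.input r p).rarr 0)
    (h2 : σ.rarr 1 = (N.input r p).rarr 1) :
    Labels N r (fun i => if h : σ.iarr 4 i < n then ⟨σ.iarr 4 i, h⟩ else r) (σ.iarr 6) (σ.rarr 3)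
      (σ.rarr 4) := by
  have hn : 0 < n := by have := r.2; omega
  refine ⟨fun i hi j hj hij => ?_, ?_, fun i hi0 hi => (h.child i hi0 hi).1, fun i hi0 hi => ?_,
    fun i hi0 hi => ?_, fun i hi => ?_⟩
  · simp only [dif_pos (h.lt i hi), dif_pos (h.lt j hj), Fin.mk.injEq] at hij
    exact h.inj hi hj hij
  · simp [h.root]
  · obtain ⟨a1, a2, -⟩ := h.child i hi0 hi
    have hl := h.lt i hi
    have hl' := h.lt (σ.iarr 6 i) (by omega)
    simp only [dif_pos hl, dif_pos hl']
    refine Fin.ext ?_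
    simp [a2, h0, TreeNetwork.input, hl]
  · obtain ⟨-, -, a3⟩ := h.child i hi0 hi
    have hl := h.lt i hi
    simp [a3, h1, TreeNetwork.input, hl]
  · have hl := h.lt i hi
    simp [h.weight i hi, h2, TreeNetwork.input, hl]

theorem exec_mainProg {H L R : ℕ} (hp : 1 ≤ p) (hb : N.IsBinary r)
    (hH : ∀ v, (N.path v r).length ≤ H) (hL : 3 * n < 2 ^ L)
    (hR : (3 * n * 16 ^ H : ℝ) ≤ (4 / 3) ^ R)
    (hW : 3 * n * (L + 3 + 3 * n) + 3 * n * (L + 3) + 6 * n + 10 ≤ W) (hpW : p ≤ W) :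
    ∃ σ t, Exec W mainProg (N.input r p) σ t ∧ N.IsSolution p σ ∧
      t ≤ (H + 1) * (69 * n + 20) + (R + 1) * (2000 * n + 700) + 3 * n * (60 * (L + 3) + 90) +
        600 * n + 30 * p + 600 := by
  have hn : 0 < n := by have := r.2; omega
  have hnW : n + 1 ≤ W := by omega
  obtain ⟨σ₁, t₁, e1, c1, hC⟩ := exec_labelProg (W := W) (n := n) (r := r) (H := H)
    (dep := fun v => if h : v < n then (N.path ⟨v, h⟩ r).length else 0) (σ := N.input r p)
    (by simp [TreeNetwork.input]) (by simp [TreeNetwork.input]) r.2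
    (by ext; simp [TreeNetwork.input]) (by ext; simp [TreeNetwork.input])
    (fun v hv => by simp [TreeNetwork.input, hv])
    (fun v hv hvr => by
      have hne : (⟨v, hv⟩ : Fin n) ≠ r := fun h => hvr (by rw [← h])
      have hpv : (N.input r p).iarr 0 v = N.parent r ⟨v, hv⟩ := by simp [TreeNetwork.input, hv]
      rw [hpv]
      simp [hv, TreeNetwork.length_path hne])
    (fun v hv => by simp [hv, hH]) hnW
  have f1 := e1.frame
  have hLb := hC.labels (N := N) (p := p) (f1.ia 0 rfl) (f1.ra 0 rfl) (f1.ra 1 rfl)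
  obtain ⟨σ₂, t₂, rd, e2, c2, k7, kw, hRd, k3⟩ := exec_initProg (W := W)
    ((f1.i 0 rfl).trans (by simp [TreeNetwork.input])) hn rfl rfl rfl hLb.par_lt hnW
  have f2 := e2.frame
  have hE : Env n p r (fun i => if h : σ₁.iarr 4 i < n then ⟨σ₁.iarr 4 i, h⟩ else r) (σ₁.iarr 6)
      (σ₁.rarr 3) (σ₂.rarr 8) (σ₂.rarr 9) σ₂ := by
    refine ⟨(f2.i 0 rfl).trans ((f1.i 0 rfl).trans (by simp [TreeNetwork.input])),
      (f2.i 1 rfl).trans ((f1.i 1 rfl).trans (by simp [TreeNetwork.input])),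
      (f2.i 2 rfl).trans ((f1.i 2 rfl).trans (by simp [TreeNetwork.input])), k7, fun i hi => ?_,
      f2.ia 6 rfl, f2.ra 3 rfl, kw, rfl, rfl⟩
    rw [f2.ia 4 rfl, dif_pos (hC.lt i hi)]
  have k8 : σ₂.iarr 8 = fun _ => 0 := (f2.ia 8 rfl).trans ((f1.ia 8 rfl).trans
    (by ext; simp [TreeNetwork.input]))
  obtain ⟨σ₃, t₃, e3, c3, h3⟩ := exec_startProg (W := W) (R := R) L hLb hRd hn hp hE k3 k8
    ((hLb.three_mul_unseenW_lt hb hH hn).trans_le hR) hnW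
  have hE3 := hE.frame e3.frame (by decide)
  obtain ⟨σ₄, t₄, e4, c4, h4⟩ := exec_searchProg (W := W) hLb hRd hn hE3 h3 hL hW
  have hE4 := hE3.frame e4.frame (by decide)
  obtain ⟨σ₅, t₅, e5, c5, h5⟩ := exec_outputProg (W := W) hLb hRd hn hE4 h4 hnW hpW
  refine ⟨σ₅, _, .seq _ _ _ _ _ _ _ e1 (.seq _ _ _ _ _ _ _ e2 (.seq _ _ _ _ _ _ _ e3
    (.seq _ _ _ _ _ _ _ e4 e5))), h5, ?_⟩
  omega

/-! ### The running time -/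

/-- Three rounds gain more than a factor 2, as (4/3)³ > 2, and ten gain more than 16, as (4/3)¹⁰ >
16. The bound by the logarithm rests on 3n ≤ n³ and log 2 ≥ 1/2. -/
theorem exists_rounds (H : ℕ) (hn : 2 ≤ n) : ∃ L : ℕ, 3 * n < 2 ^ L ∧ L ≤ 3 * n ∧
    (L : ℝ) ≤ 8 * Real.log n ∧ (3 * n * 16 ^ H : ℝ) ≤ (4 / 3) ^ (3 * L + 10 * H) := by
  have hlog : 1 / 2 ≤ Real.log 2 := by linarith [Real.log_two_gt_d9]
  have hlogn : Real.log 2 ≤ Real.log n :=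
    Real.log_le_log (by norm_num) (by exact_mod_cast hn)
  refine ⟨Nat.log 2 (3 * n) + 1, Nat.lt_pow_succ_log_self (by norm_num) _, ?_, ?_, ?_⟩
  · have h1 : Nat.log 2 (3 * n) < 3 * n := Nat.log_lt_self 2 (by omega)
    omega
  · have h1 : 2 ^ Nat.log 2 (3 * n) ≤ 3 * n := Nat.pow_log_le_self 2 (by omega)
    have h2 : 3 * n ≤ n ^ 3 := by
      rw [pow_succ]
      exact Nat.mul_le_mul_right n (by nlinarith)
    have h3 : ((2 : ℝ) ^ Nat.log 2 (3 * n)) ≤ (n : ℝ) ^ 3 := by exact_mod_cast h1.trans h2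
    have h4 := Real.log_le_log (by positivity) h3
    rw [Real.log_pow, Real.log_pow] at h4
    push_cast at h4 ⊢
    have h5 : (0 : ℝ) ≤ Nat.log 2 (3 * n) := Nat.cast_nonneg _
    nlinarith
  · have h1 : (3 * n : ℝ) ≤ 2 ^ (Nat.log 2 (3 * n) + 1) := by
      exact_mod_cast (Nat.lt_pow_succ_log_self (by norm_num) (3 * n)).le
    rw [pow_add, pow_mul, pow_mul]
    have h2 : (2 : ℝ) ^ (Nat.log 2 (3 * n) + 1) ≤ ((4 / 3 : ℝ) ^ 3) ^ (Nat.log 2 (3 * n) + 1) :=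
      pow_le_pow_left₀ (by norm_num) (by norm_num) _
    have h3 : (16 : ℝ) ^ H ≤ ((4 / 3 : ℝ) ^ 10) ^ H :=
      pow_le_pow_left₀ (by norm_num) (by norm_num) _
    exact mul_le_mul (h1.trans h2) h3 (by positivity) (by positivity)

/-- For p ≤ 2n the first summand suffices. For larger p the logarithm of n/p is at most -log 2, so
its square is at least 1/4 and the second summand dominates p; the second summand is needed for
nothing else. -/
theorem cast_le_padding (n p : ℕ) (hn : 2 ≤ n) (hp : 1 ≤ p) :
    (p : ℝ) ≤ 4 * (n * Real.log n + (p : ℝ) ^ 2 * Real.log ((n : ℝ) / p) ^ 2) := by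
  have hlog : 1 / 2 ≤ Real.log 2 := by linarith [Real.log_two_gt_d9]
  have hlogn : Real.log 2 ≤ Real.log n :=
    Real.log_le_log (by norm_num) (by exact_mod_cast hn)
  have hn' : (2 : ℝ) ≤ n := by exact_mod_cast hn
  have hp' : (1 : ℝ) ≤ p := by exact_mod_cast hp
  have h0 : 0 ≤ (p : ℝ) ^ 2 * Real.log ((n : ℝ) / p) ^ 2 := by positivity
  by_cases h : p ≤ 2 * n
  · have h' : (p : ℝ) ≤ 2 * n := by exact_mod_cast h
    nlinarith
  · have h' : (2 * n : ℝ) ≤ p := by exact_mod_cast (not_le.mp h).le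
    have h1 : Real.log ((n : ℝ) / p) ≤ -Real.log 2 := by
      rw [← Real.log_inv]
      refine Real.log_le_log (by positivity) ?_
      rw [div_le_iff₀ (by linarith)]
      linarith
    have h2 : 1 / 4 ≤ Real.log ((n : ℝ) / p) ^ 2 := by nlinarith
    have h3 : (p : ℝ) ≤ (p : ℝ) ^ 2 := by nlinarith
    have h4 : 0 ≤ (n : ℝ) * Real.log n := by
      have : 0 ≤ Real.log n := by linarith
      positivity
    nlinarith

/-- Addresses on the tape stay quadratic in n. The spare factor (n + p)⁴ ≥ 81 absorbs the constants,
since n + p ≥ 3. -/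
theorem word_bound {n p L : ℕ} (hn : 2 ≤ n) (hp : 1 ≤ p) (hL : L ≤ 3 * n) :
    3 * n * (L + 3 + 3 * n) + 3 * n * (L + 3) + 6 * n + 10 ≤ (n + p) ^ 6 := by
  have h1 : 3 * n * (L + 3 + 3 * n) ≤ 3 * n * (3 * n + 3 + 3 * n) :=
    Nat.mul_le_mul_left _ (by omega)
  have h2 : 3 * n * (L + 3) ≤ 3 * n * (3 * n + 3) := Nat.mul_le_mul_left _ (by omega)
  have h3 : 81 * (n + p) ^ 2 ≤ (n + p) ^ 6 := by
    have : 3 ^ 4 ≤ (n + p) ^ 4 := Nat.pow_le_pow_left (by omega) 4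
    calc 81 * (n + p) ^ 2 ≤ (n + p) ^ 4 * (n + p) ^ 2 := Nat.mul_le_mul_right _ (by omega)
      _ = (n + p) ^ 6 := by ring
  have h4 : n ^ 2 ≤ (n + p) ^ 2 := Nat.pow_le_pow_left (by omega) 2
  nlinarith

end PCenter

theorem theorem2 :
    ∃ (prog : RealRAM.Prog) (k : ℕ), ∀ K : ℝ, ∃ C : ℝ,
      ∀ (n p : ℕ) (N : TreeNetwork (Fin n)) (r : Fin n),
        2 ≤ n → 1 ≤ p → N.IsBinary r → N.IsBalanced r K →
          ∃ (σ : RealRAM.Store) (t : ℕ),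
            RealRAM.Exec ((n + p) ^ k) prog (N.input r p) σ t ∧
            N.IsSolution p σ ∧
            (t : ℝ) ≤ C * ((n : ℝ) * Real.log n
              + (p : ℝ) ^ 2 * Real.log ((n : ℝ) / p) ^ 2) := by
  -- Only the constant depends on `K`. Passing to `|K|` makes the height bound nonnegative, so that
  -- its floor may serve as the integer height `H`.
  refine ⟨PCenter.mainProg, 6, fun K => ⟨100000 + 30000 * |K|, fun n p N r hn hp hb hK => ?_⟩⟩
  have hlog : 1 / 2 ≤ Real.log n := by
    have : Real.log 2 ≤ Real.log n := Real.log_le_log (by norm_num) (by exact_mod_cast hn)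
    linarith [Real.log_two_gt_d9]
  have hn' : (2 : ℝ) ≤ n := by exact_mod_cast hn
  have hlen : ∀ v, ((N.path v r).length : ℝ) ≤ |K| * Real.log n := fun v => by
    have h := hK v
    rw [Nat.card_fin] at h
    exact h.trans (mul_le_mul_of_nonneg_right (le_abs_self K) (by linarith))
  have hH : ∀ v, (N.path v r).length ≤ ⌊|K| * Real.log n⌋₊ := fun v => Nat.le_floor (hlen v)
  have hHle : (⌊|K| * Real.log n⌋₊ : ℝ) ≤ |K| * Real.log n :=
    Nat.floor_le (mul_nonneg (abs_nonneg K) (by linarith))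
  obtain ⟨H, hHd⟩ : ∃ H, ⌊|K| * Real.log n⌋₊ = H := ⟨_, rfl⟩
  rw [hHd] at hH hHle
  obtain ⟨L, hL, hLn, hLl, hR⟩ := PCenter.exists_rounds H hn
  have hpW : p ≤ (n + p) ^ 6 :=
    (Nat.le_add_left p n).trans (Nat.le_self_pow (by norm_num) _)
  obtain ⟨σ, t, he, hs, ht⟩ := PCenter.exec_mainProg hp hb hH hL hR
    (PCenter.word_bound hn hp hLn) hpW
  refine ⟨σ, t, he, hs, ?_⟩
  have hpad := PCenter.cast_le_padding n p hn hp
  have ht' : (t : ℝ) ≤ (H + 1) * (69 * n + 20) + (3 * L + 10 * H + 1) * (2000 * n + 700) +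
      3 * n * (60 * (L + 3) + 90) + 600 * n + 30 * p + 600 := by exact_mod_cast ht
  obtain ⟨x, hx⟩ : ∃ x, x = (n : ℝ) * Real.log n := ⟨_, rfl⟩
  obtain ⟨y, hy⟩ : ∃ y, y = (p : ℝ) ^ 2 * Real.log ((n : ℝ) / p) ^ 2 := ⟨_, rfl⟩
  rw [← hx, ← hy] at hpad ⊢
  have hy0 : 0 ≤ y := by rw [hy]; positivity
  have hnx : (n : ℝ) ≤ 2 * x := by rw [hx]; nlinarith
  have hHx : (H : ℝ) * n ≤ |K| * x := by rw [hx]; nlinarith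
  have hLx : (L : ℝ) * n ≤ 8 * x := by rw [hx]; nlinarith
  have hH0 : (H : ℝ) ≤ H * n := le_mul_of_one_le_right (Nat.cast_nonneg _) (by linarith)
  have hL0 : (L : ℝ) ≤ L * n := le_mul_of_one_le_right (Nat.cast_nonneg _) (by linarith)
  have hKy : 0 ≤ |K| * y := mul_nonneg (abs_nonneg K) hy0
  have hKx : 0 ≤ |K| * x := mul_nonneg (abs_nonneg K) (by linarith)
  linarith
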